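/- **Setting.** Consider $\min_{x\in\mathcal X}F(x)$, $F(x)=\frac1n\sum_{i=1}^n f_i(g_i(x))+r(x)$, where $\mathcal X\subseteq\mathbb R^d$ is closed and convex, $r:\mathbb R^d\to(-\infty,\infty]$ on $\mathcal X$ is proper, lower semicontinuous and $\mu$-strongly convex ($\mu>0$), and $g_i(x)=\mathbb E_{\zeta\sim\mathbb P_i}[g_i(x;\zeta)]\in\mathbb R^m$. Let $\|\cdot\|_*$ be a norm on $\mathbb R^m$, $\|\cdot\|$ its dual norm. Assume for every $i$: * each coordinate of $g_i$ is convex on $\mathcal X$, $\|g_i(x)-g_i(x')\|_*\le C_g\|x-x'\|_2$ on $\mathcal X$; the stochastic (sub)gradient $g_i'(x;\zeta)$ has mean $g_i'(x)\in\partial g_i(x)$ (the gradient, if $g_i$ is affine or smooth) with $\|g_i'(x)(x'-x)\|_*\le C_g\|x'-x\|_2$ for $x,x'\in\mathcal X$; * $f_i:\mathbb R^m\to\mathbb R$ is convex, $C_f$-Lipschitz and $L_f$-smooth with respect to $\|\cdot\|_*$, and it is non-decreasing in each coordinate unless $g_i$ is affine on $\mathcal X$; * for $x\in\mathcal X$,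 $y^{(j)}\in\mathcal Y_j:=\operatorname{dom}f_j^*$: $\ \mathbb E\|g_i(x)-g_i(x;\zeta)\|_*^2\le\sigma_0^2$, $\ \mathbb E\|g_i'(x)-g_i'(x;\zeta)\|_{\rm op}^2\le\sigma_1^2$, $\ \frac1n\sum_j\big\|[g_j'(x)]^\top y^{(j)}-\frac1n\sum_k[g_k'(x)]^\top y^{(k)}\big\|_2^2\le\delta^2$. **Algorithm (ALEXR).** For each $i$ the function $\psi_i$ is either $f_i^*$, or a function that is differentiable on $\mathcal Y_i$, $\mu_\psi$-strongly convex there with respect to $\|\cdot\|$, and satisfies $U_{f_i^*}\ge\rho\,U_{\psi_i}$ on $\mathcal Y_i$ ($\mu_\psi,\rho>0$), where $U_\psi(a,y)=\psi(a)-\psi(y)-\langle\psi'(y),a-y\rangle$ is the Bregman divergence. Start at $x_{-1}=x_0\in\mathcal X$ and $y_0^{(i)}\in\mathcal Y_i$ (with a subgradient $u_0^{(i)}\in\partial f_i^*(y_0^{(i)})$ if $\psi_i=f_i^*$). In iteration $t$ draw $\mathcal S_t\subseteq\{1,\dots,n\}$ uniformly among the subsets of size $S$ and, independently, batches $\mathcal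 B_t^{(i)},\tilde{\mathcal B}_t^{(i)}$ of $B$ i.i.d. samples from $\mathbb P_i$; all draws are independent. With $g_i(x;\mathcal B)$, $g_i'(x;\mathcal B)$ the batch averages, for $i\in\mathcal S_t$ put $\tilde g_t^{(i)}=g_i(x_t;\mathcal B_t^{(i)})+\theta\,(g_i(x_t;\mathcal B_t^{(i)})-g_i(x_{t-1};\mathcal B_t^{(i)}))$ and $$y_{t+1}^{(i)}=\arg\max_{v\in\mathcal Y_i}\{\langle v,\tilde g_t^{(i)}\rangle-f_i^*(v)-\tau U_{\psi_i}(v,y_t^{(i)})\},$$ and $y_{t+1}^{(i)}=y_t^{(i)}$ for $i\notin\mathcal S_t$; if $\psi_i=f_i^*$, the subgradient used in $U_{\psi_i}(\cdot,y_t^{(i)})$ is $u_t^{(i)}$, where $u_{t+1}^{(i)}=(\tau u_t^{(i)}+\tilde g_t^{(i)})/(1+\tau)$ for $i\in\mathcal S_t$ and $u_{t+1}^{(i)}=u_t^{(i)}$ otherwise. Then $$x_{t+1}=\arg\min_{x\in\mathcal X}\Big\{\langle G_t,x\rangle+r(x)+\tfrac\eta2\|x-x_t\|_2^2\Big\},\qquad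 G_t=\frac1S\sum_{i\in\mathcal S_t}[g_i'(x_t;\tilde{\mathcal B}_t^{(i)})]^\top y_{t+1}^{(i)}.$$ Let $x_*$ be the minimizer of $F$ over $\mathcal X$, $y_*^{(i)}=\nabla f_i(g_i(x_*))$, and $\Delta_0=\frac\mu2\|x_0-x_*\|_2^2+\frac1n\sum_i U_{\psi_i}(y_*^{(i)},y_0^{(i)})$. **Theorem.** (i) There are $c\in(0,1)$ and $K>0$, depending only on $(\mathbb R^m,\|\cdot\|_*)$, $C_f,L_f,C_g,L_g,\mu_\psi,\rho,\sigma_0,\sigma_1,\delta$ (and so not on $d,n,S,B,\mu,\varepsilon$ or the rest of the problem), such that the following holds. Let every $g_i$ be $L_g$-smooth on $\mathcal X$, that is, differentiable with $\|g_i(x')-g_i(x)-\nabla g_i(x)(x'-x)\|_*\le\frac{L_g}2\|x'-x\|_2^2$. Let $1\le S\le n$, $B\ge1$, $0<\varepsilon\le 1/B$, $M=\max\{\frac1{\mu S},\frac1{\mu B},\frac n{BS}\}$. Then ALEXR with $$\theta=1-\frac{c\,\varepsilon}{M},\qquad \eta=\frac{\mu\theta}{1-\theta},\qquad \tau=\frac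 S{n(1-\theta)}$$ satisfies $\frac\mu2\,\mathbb E\|x_T-x_*\|_2^2\le\varepsilon$ for every $T\ge K\,\frac M\varepsilon\,\log\!\big(2+\frac{\Delta_0}\varepsilon\big)$; that is, $\tilde O(\max\{\frac1{\mu S},\frac1{\mu B},\frac n{BS}\}\varepsilon^{-1})$ iterations suffice. (ii) The same holds without any smoothness of the $g_i$, with $M=\max\{\frac1\mu,\frac n{BS}\}$ and constants $c,K$ that depend only on the quantities listed in (i) other than $L_g$; that is, $\tilde O(\max\{\frac1\mu,\frac n{BS}\}\varepsilon^{-1})$ iterations suffice. -/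

import Mathlib

open MeasureTheory ProbabilityTheory

universe u w v

noncomputable section

namespace CFCCO

/-- The primal space `ℝ^d` with the Euclidean norm. -/
abbrev Primal (d : ℕ) : Type := EuclideanSpace ℝ (Fin d)

section Outer

/- `V` is `ℝ^m` with the norm `‖·‖_*` (the space in which the inner functions take their values), and
`StrongDual ℝ V` is the space of the dual blocks `y^{(i)}`, with the norm `‖·‖`. -/
variable {V : Type u} [NormedAddCommGroup V] [NormedSpace ℝ V]

/-- The effective domain of the convex conjugate of `f`; it is the dual domain `𝒴_i` for `f = f_i`. -/
def conjDom (f : V → ℝ) : Set (StrongDual ℝ V) :=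
  {y | BddAbove (Set.range fun z : V => y z - f z)}

/-- The convex conjugate `f^*`, to be used on `conjDom f`. -/
def conj (f : V → ℝ) (y : StrongDual ℝ V) : ℝ := ⨆ z : V, (y z - f z)

/-- `z` is a subgradient of `f^*` at `y`. -/
def IsConjSubgrad (f : V → ℝ) (y : StrongDual ℝ V) (z : V) : Prop :=
  ∀ y' ∈ conjDom f, conj f y + (y' - y) z ≤ conj f y'

/-- `z` is the gradient of `ψ` at `y`. -/
def IsGrad (ψ : StrongDual ℝ V → ℝ) (y : StrongDual ℝ V) (z : V) : Prop :=
  HasFDerivAt ψ (NormedSpace.inclusionInDoubleDual ℝ V z) y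

/-- The Bregman divergence `U_ψ(a, y) = ψ(a) - ψ(y) - ⟨z, a - y⟩` formed with the (sub)gradient `z`
of `ψ` at `y`. -/
def bregman (ψ : StrongDual ℝ V → ℝ) (a y : StrongDual ℝ V) (z : V) : ℝ :=
  ψ a - ψ y - (a - y) z

/-- `f` is convex, `C_f`-Lipschitz and `L_f`-smooth with respect to `‖·‖_*`. -/
structure OuterFunction (Cf Lf : ℝ) (f : V → ℝ) : Prop where
  convex : ConvexOn ℝ Set.univ f
  lipschitz : ∀ z z', |f z - f z'| ≤ Cf * ‖z - z'‖
  differentiable : Differentiable ℝ f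
  smooth : ∀ z₁ z₂, |f z₁ - f z₂ - fderiv ℝ f z₂ (z₁ - z₂)| ≤ Lf / 2 * ‖z₁ - z₂‖ ^ 2

/-- `f` is non-decreasing in every coordinate. -/
def CoordMonotone {m : ℕ} (b : Module.Basis (Fin m) ℝ V) (f : V → ℝ) : Prop :=
  ∀ z z', (∀ j, b.repr z j ≤ b.repr z' j) → f z ≤ f z'

variable (V) in
/-- The choice of a distance-generating function for a dual block: the conjugate `f_i^*` of the outer
function, or a given differentiable function `ψ_i`. -/
inductive DGF : Type u
  | conjugate : DGF
  | smooth (ψ : StrongDual ℝ V → ℝ) : DGF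

/-- The distance-generating function `ψ_i` itself. -/
def DGF.val (f : V → ℝ) : DGF V → StrongDual ℝ V → ℝ
  | .conjugate => conj f
  | .smooth ψ => ψ

/-- Requirements on the distance-generating function. None for `ψ_i = f_i^*`; otherwise `ψ_i` is
differentiable on `𝒴_i`, `μψ`-strongly convex there with respect to `‖·‖`, and
`U_{f_i^*} ≥ ρ U_{ψ_i}` on `𝒴_i`. -/
def DGF.Admissible (f : V → ℝ) (μψ ρ : ℝ) : DGF V → Prop
  | .conjugate => True
  | .smooth ψ => (∀ y ∈ conjDom f, DifferentiableAt ℝ ψ y) ∧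
      ∀ y ∈ conjDom f, ∀ z, IsGrad ψ y z → ∀ a ∈ conjDom f,
        μψ / 2 * ‖a - y‖ ^ 2 ≤ bregman ψ a y z ∧
        ∀ z', IsConjSubgrad f y z' → ρ * bregman ψ a y z ≤ bregman (conj f) a y z'

/-- `z` is a (sub)gradient of the distance-generating function at `y`. -/
def DGF.IsSubgrad (f : V → ℝ) (y : StrongDual ℝ V) (z : V) : DGF V → Prop
  | .conjugate => IsConjSubgrad f y z
  | .smooth ψ => IsGrad ψ y z

/-- The (sub)gradient `z'` of the distance-generating function at the new dual block `y'`. For a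
differentiable `ψ_i` it is the gradient; for `ψ_i = f_i^*`, whose subgradient need not be unique, it
is `z' = (τ z + g̃) / (1 + τ)`, with `z` the previous subgradient. -/
def DGF.NextSubgrad (τ : ℝ) (gt z : V) (y' : StrongDual ℝ V) (z' : V) : DGF V → Prop
  | .conjugate => z' = (1 / (1 + τ)) • (τ • z + gt)
  | .smooth ψ => IsGrad ψ y' z'

end Outer

/-- The data of `min_{x ∈ 𝒳} (1/n) ∑ f_i(g_i(x)) + r(x)` with `g_i(x) = 𝔼_{ζ ∼ P_i} g_i(x; ζ)`:
`g i x ζ` is the value oracle and `Dg i x ζ` the (sub)gradient oracle of the inner function. -/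
structure Problem (V : Type u) [NormedAddCommGroup V] [NormedSpace ℝ V] (d n : ℕ)
    (Z : Fin n → Type w) [∀ i, MeasurableSpace (Z i)] where
  X : Set (Primal d)
  r : Primal d → EReal
  f : Fin n → V → ℝ
  P : ∀ i, Measure (Z i)
  g : ∀ i, Primal d → Z i → V
  Dg : ∀ i, Primal d → Z i → Primal d →L[ℝ] V

section Problem

variable {V : Type u} [NormedAddCommGroup V] [NormedSpace ℝ V] {d n : ℕ}
  {Z : Fin n → Type w} [∀ i, MeasurableSpace (Z i)]

/-- The inner function `g_i(x) = 𝔼 g_i(x; ζ)`. -/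
def Problem.inner (p : Problem V d n Z) (i : Fin n) (x : Primal d) : V := ∫ s, p.g i x s ∂(p.P i)

/-- The mean `g_i'(x)` of the (sub)gradient oracle. -/
def Problem.innerD (p : Problem V d n Z) (i : Fin n) (x : Primal d) : Primal d →L[ℝ] V :=
  ∫ s, p.Dg i x s ∂(p.P i)

/-- The objective `F`. -/
def Problem.F (p : Problem V d n Z) (x : Primal d) : EReal :=
  (((1 / n : ℝ) * ∑ i, p.f i (p.inner i x) : ℝ) : EReal) + p.r x

/-- `x` minimizes `F` over `𝒳`. -/
def Problem.IsMinimizer (p : Problem V d n Z) (x : Primal d) : Prop :=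
  x ∈ p.X ∧ IsMinOn p.F p.X x

/-- The standing assumptions, with a `μ`-strongly convex regularizer and `L_f`-smooth outer
functions. -/
structure Problem.Assumptions {m : ℕ} (p : Problem V d n Z) (b : Module.Basis (Fin m) ℝ V)
    (μ Cf Lf Cg σ₀ σ₁ δ : ℝ) : Prop where
  prob : ∀ i, IsProbabilityMeasure (p.P i)
  -- the domain and the regularizer
  closed : IsClosed p.X
  convex : Convex ℝ p.X
  r_ne_bot : ∀ x ∈ p.X, p.r x ≠ ⊥
  r_proper : ∃ x ∈ p.X, p.r x ≠ ⊤
  r_lsc : LowerSemicontinuousOn p.r p.X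
  r_strong : ∀ x ∈ p.X, ∀ x' ∈ p.X, ∀ s t : ℝ, 0 < s → 0 < t → s + t = 1 →
    p.r (s • x + t • x') + ((μ / 2 * (s * t) * ‖x - x'‖ ^ 2 : ℝ) : EReal) ≤
      (s : EReal) * p.r x + (t : EReal) * p.r x'
  -- the oracles of the inner functions are measurable and integrable
  g_meas : ∀ i, StronglyMeasurable (Function.uncurry (p.g i))
  Dg_meas : ∀ i, StronglyMeasurable (Function.uncurry (p.Dg i))
  g_int : ∀ i, ∀ x ∈ p.X, Integrable (p.g i x) (p.P i)
  Dg_int : ∀ i, ∀ x ∈ p.X, Integrable (p.Dg i x) (p.P i)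
  -- the inner functions are convex (in each coordinate) and Lipschitz, and `g_i'(x) ∈ ∂ g_i(x)` has
  -- norm at most `C_g` along feasible directions
  g_convex : ∀ i j, ConvexOn ℝ p.X fun x => b.repr (p.inner i x) j
  g_lipschitz : ∀ i, ∀ x ∈ p.X, ∀ x' ∈ p.X, ‖p.inner i x - p.inner i x'‖ ≤ Cg * ‖x - x'‖
  Dg_subgrad : ∀ i, ∀ x ∈ p.X, ∀ x' ∈ p.X, ∀ j,
    b.repr (p.inner i x) j + b.repr (p.innerD i x (x' - x)) j ≤ b.repr (p.inner i x') j
  Dg_bound : ∀ i, ∀ x ∈ p.X, ∀ x' ∈ p.X, ‖p.innerD i x (x' - x)‖ ≤ Cg * ‖x' - x‖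
  -- the outer functions; monotonicity is needed only where the inner function is not affine
  outer : ∀ i, OuterFunction Cf Lf (p.f i)
  outer_mono : ∀ i, CoordMonotone b (p.f i) ∨
    ∀ x ∈ p.X, ∀ x' ∈ p.X, p.inner i x' = p.inner i x + p.innerD i x (x' - x)
  -- variances
  var_g : ∀ i, ∀ x ∈ p.X, Integrable (fun s => ‖p.inner i x - p.g i x s‖ ^ 2) (p.P i) ∧
    ∫ s, ‖p.inner i x - p.g i x s‖ ^ 2 ∂(p.P i) ≤ σ₀ ^ 2
  var_Dg : ∀ i, ∀ x ∈ p.X, Integrable (fun s => ‖p.innerD i x - p.Dg i x s‖ ^ 2) (p.P i) ∧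
    ∫ s, ‖p.innerD i x - p.Dg i x s‖ ^ 2 ∂(p.P i) ≤ σ₁ ^ 2
  var_comp : ∀ x ∈ p.X, ∀ y : Fin n → StrongDual ℝ V, (∀ i, y i ∈ conjDom (p.f i)) →
    (1 / n : ℝ) * ∑ j, ‖(y j).comp (p.innerD j x)
      - (1 / n : ℝ) • ∑ i, (y i).comp (p.innerD i x)‖ ^ 2 ≤ δ ^ 2

/-- The inner functions are `L_g`-smooth on `𝒳`, with gradient the mean of the gradient oracle. -/
def Problem.InnerSmooth (p : Problem V d n Z) (Lg : ℝ) : Prop :=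
  ∀ i, ∀ x ∈ p.X, HasFDerivWithinAt (p.inner i) (p.innerD i x) p.X x ∧
    ∀ x' ∈ p.X, ‖p.inner i x' - p.inner i x - p.innerD i x (x' - x)‖ ≤ Lg / 2 * ‖x' - x‖ ^ 2

/-- The randomness of one iteration: the outer batch `𝒮_t`, and the inner batches `ℬ_t^{(i)}` and
`ℬ̃_t^{(i)}` for each `i` (only those with `i ∈ 𝒮_t` are used by the algorithm). -/
abbrev Draw (n B : ℕ) (Z : Fin n → Type w) : Type w :=
  Finset (Fin n) × (∀ i, Fin B → Z i) × (∀ i, Fin B → Z i)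

/-- The law of one iteration's randomness: `𝒮_t` is uniform among the subsets of size `S`, the inner
batches are i.i.d. samples from `P_i`, and all of them are independent. -/
def Problem.drawLaw (p : Problem V d n Z) (S B : ℕ) : Measure (Draw n B Z) :=
  (uniformOn {A : Finset (Fin n) | A.card = S}).prod
    ((Measure.pi fun i => Measure.pi fun _ : Fin B => p.P i).prod
      (Measure.pi fun i => Measure.pi fun _ : Fin B => p.P i))

/-- The draws of the iterations are i.i.d. with the law `drawLaw`. -/
structure Problem.IsSampling {Ω : Type v} [MeasurableSpace Ω] (p : Problem V d n Z) (S B : ℕ)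
    (Pr : Measure Ω) (ξ : ℕ → Ω → Draw n B Z) : Prop where
  law : ∀ t, HasLaw (ξ t) (p.drawLaw S B) Pr
  indep : iIndepFun ξ Pr

/-- The mini-batch value `g_i(x; ℬ)`. -/
def Problem.batch {B : ℕ} (p : Problem V d n Z) (i : Fin n) (x : Primal d) (s : Fin B → Z i) : V :=
  (1 / B : ℝ) • ∑ k, p.g i x (s k)

/-- The mini-batch (sub)gradient `g_i'(x; ℬ)`. -/
def Problem.batchD {B : ℕ} (p : Problem V d n Z) (i : Fin n) (x : Primal d) (s : Fin B → Z i) :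
    Primal d →L[ℝ] V :=
  (1 / B : ℝ) • ∑ k, p.Dg i x (s k)

/-- The extrapolated estimator
`g̃^{(i)} = g_i(x; ℬ) + θ (g_i(x; ℬ) - g_i(x⁻; ℬ))`, with `x⁻` the previous iterate. -/
def Problem.extrap {B : ℕ} (p : Problem V d n Z) (θ : ℝ) (i : Fin n) (xprev x : Primal d)
    (s : Fin B → Z i) : V :=
  p.batch i x s + θ • (p.batch i x s - p.batch i xprev s)

/-- The stochastic gradient `G = (1/S) ∑_{i ∈ 𝒮} [g_i'(x; ℬ̃^{(i)})]ᵀ y^{(i)}`, as a functional. -/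
def Problem.gradEst {B : ℕ} (p : Problem V d n Z) (S : ℕ) (x : Primal d)
    (y : Fin n → StrongDual ℝ V) (ζ : Draw n B Z) : StrongDual ℝ (Primal d) :=
  (1 / S : ℝ) • ∑ i ∈ ζ.1, (y i).comp (p.batchD i x (ζ.2.2 i))

/-- `X`, `Y` are the iterates of ALEXR driven by the draws `ξ`, started at `x₀`, `y₀`;
`Q t ω i` is the (sub)gradient of `ψ_i` at `Y t ω i` in the Bregman divergence. For `t = 0`,
`X (t - 1)` is `X 0`, which is the convention `x_{-1} = x_0`. -/
structure Problem.IsALEXR {Ω : Type v} (p : Problem V d n Z) (ψ : Fin n → DGF V) (S B : ℕ)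
    (θ η τ : ℝ) (x₀ : Primal d) (y₀ : Fin n → StrongDual ℝ V) (q₀ : Fin n → V)
    (ξ : ℕ → Ω → Draw n B Z) (X : ℕ → Ω → Primal d) (Y : ℕ → Ω → Fin n → StrongDual ℝ V)
    (Q : ℕ → Ω → Fin n → V) : Prop where
  x_init : x₀ ∈ p.X ∧ ∀ ω, X 0 ω = x₀
  y_init : (∀ i, y₀ i ∈ conjDom (p.f i)) ∧ ∀ ω, Y 0 ω = y₀
  q_init : (∀ i, (ψ i).IsSubgrad (p.f i) (y₀ i) (q₀ i)) ∧ ∀ ω, Q 0 ω = q₀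
  dual : ∀ t ω, ∀ i ∈ (ξ t ω).1,
    Y (t + 1) ω i ∈ conjDom (p.f i) ∧
    IsMaxOn (fun a => a (p.extrap θ i (X (t - 1) ω) (X t ω) ((ξ t ω).2.1 i)) - conj (p.f i) a
      - τ * bregman ((ψ i).val (p.f i)) a (Y t ω i) (Q t ω i))
      (conjDom (p.f i)) (Y (t + 1) ω i) ∧
    (ψ i).NextSubgrad τ (p.extrap θ i (X (t - 1) ω) (X t ω) ((ξ t ω).2.1 i)) (Q t ω i)
      (Y (t + 1) ω i) (Q (t + 1) ω i)
  dual_idle : ∀ t ω, ∀ i ∉ (ξ t ω).1, Y (t + 1) ω i = Y t ω i ∧ Q (t + 1) ω i = Q t ω i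
  primal : ∀ t ω, X (t + 1) ω ∈ p.X ∧
    IsMinOn (fun x => ((p.gradEst S (X t ω) (Y (t + 1) ω) (ξ t ω) x
      + η / 2 * ‖x - X t ω‖ ^ 2 : ℝ) : EReal) + p.r x) p.X (X (t + 1) ω)

/-- The initial error `(μ/2) ‖x_0 - x_*‖² + (1/n) ∑ U_{ψ_i}(y_*^{(i)}, y_0^{(i)})`, where
`y_*^{(i)} = ∇ f_i(g_i(x_*))`. -/
def Problem.initGap (p : Problem V d n Z) (ψ : Fin n → DGF V) (μ : ℝ) (x₀ : Primal d)
    (y₀ : Fin n → StrongDual ℝ V) (q₀ : Fin n → V) (xs : Primal d) : ℝ :=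
  μ / 2 * ‖x₀ - xs‖ ^ 2 + (1 / n : ℝ) *
    ∑ i, bregman ((ψ i).val (p.f i)) (fderiv ℝ (p.f i) (p.inner i xs)) (y₀ i) (q₀ i)

/-- ALEXR with parameters `θ, η, τ` and batch sizes `S, B` satisfies
`(μ/2) 𝔼 ‖x_T - x_*‖² ≤ ε` for all `T ≥ N log (2 + Δ / ε)`, with `Δ` the initial error. -/
def Problem.ReachesAccuracy (p : Problem V d n Z) (ψ : Fin n → DGF V) (S B : ℕ)
    (μ θ η τ ε N : ℝ) : Prop :=
  ∀ (Ω : Type v) [MeasurableSpace Ω] (Pr : Measure Ω) [IsProbabilityMeasure Pr]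
    (ξ : ℕ → Ω → Draw n B Z) (x₀ : Primal d) (y₀ : Fin n → StrongDual ℝ V) (q₀ : Fin n → V)
    (X : ℕ → Ω → Primal d) (Y : ℕ → Ω → Fin n → StrongDual ℝ V) (Q : ℕ → Ω → Fin n → V)
    (xs : Primal d),
    p.IsMinimizer xs → p.IsSampling S B Pr ξ → p.IsALEXR ψ S B θ η τ x₀ y₀ q₀ ξ X Y Q →
    ∀ T : ℕ, N * Real.log (2 + p.initGap ψ μ x₀ y₀ q₀ xs / ε) ≤ T →
      Integrable (fun ω => ‖X T ω - xs‖ ^ 2) Pr ∧ μ / 2 * ∫ ω, ‖X T ω - xs‖ ^ 2 ∂Pr ≤ ε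

end Problem

end CFCCO

end

open CFCCO

/-
ALEXR is a stochastic primal-dual method for the saddle point form
`min_x max_y (1/n) ∑ (⟨y⁽ⁱ⁾, g_i(x)⟩ - f_i^*(y⁽ⁱ⁾)) + r(x)`. Strong convexity of `r` on the primal
side and of `f_i^*` relative to `ψ_i` on the dual side turn the three-point inequalities of the two
steps into a contraction of the Lyapunov function
`(η+μ)/2 ‖x_t - x_*‖² + η/8 ‖x_t - x_{t-1}‖² + (τ+ρ/2) (1/S) ∑ U_{ψ_i}(y_*⁽ⁱ⁾, y_t⁽ⁱ⁾)`
by the factor `1 - ρ(1-θ)/4`, up to three errors. The dual sampling error has mean zero when it is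
tested with `y_t - y_*`, which does not depend on the batches of iteration `t`; what is left is a
variance divided by `τ`, and it decays like `1/B` for every norm on the finite-dimensional inner
space because that norm is equivalent to a Euclidean one. The gradient error contributes its
variance divided by `η`. The error of linearizing `g_i` is at most `k₁ ‖x_{t+1} - x_t‖² + k₂`: for
smooth `g_i` one may take `k₂ = 0`, and otherwise Young's inequality allows `k₁` of order `η` and
`k₂` of order `1/η`. With `1 - θ = c ε / M` all three errors are at most of order
`(1 - θ) M = c ε`.
-/

namespace CFCCO

section Calculus

variable {E : Type*} [NormedAddCommGroup E] [NormedSpace ℝ E]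

theorem le_fderiv_apply_of_forall_mul_le {φ : E → ℝ} {φ' : E →L[ℝ] ℝ} {x v : E} {K : ℝ}
    (hφ : HasFDerivAt φ φ' x) (h : ∀ s : ℝ, 0 < s → s ≤ 1 → s * K ≤ φ (x + s • v) - φ x) :
    K ≤ φ' v := by
  have slope_tendsto := (hasDerivWithinAt_iff_tendsto_slope' Set.self_notMem_Ioi).1
    (hφ.hasLineDerivAt v).hasDerivWithinAt
  refine ge_of_tendsto slope_tendsto ?_
  filter_upwards [Ioc_mem_nhdsGT one_pos] with s hs
  rw [slope_def_field, le_div_iff₀ (by linarith [hs.1]), mul_comm]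
  simpa using h s hs.1 hs.2

theorem norm_sq_le_of_forall_apply_sub_le {ℓ : StrongDual ℝ E} {L K : ℝ} (hL : 0 < L)
    (h : ∀ v, ℓ v - L / 2 * ‖v‖ ^ 2 ≤ K) : 1 / L / 2 * ‖ℓ‖ ^ 2 ≤ K := by
  have hK : 0 ≤ K := by simpa using h 0
  have sq_apply_le (v : E) : ℓ v ^ 2 ≤ 2 * L * K * ‖v‖ ^ 2 := by
    have quadratic_nonneg (t : ℝ) : 0 ≤ L / 2 * ‖v‖ ^ 2 * (t * t) + -ℓ v * t + K := by
      have := h (t • v)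
      rw [map_smul, norm_smul, mul_pow, Real.norm_eq_abs, sq_abs, smul_eq_mul] at this
      linarith
    have := discrim_le_zero quadratic_nonneg
    rw [discrim] at this
    linarith
  have norm_le : ‖ℓ‖ ≤ √(2 * L * K) := ℓ.opNorm_le_bound (Real.sqrt_nonneg _) fun v => by
    refine abs_le_of_sq_le_sq ?_ (by positivity)
    rw [mul_pow, Real.sq_sqrt (by positivity)]
    exact sq_apply_le v
  calc 1 / L / 2 * ‖ℓ‖ ^ 2 ≤ 1 / L / 2 * √(2 * L * K) ^ 2 := by gcongr
    _ = K := by rw [Real.sq_sqrt (by positivity)]; field_simp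

theorem apply_le_opNorm_mul_norm (ℓ : StrongDual ℝ E) (v : E) : ℓ v ≤ ‖ℓ‖ * ‖v‖ :=
  (le_abs_self _).trans (ℓ.le_opNorm v)

theorem apply_le_mul_norm_sq_add {a : ℝ} (ha : 0 < a) (ℓ : StrongDual ℝ E) (v : E) :
    ℓ v ≤ a * ‖ℓ‖ ^ 2 + ‖v‖ ^ 2 / (4 * a) := by
  have young := two_mul_le_add_mul_sq (a := ‖ℓ‖) (b := ‖v‖) (by positivity : 0 < 2 * a)
  have : ‖v‖ ^ 2 / (4 * a) = (2 * a)⁻¹ * ‖v‖ ^ 2 / 2 := by field_simp; ring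
  linarith [apply_le_opNorm_mul_norm ℓ v]

end Calculus

theorem nonpos_of_forall_mul_le {D C : ℝ} (h : ∀ s : ℝ, 0 ≤ s → s * D ≤ C) : D ≤ 0 := by
  by_contra! hD
  have hC : 0 ≤ C := by simpa using h 0 le_rfl
  have := h ((C + 1) / D) (by positivity)
  rw [div_mul_cancel₀ _ hD.ne'] at this
  linarith

section Conj

variable {V : Type*} [NormedAddCommGroup V] [NormedSpace ℝ V] {f : V → ℝ} {y : StrongDual ℝ V}

theorem le_conj (hy : y ∈ conjDom f) (z : V) : y z - f z ≤ conj f y :=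
  le_ciSup hy z

theorem mem_conjDom_of_le {C : ℝ} (h : ∀ z, y z - f z ≤ C) : y ∈ conjDom f :=
  ⟨C, Set.forall_mem_range.2 h⟩

theorem conj_le {C : ℝ} (h : ∀ z, y z - f z ≤ C) : conj f y ≤ C :=
  ciSup_le h

theorem convexOn_conj : ConvexOn ℝ (conjDom f) (conj f) := by
  have fenchel_combo : ∀ y ∈ conjDom f, ∀ y' ∈ conjDom f, ∀ s t : ℝ, 0 ≤ s → 0 ≤ t → s + t = 1 →
      ∀ z, (s • y + t • y') z - f z ≤ s * conj f y + t * conj f y' := by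
    intro y hy y' hy' s t hs ht hst z
    calc (s • y + t • y') z - f z = s * (y z - f z) + t * (y' z - f z) := by
          simp only [add_apply, smul_apply, smul_eq_mul]
          linear_combination f z * hst
      _ ≤ _ := by gcongr <;> exact le_conj ‹_› z
  exact ⟨fun y hy y' hy' s t hs ht hst =>
      mem_conjDom_of_le (fenchel_combo y hy y' hy' s t hs ht hst),
    fun y hy y' hy' s t hs ht hst => conj_le (fenchel_combo y hy y' hy' s t hs ht hst)⟩

theorem norm_le_of_mem_conjDom {C : ℝ} (hC : 0 ≤ C) (hf : ∀ z z', |f z - f z'| ≤ C * ‖z - z'‖)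
    (hy : y ∈ conjDom f) : ‖y‖ ≤ C := by
  have apply_le (v : V) : y v ≤ C * ‖v‖ := by
    refine sub_nonpos.1 (nonpos_of_forall_mul_le (C := conj f y + f 0) fun s hs => ?_)
    have fenchel := le_conj hy (s • v)
    have growth := (abs_le.1 (hf (s • v) 0)).2
    rw [sub_zero, norm_smul, Real.norm_of_nonneg hs] at growth
    rw [map_smul, smul_eq_mul] at fenchel
    linarith
  refine y.opNorm_le_bound hC fun v => abs_le.2 ⟨?_, apply_le v⟩
  have := apply_le (-v)
  rw [map_neg, norm_neg] at this
  linarith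

theorem apply_basis_nonneg {m : ℕ} {b : Module.Basis (Fin m) ℝ V} (hf : CoordMonotone b f)
    (hy : y ∈ conjDom f) (j : Fin m) : 0 ≤ y (b j) := by
  refine neg_nonpos.1 (nonpos_of_forall_mul_le (C := conj f y + f 0) fun s hs => ?_)
  have fenchel := le_conj hy (-(s • b j))
  have descent : f (-(s • b j)) ≤ f 0 := hf _ _ fun k => by
    simp only [map_neg, map_smul, Module.Basis.repr_self, Finsupp.smul_single, smul_eq_mul,
      mul_one, Finsupp.coe_neg, Pi.neg_apply, map_zero, Finsupp.coe_zero, Pi.zero_apply,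
      Left.neg_nonpos_iff, Finsupp.single_apply]
    split_ifs <;> simp [hs]
  rw [map_neg, map_smul, smul_eq_mul] at fenchel
  linarith

theorem apply_le_apply_of_coordMonotone {m : ℕ} {b : Module.Basis (Fin m) ℝ V}
    (hf : CoordMonotone b f) (hy : y ∈ conjDom f) {z z' : V}
    (h : ∀ j, b.repr z j ≤ b.repr z' j) : y z ≤ y z' := by
  rw [← b.sum_repr z, ← b.sum_repr z', map_sum, map_sum]
  refine Finset.sum_le_sum fun j _ => ?_
  rw [map_smul, map_smul]
  exact mul_le_mul_of_nonneg_right (h j) (apply_basis_nonneg hf hy j)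

theorem measurableSet_conjDom : MeasurableSet (conjDom f) := by
  have : conjDom f = ⋃ N : ℕ, ⋂ z : V, {y : StrongDual ℝ V | y z - f z ≤ N} := by
    ext y
    simp only [Set.mem_iUnion, Set.mem_iInter, Set.mem_ofPred_eq]
    refine ⟨fun ⟨C, hC⟩ => ?_, fun ⟨N, hN⟩ => mem_conjDom_of_le hN⟩
    obtain ⟨N, hN⟩ := exists_nat_ge C
    exact ⟨N, fun z => (hC ⟨z, rfl⟩).trans hN⟩
  rw [this]
  exact .iUnion fun N =>
    (isClosed_iInter fun z => isClosed_le (by fun_prop) continuous_const).measurableSet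

theorem lowerSemicontinuousOn_conj : LowerSemicontinuousOn (conj f) (conjDom f) :=
  lowerSemicontinuousOn_ciSup (f := fun (z : V) (y : StrongDual ℝ V) => y z - f z)
    (fun _ hy => hy) fun _ =>
      (Continuous.lowerSemicontinuous (by fun_prop)).lowerSemicontinuousOn _

namespace OuterFunction

variable {Cf Lf : ℝ} {q : V}

theorem add_fderiv_le (hf : OuterFunction Cf Lf f) (z z' : V) :
    f z + fderiv ℝ f z (z' - z) ≤ f z' := by
  have := le_fderiv_apply_of_forall_mul_le (K := -(f z' - f z)) (v := z' - z)
    (hf.differentiable z).hasFDerivAt.neg fun s hs hs1 => by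
      have convexity :=
        hf.convex.2 (Set.mem_univ z) (Set.mem_univ z') (sub_nonneg.2 hs1) hs.le (by ring)
      rw [show (1 - s) • z + s • z' = z + s • (z' - z) by module, smul_eq_mul, smul_eq_mul]
        at convexity
      simp only [Pi.neg_apply]
      linarith
  simp only [neg_apply] at this
  linarith

theorem apply_fderiv_sub_le (hf : OuterFunction Cf Lf f) (z z' : V) :
    fderiv ℝ f z z' - f z' ≤ fderiv ℝ f z z - f z := by
  have := hf.add_fderiv_le z z'
  rw [map_sub] at this
  linarith

theorem fderiv_mem_conjDom (hf : OuterFunction Cf Lf f) (z : V) : fderiv ℝ f z ∈ conjDom f :=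
  mem_conjDom_of_le (hf.apply_fderiv_sub_le z)

theorem conj_fderiv (hf : OuterFunction Cf Lf f) (z : V) :
    conj f (fderiv ℝ f z) = fderiv ℝ f z z - f z :=
  le_antisymm (conj_le (hf.apply_fderiv_sub_le z)) (le_conj (hf.fderiv_mem_conjDom z) z)

theorem eq_fderiv_of_conj_le (hf : OuterFunction Cf Lf f) (hy : y ∈ conjDom f)
    (h : conj f y ≤ y q - f q) : y = fderiv ℝ f q := by
  have isMin : IsLocalMin (fun z => f z - y z) q :=
    Filter.Eventually.of_forall fun z => by linarith [le_conj hy z]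
  exact (sub_eq_zero.1
    (isMin.hasFDerivAt_eq_zero ((hf.differentiable q).hasFDerivAt.sub y.hasFDerivAt))).symm

theorem conj_eq_of_isConjSubgrad (hf : OuterFunction Cf Lf f) (hy : y ∈ conjDom f)
    (hq : IsConjSubgrad f y q) : conj f y = y q - f q := by
  refine le_antisymm ?_ (le_conj hy q)
  have := hq _ (hf.fderiv_mem_conjDom q)
  rw [hf.conj_fderiv, sub_apply] at this
  linarith

theorem isConjSubgrad_fderiv (hf : OuterFunction Cf Lf f) (q : V) :
    IsConjSubgrad f (fderiv ℝ f q) q := by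
  intro a ha
  have := le_conj ha q
  rw [hf.conj_fderiv, sub_apply]
  linarith

theorem norm_sq_le_bregman_conj (hf : OuterFunction Cf Lf f) (hLf : 0 < Lf) (hy : y ∈ conjDom f)
    {a : StrongDual ℝ V} (ha : a ∈ conjDom f) (hq : IsConjSubgrad f y q) :
    1 / Lf / 2 * ‖a - y‖ ^ 2 ≤ bregman (conj f) a y q := by
  have conj_y := hf.conj_eq_of_isConjSubgrad hy hq
  have y_eq := hf.eq_fderiv_of_conj_le hy conj_y.le
  refine norm_sq_le_of_forall_apply_sub_le hLf fun v => ?_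
  have fenchel := le_conj ha (q + v)
  have smoothness := (abs_le.1 (hf.smooth (q + v) q)).2
  rw [← y_eq, add_sub_cancel_left] at smoothness
  rw [bregman, conj_y]
  simp only [sub_apply, map_add] at fenchel ⊢
  linarith

end OuterFunction

end Conj

section DoubleDual

variable {V : Type*} [NormedAddCommGroup V] [NormedSpace ℝ V] [FiniteDimensional ℝ V]

theorem finrank_strongDual : Module.finrank ℝ (StrongDual ℝ V) = Module.finrank ℝ V := by
  rw [← Subspace.dual_finrank_eq (K := ℝ) (V := V)]
  exact (LinearMap.toContinuousLinearMap (𝕜 := ℝ) (E := V) (F' := ℝ)).symm.finrank_eq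

/-- Reflexivity of a finite-dimensional space: evaluation identifies it with its double dual. -/
noncomputable def doubleDualEquiv : V ≃L[ℝ] StrongDual ℝ (StrongDual ℝ V) :=
  (LinearEquiv.ofInjectiveOfFinrankEq (NormedSpace.inclusionInDoubleDual ℝ V).toLinearMap
    (NormedSpace.inclusionInDoubleDualLi ℝ (E := V)).injective
    (by rw [finrank_strongDual, finrank_strongDual])).toContinuousLinearEquiv

/-- The gradient of `ψ` at `y`, as a vector of the space `V` of which `y` is a functional; it is `0`
where `ψ` is not differentiable. -/
noncomputable def dualGrad (ψ : StrongDual ℝ V → ℝ) (y : StrongDual ℝ V) : V :=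
  doubleDualEquiv.symm (fderiv ℝ ψ y)

variable {ψ : StrongDual ℝ V → ℝ} {y : StrongDual ℝ V}

theorem isGrad_dualGrad (h : DifferentiableAt ℝ ψ y) : IsGrad ψ y (dualGrad ψ y) := by
  rw [IsGrad, show NormedSpace.inclusionInDoubleDual ℝ V (dualGrad ψ y) = fderiv ℝ ψ y from
    doubleDualEquiv.apply_symm_apply _]
  exact h.hasFDerivAt

theorem IsGrad.eq_dualGrad {z : V} (h : IsGrad ψ y z) : z = dualGrad ψ y := by
  rw [dualGrad, HasFDerivAt.fderiv h]
  exact (doubleDualEquiv.symm_apply_apply z).symm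

theorem measurable_dualGrad [MeasurableSpace V] [BorelSpace V] : Measurable (dualGrad ψ) :=
  doubleDualEquiv.symm.continuous.measurable.comp (measurable_fderiv ℝ ψ)

end DoubleDual

section DualObjective

variable {V : Type*} [NormedAddCommGroup V] [NormedSpace ℝ V] {f : V → ℝ} {Cf Lf τ : ℝ}
  {ψ : StrongDual ℝ V → ℝ} {a : StrongDual ℝ V} {w z : V}

theorem exists_isMaxOn_sub_conj [FiniteDimensional ℝ V] {φ : StrongDual ℝ V → ℝ} {M : ℝ}
    (hCf : 0 ≤ Cf) (hf : ∀ z z', |f z - f z'| ≤ Cf * ‖z - z'‖) (hne : (conjDom f).Nonempty)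
    (hφ : ContinuousOn φ (conjDom f)) (hM : ∀ a ∈ conjDom f, φ a ≤ M) :
    ∃ a ∈ conjDom f, IsMaxOn (fun a => φ a - conj f a) (conjDom f) a := by
  obtain ⟨y, hy⟩ := hne
  set s : Set (StrongDual ℝ V) := {a | ∀ z, a z - f z ≤ M - (φ y - conj f y)} with hs
  have s_subset : s ⊆ conjDom f := fun a ha => mem_conjDom_of_le ha
  have mem_s {a} (ha : a ∈ conjDom f) (hle : φ y - conj f y ≤ φ a - conj f a) : a ∈ s :=
    fun z => by linarith [le_conj ha z, hM a ha]
  have s_compact : IsCompact s := by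
    refine Metric.isCompact_of_isClosed_isBounded ?_ ?_
    · rw [hs, Set.ofPred_forall]
      exact isClosed_iInter fun z => isClosed_le (by fun_prop) continuous_const
    · exact Metric.isBounded_closedBall.subset fun a ha =>
        mem_closedBall_zero_iff.2 (norm_le_of_mem_conjDom hCf hf (s_subset ha))
  obtain ⟨a, ha, hmin⟩ := LowerSemicontinuousOn.exists_isMinOn ⟨y, mem_s hy le_rfl⟩ s_compact
    ((lowerSemicontinuousOn_conj.mono s_subset).add (hφ.mono s_subset).neg.lowerSemicontinuousOn)
  have le_max {a'} (ha' : a' ∈ s) : φ a' - conj f a' ≤ φ a - conj f a := by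
    have : conj f a + -φ a ≤ conj f a' + -φ a' := hmin ha'
    linarith
  refine ⟨a, s_subset ha, fun a' ha' => ?_⟩
  rcases le_total (φ y - conj f y) (φ a' - conj f a') with hle | hge
  · exact le_max (mem_s ha' hle)
  · exact hge.trans (le_max (mem_s hy le_rfl))

/-- The objective `⟨a, w⟩ - f^*(a) - τ ψ(a)`, which for `w = g̃ + τ z` is that of the dual step from
the estimate `g̃` and the (sub)gradient `z`, up to a constant. -/
noncomputable def dualObjective (f : V → ℝ) (ψ : StrongDual ℝ V → ℝ) (τ : ℝ) (w : V)
    (a : StrongDual ℝ V) : ℝ :=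
  a w - τ * ψ a - conj f a

theorem sub_conj_sub_bregman_eq (y : StrongDual ℝ V) (gt q : V) :
    a gt - conj f a - τ * bregman ψ a y q =
      dualObjective f ψ τ (gt + τ • q) a + τ * (ψ y - y q) := by
  simp only [dualObjective, bregman, map_add, map_smul, smul_eq_mul, sub_apply]
  ring

theorem isMaxOn_dualObjective_iff {y : StrongDual ℝ V} {gt q : V} {s : Set (StrongDual ℝ V)} :
    IsMaxOn (fun a => a gt - conj f a - τ * bregman ψ a y q) s a ↔
      IsMaxOn (dualObjective f ψ τ (gt + τ • q)) s a := by
  simp only [isMaxOn_iff, sub_conj_sub_bregman_eq, add_le_add_iff_right]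

theorem isConjSubgrad_of_isMaxOn (ha : a ∈ conjDom f)
    (hmax : IsMaxOn (dualObjective f ψ τ w) (conjDom f) a) (hz : IsGrad ψ a z) :
    IsConjSubgrad f a (w - τ • z) := by
  intro a' ha'
  have := le_fderiv_apply_of_forall_mul_le (v := a' - a)
    (K := (a' - a) w - (conj f a' - conj f a)) (HasFDerivAt.const_mul hz τ) fun s hs hs1 => by
      have segment_eq : (1 - s) • a + s • a' = a + s • (a' - a) := by module
      have segment_mem := convexOn_conj.1 ha ha' (sub_nonneg.2 hs1) hs.le (by ring)
      have convexity := convexOn_conj.2 ha ha' (sub_nonneg.2 hs1) hs.le (by ring)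
      rw [segment_eq] at segment_mem
      rw [segment_eq, smul_eq_mul, smul_eq_mul] at convexity
      have maximality := hmax segment_mem
      simp only [dualObjective, Set.mem_ofPred_eq, add_apply, smul_apply, smul_eq_mul] at maximality
      linarith
  simp only [smul_apply, NormedSpace.dual_def, smul_eq_mul] at this
  rw [map_sub, map_smul, smul_eq_mul]
  linarith

theorem norm_sq_le_dualObjective_sub (hf : OuterFunction Cf Lf f) (hLf : 0 < Lf) (hτ : 0 ≤ τ)
    (ha : a ∈ conjDom f) (hmax : IsMaxOn (dualObjective f ψ τ w) (conjDom f) a)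
    (hz : IsGrad ψ a z) {a' : StrongDual ℝ V} (ha' : a' ∈ conjDom f)
    (hψ : 0 ≤ bregman ψ a' a z) :
    1 / Lf / 2 * ‖a' - a‖ ^ 2 ≤ dualObjective f ψ τ w a - dualObjective f ψ τ w a' := by
  have conj_growth := hf.norm_sq_le_bregman_conj hLf ha ha' (isConjSubgrad_of_isMaxOn ha hmax hz)
  have ψ_growth := mul_nonneg hτ hψ
  simp only [dualObjective, bregman, map_sub, sub_apply, map_smul, smul_eq_mul]
    at conj_growth ψ_growth ⊢
  linarith

theorem norm_sub_le_of_isMaxOn_dualObjective (hf : OuterFunction Cf Lf f) (hLf : 0 < Lf)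
    (hτ : 0 ≤ τ) (ha : a ∈ conjDom f) (hmax : IsMaxOn (dualObjective f ψ τ w) (conjDom f) a)
    (hz : IsGrad ψ a z) {a' : StrongDual ℝ V} {w' z' : V} (ha' : a' ∈ conjDom f)
    (hmax' : IsMaxOn (dualObjective f ψ τ w') (conjDom f) a') (hz' : IsGrad ψ a' z')
    (hψ : 0 ≤ bregman ψ a' a z) (hψ' : 0 ≤ bregman ψ a a' z') :
    ‖a - a'‖ ≤ Lf * ‖w - w'‖ := by
  have growth := norm_sq_le_dualObjective_sub hf hLf hτ ha hmax hz ha' hψ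
  have growth' := norm_sq_le_dualObjective_sub hf hLf hτ ha' hmax' hz' ha hψ'
  have cauchy := apply_le_opNorm_mul_norm (a - a') (w - w')
  rw [norm_sub_rev] at growth
  simp only [dualObjective, map_sub, sub_apply] at growth growth' cauchy
  have : 1 / Lf * ‖a - a'‖ ^ 2 ≤ ‖a - a'‖ * ‖w - w'‖ := by linarith
  rw [one_div, inv_mul_le_iff₀ hLf] at this
  rcases (norm_nonneg (a - a')).eq_or_lt with h0 | hpos
  · rw [← h0]; positivity
  · exact le_of_mul_le_mul_left (by linarith) hpos

end DualObjective

namespace DGF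

variable {V : Type*} [NormedAddCommGroup V] [NormedSpace ℝ V] {f : V → ℝ}
  {Cf Lf κ ρ τ : ℝ} {ψ : DGF V} {a y y' : StrongDual ℝ V} {gt q q' : V}

theorem Admissible.mono {κ' ρ' : ℝ} (hψ : ψ.Admissible f κ ρ) (hκ : 0 ≤ κ) (hκ' : κ' ≤ κ)
    (hρ' : ρ' ≤ ρ) : ψ.Admissible f κ' ρ' := by
  cases ψ with
  | conjugate => trivial
  | smooth ψ =>
    refine ⟨hψ.1, fun y hy z hz a ha => ?_⟩
    obtain ⟨strong, relative⟩ := hψ.2 y hy z hz a ha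
    have : 0 ≤ bregman ψ a y z := le_trans (by positivity) strong
    exact ⟨le_trans (by gcongr) strong, fun z' hz' => le_trans (by gcongr) (relative z' hz')⟩

theorem norm_sq_le_bregman (hf : OuterFunction Cf Lf f) (hLf : 0 < Lf) (hψ : ψ.Admissible f κ ρ)
    (hκ : κ ≤ 1 / Lf) (hy : y ∈ conjDom f) (ha : a ∈ conjDom f) (hq : ψ.IsSubgrad f y q) :
    κ / 2 * ‖a - y‖ ^ 2 ≤ bregman (ψ.val f) a y q := by
  cases ψ with
  | conjugate => exact le_trans (by gcongr) (hf.norm_sq_le_bregman_conj hLf hy ha hq)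
  | smooth ψ => exact (hψ.2 y hy q hq a ha).1

theorem bregman_nonneg (hf : OuterFunction Cf Lf f) (hLf : 0 < Lf) (hψ : ψ.Admissible f κ ρ)
    (hκ : 0 ≤ κ) (hy : y ∈ conjDom f) (ha : a ∈ conjDom f) (hq : ψ.IsSubgrad f y q) :
    0 ≤ bregman (ψ.val f) a y q := by
  cases ψ with
  | conjugate => exact le_trans (by positivity) (hf.norm_sq_le_bregman_conj hLf hy ha hq)
  | smooth ψ => exact le_trans (by positivity) (hψ.2 y hy q hq a ha).1

theorem exists_measurable_bregman [FiniteDimensional ℝ V] [MeasurableSpace V] [BorelSpace V]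
    (hf : OuterFunction Cf Lf f) (hψ : ψ.Admissible f κ ρ) (a : StrongDual ℝ V) :
    ∃ D : StrongDual ℝ V × V → ℝ, Measurable D ∧ ∀ y ∈ conjDom f, ∀ q, ψ.IsSubgrad f y q →
      bregman (ψ.val f) a y q = D (y, q) := by
  cases ψ with
  | conjugate =>
    have := hf.differentiable.continuous
    refine ⟨fun yq => conj f a - (a yq.2 - f yq.2), by fun_prop, fun y hy q hq => ?_⟩
    simp only [DGF.val, bregman, sub_apply, hf.conj_eq_of_isConjSubgrad hy hq]
    ring
  | smooth ψ =>
    classical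
    have measurable_ψ : Measurable ((conjDom f).piecewise ψ 0) :=
      ContinuousOn.measurable_piecewise (fun y hy => (hψ.1 y hy).continuousAt.continuousWithinAt)
        continuousOn_const measurableSet_conjDom
    have measurable_apply : Measurable fun yq : StrongDual ℝ V × V => (a - yq.1) yq.2 :=
      Continuous.measurable (by fun_prop)
    refine ⟨fun yq => ψ a - (conjDom f).piecewise ψ 0 yq.1 - (a - yq.1) yq.2, by fun_prop,
      fun y hy q _ => ?_⟩
    simp only [DGF.val, bregman, Set.piecewise_eq_of_mem _ _ _ hy]

/-- `(y', q')` results from a dual step of size `1 / τ` with the estimate `gt`, started at the dual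
block `y` with the (sub)gradient `q`. -/
structure IsDualStep (f : V → ℝ) (ψ : DGF V) (τ : ℝ) (gt : V) (y : StrongDual ℝ V) (q : V)
    (y' : StrongDual ℝ V) (q' : V) : Prop where
  mem : y' ∈ conjDom f
  isMaxOn : IsMaxOn (fun a => a gt - conj f a - τ * bregman (ψ.val f) a y q) (conjDom f) y'
  nextSubgrad : ψ.NextSubgrad τ gt q y' q'

theorem add_smul_eq_one_add_smul (hτ : 0 < 1 + τ) (h : q' = (1 / (1 + τ)) • (τ • q + gt)) :
    gt + τ • q = (1 + τ) • q' := by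
  rw [h, smul_smul, mul_one_div_cancel hτ.ne', one_smul, add_comm]

theorem dualObjective_conj_eq (hw : gt + τ • q = (1 + τ) • q') :
    dualObjective f (conj f) τ (gt + τ • q) a = (1 + τ) * (a q' - conj f a) := by
  rw [dualObjective, hw, map_smul, smul_eq_mul]
  ring

theorem isDualStep_conjugate (hf : OuterFunction Cf Lf f) (hτ : 0 < 1 + τ)
    (hq' : q' = (1 / (1 + τ)) • (τ • q + gt)) :
    IsDualStep f .conjugate τ gt y q (fderiv ℝ f q') q' := by
  refine ⟨hf.fderiv_mem_conjDom q', isMaxOn_dualObjective_iff.2 fun a ha => ?_, hq'⟩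
  have hw := add_smul_eq_one_add_smul hτ hq'
  simp only [val, dualObjective_conj_eq hw, Set.mem_ofPred_eq]
  refine mul_le_mul_of_nonneg_left ?_ hτ.le
  linarith [hf.conj_fderiv q', le_conj ha q']

namespace IsDualStep

theorem eq_fderiv_of_conjugate (hf : OuterFunction Cf Lf f) (hτ : 0 < 1 + τ)
    (h : IsDualStep f .conjugate τ gt y q y' q') : y' = fderiv ℝ f q' := by
  have hw := add_smul_eq_one_add_smul hτ h.nextSubgrad
  have maximality := isMaxOn_dualObjective_iff.1 h.isMaxOn (hf.fderiv_mem_conjDom q')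
  simp only [val, dualObjective_conj_eq hw, Set.mem_ofPred_eq] at maximality
  refine hf.eq_fderiv_of_conj_le h.mem ?_
  linarith [le_of_mul_le_mul_left maximality hτ, hf.conj_fderiv q']

theorem isSubgrad (hf : OuterFunction Cf Lf f) (hτ : 0 < τ)
    (h : IsDualStep f ψ τ gt y q y' q') : ψ.IsSubgrad f y' q' := by
  cases ψ with
  | conjugate =>
    rw [h.eq_fderiv_of_conjugate hf (by linarith)]
    exact hf.isConjSubgrad_fderiv q'
  | smooth ψ => exact h.nextSubgrad

theorem isConjSubgrad (hf : OuterFunction Cf Lf f) (hτ : 0 < τ)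
    (h : IsDualStep f ψ τ gt y q y' q') : IsConjSubgrad f y' (gt + τ • q - τ • q') := by
  cases ψ with
  | conjugate =>
    rw [add_smul_eq_one_add_smul (by linarith) h.nextSubgrad, add_smul, one_smul,
      add_sub_cancel_right]
    exact h.isSubgrad hf hτ
  | smooth ψ =>
    exact isConjSubgrad_of_isMaxOn h.mem (isMaxOn_dualObjective_iff.1 h.isMaxOn) h.nextSubgrad

theorem mul_bregman_le (hf : OuterFunction Cf Lf f) (hLf : 0 < Lf) (hψ : ψ.Admissible f κ ρ)
    (hρ : ρ ≤ 1) (hτ : 0 < τ) (h : IsDualStep f ψ τ gt y q y' q') (ha : a ∈ conjDom f) :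
    ρ * bregman (ψ.val f) a y' q' ≤ bregman (conj f) a y' (gt + τ • q - τ • q') := by
  have isConjSubgrad := h.isConjSubgrad hf hτ
  cases ψ with
  | conjugate =>
    rw [add_smul_eq_one_add_smul (by linarith) h.nextSubgrad, add_smul, one_smul,
      add_sub_cancel_right] at isConjSubgrad ⊢
    exact mul_le_of_le_one_left
      (le_trans (by positivity) (hf.norm_sq_le_bregman_conj hLf h.mem ha isConjSubgrad)) hρ
  | smooth ψ => exact (hψ.2 y' h.mem q' h.nextSubgrad a ha).2 _ isConjSubgrad

theorem three_point (hf : OuterFunction Cf Lf f) (hLf : 0 < Lf) (hψ : ψ.Admissible f κ ρ)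
    (hρ : ρ ≤ 1) (hτ : 0 < τ) (h : IsDualStep f ψ τ gt y q y' q') (ha : a ∈ conjDom f) :
    (a - y') gt - conj f a + conj f y' ≤ τ * bregman (ψ.val f) a y q
      - τ * bregman (ψ.val f) y' y q - (τ + ρ) * bregman (ψ.val f) a y' q' := by
  have := h.mul_bregman_le hf hLf hψ hρ hτ ha
  simp only [bregman, map_sub, map_add, sub_apply, map_smul, smul_eq_mul] at this ⊢
  linarith

theorem unique (hf : OuterFunction Cf Lf f) (hLf : 0 < Lf) (hψ : ψ.Admissible f κ ρ) (hκ : 0 ≤ κ)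
    (hτ : 0 < τ) [FiniteDimensional ℝ V] {y₁ y₂ : StrongDual ℝ V} {q₁ q₂ : V}
    (h₁ : IsDualStep f ψ τ gt y q y₁ q₁) (h₂ : IsDualStep f ψ τ gt y q y₂ q₂) :
    y₁ = y₂ ∧ q₁ = q₂ := by
  cases ψ with
  | conjugate =>
    have hq : q₁ = q₂ := h₁.nextSubgrad.trans h₂.nextSubgrad.symm
    rw [h₁.eq_fderiv_of_conjugate hf (by linarith), h₂.eq_fderiv_of_conjugate hf (by linarith), hq]
    exact ⟨rfl, rfl⟩
  | smooth ψ =>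
    have hy : y₁ = y₂ := by
      have := norm_sub_le_of_isMaxOn_dualObjective hf hLf hτ.le
        h₁.mem (isMaxOn_dualObjective_iff.1 h₁.isMaxOn) h₁.nextSubgrad
        h₂.mem (isMaxOn_dualObjective_iff.1 h₂.isMaxOn) h₂.nextSubgrad
        (bregman_nonneg hf hLf hψ hκ h₁.mem h₂.mem h₁.nextSubgrad)
        (bregman_nonneg hf hLf hψ hκ h₂.mem h₁.mem h₂.nextSubgrad)
      rwa [sub_self, norm_zero, mul_zero, norm_le_zero_iff, sub_eq_zero] at this
    refine ⟨hy, (IsGrad.eq_dualGrad h₁.nextSubgrad).trans ?_⟩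
    rw [hy]
    exact (IsGrad.eq_dualGrad h₂.nextSubgrad).symm

end IsDualStep

section DualStep

variable [FiniteDimensional ℝ V]

open Classical in
/-- A maximizer of the dual objective over the dual domain, or `0` if there is none. -/
noncomputable def argmaxDual (f : V → ℝ) (ψ : StrongDual ℝ V → ℝ) (τ : ℝ) (w : V) :
    StrongDual ℝ V :=
  if h : ∃ a ∈ conjDom f, IsMaxOn (dualObjective f ψ τ w) (conjDom f) a then h.choose else 0

/-- The dual step as a map of the estimate and the current (sub)gradient, on which alone it depends:
the new dual block and its (sub)gradient. -/
noncomputable def dualStep (f : V → ℝ) (τ : ℝ) (gt q : V) : DGF V → StrongDual ℝ V × V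
  | .conjugate => (fderiv ℝ f ((1 / (1 + τ)) • (τ • q + gt)), (1 / (1 + τ)) • (τ • q + gt))
  | .smooth ψ => (argmaxDual f ψ τ (gt + τ • q), dualGrad ψ (argmaxDual f ψ τ (gt + τ • q)))

theorem argmaxDual_spec {ψ : StrongDual ℝ V → ℝ} (hf : OuterFunction Cf Lf f) (hCf : 0 ≤ Cf)
    (hLf : 0 < Lf) (hψ : (smooth ψ).Admissible f κ ρ) (hκ : 0 ≤ κ) (hτ : 0 ≤ τ) (w : V) :
    argmaxDual f ψ τ w ∈ conjDom f ∧
      IsMaxOn (dualObjective f ψ τ w) (conjDom f) (argmaxDual f ψ τ w) := by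
  have exists_max : ∃ a ∈ conjDom f, IsMaxOn (dualObjective f ψ τ w) (conjDom f) a := by
    have hy := hf.fderiv_mem_conjDom 0
    set y := fderiv ℝ f 0
    have hq := isGrad_dualGrad (hψ.1 y hy)
    set q := dualGrad ψ y
    refine exists_isMaxOn_sub_conj (M := Cf * ‖w - τ • q‖ + τ * (y q - ψ y)) hCf hf.lipschitz
      ⟨y, hy⟩ (fun a ha => (ContinuousAt.sub (by fun_prop)
        ((hψ.1 a ha).continuousAt.const_mul τ)).continuousWithinAt) fun a ha => ?_
    have bregman_nonneg := mul_nonneg hτ (bregman_nonneg hf hLf hψ hκ hy ha hq)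
    have linear_bound : a (w - τ • q) ≤ Cf * ‖w - τ • q‖ :=
      (apply_le_opNorm_mul_norm _ _).trans
        (by gcongr; exact norm_le_of_mem_conjDom hCf hf.lipschitz ha)
    simp only [val, bregman, map_sub, map_smul, sub_apply, smul_eq_mul]
      at bregman_nonneg linear_bound
    linarith
  rw [argmaxDual, dif_pos exists_max]
  exact exists_max.choose_spec

theorem lipschitzWith_argmaxDual {ψ : StrongDual ℝ V → ℝ} (hf : OuterFunction Cf Lf f)
    (hCf : 0 ≤ Cf) (hLf : 0 < Lf) (hψ : (smooth ψ).Admissible f κ ρ) (hκ : 0 ≤ κ) (hτ : 0 ≤ τ) :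
    LipschitzWith ⟨Lf, hLf.le⟩ (argmaxDual f ψ τ) := by
  have spec := argmaxDual_spec hf hCf hLf hψ hκ hτ
  have grad w := isGrad_dualGrad (hψ.1 _ (spec w).1)
  refine LipschitzWith.of_dist_le_mul fun w w' => ?_
  rw [dist_eq_norm, dist_eq_norm]
  exact norm_sub_le_of_isMaxOn_dualObjective hf hLf hτ (spec w).1 (spec w).2 (grad w)
    (spec w').1 (spec w').2 (grad w') (bregman_nonneg hf hLf hψ hκ (spec w).1 (spec w').1 (grad w))
    (bregman_nonneg hf hLf hψ hκ (spec w').1 (spec w).1 (grad w'))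

theorem isDualStep_dualStep (hf : OuterFunction Cf Lf f) (hCf : 0 ≤ Cf) (hLf : 0 < Lf)
    (hψ : ψ.Admissible f κ ρ) (hκ : 0 ≤ κ) (hτ : 0 < τ) (gt q : V) (y : StrongDual ℝ V) :
    IsDualStep f ψ τ gt y q (ψ.dualStep f τ gt q).1 (ψ.dualStep f τ gt q).2 := by
  cases ψ with
  | conjugate => exact isDualStep_conjugate hf (by linarith) rfl
  | smooth ψ =>
    obtain ⟨mem, isMaxOn⟩ := argmaxDual_spec hf hCf hLf hψ hκ hτ.le (gt + τ • q)
    exact ⟨mem, isMaxOn_dualObjective_iff.2 isMaxOn, isGrad_dualGrad (hψ.1 _ mem)⟩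

theorem measurable_dualStep [MeasurableSpace V] [BorelSpace V] (hf : OuterFunction Cf Lf f)
    (hCf : 0 ≤ Cf) (hLf : 0 < Lf) (hψ : ψ.Admissible f κ ρ) (hκ : 0 ≤ κ) (hτ : 0 ≤ τ) :
    Measurable fun w : V × V => ψ.dualStep f τ w.1 w.2 := by
  cases ψ with
  | conjugate =>
    have : Measurable fun w : V × V => (1 / (1 + τ)) • (τ • w.2 + w.1) :=
      Continuous.measurable (by fun_prop)
    exact ((measurable_fderiv ℝ f).comp this).prodMk this
  | smooth ψ =>
    have : Measurable fun w : V × V => argmaxDual f ψ τ (w.1 + τ • w.2) :=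
      Continuous.measurable ((lipschitzWith_argmaxDual hf hCf hLf hψ hκ hτ).continuous.comp
        (by fun_prop))
    exact this.prodMk (measurable_dualGrad.comp this)

end DualStep

end DGF

theorem le_of_forall_one_sub_mul_le {K L : ℝ} (h : ∀ s : ℝ, 0 < s → s < 1 → (1 - s) * K ≤ L) :
    K ≤ L := by
  have htendsto :
      Filter.Tendsto (fun s : ℝ => (1 - s) * K) (nhdsWithin 0 (Set.Ioi 0)) (nhds K) := by
    have hcont : Continuous fun s : ℝ => (1 - s) * K := by fun_prop
    simpa using (hcont.tendsto 0).mono_left nhdsWithin_le_nhds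
  refine le_of_tendsto htendsto ?_
  filter_upwards [Ioo_mem_nhdsGT (one_pos : (0 : ℝ) < 1)] with s hs
  exact h s hs.1 hs.2

theorem norm_sq_convex_comb_sub {E : Type*} [NormedAddCommGroup E] [InnerProductSpace ℝ E]
    (x u v : E) (s : ℝ) : ‖(1 - s) • u + s • v - x‖ ^ 2 =
      (1 - s) * ‖u - x‖ ^ 2 + s * ‖v - x‖ ^ 2 - s * (1 - s) * ‖v - u‖ ^ 2 := by
  have hcomb : (1 - s) • u + s • v - x = (u - x) + s • (v - u) := by module
  have hsub : v - x = (u - x) + (v - u) := by module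
  rw [hcomb, hsub, norm_add_sq_real, norm_add_sq_real, norm_smul, inner_smul_right, mul_pow,
    Real.norm_eq_abs, sq_abs]
  ring

theorem norm_sub_sq_cross_difference {E : Type*} [NormedAddCommGroup E] [InnerProductSpace ℝ E]
    (c c' x x' : E) :
    ‖x' - c‖ ^ 2 - ‖x - c‖ ^ 2 + ‖x - c'‖ ^ 2 - ‖x' - c'‖ ^ 2 =
      2 * Inner.inner ℝ (c - c') (x - x') := by
  simp only [norm_sub_sq_real, inner_sub_left, inner_sub_right, real_inner_comm]
  ring

section Primal

variable {V : Type u} [NormedAddCommGroup V] [NormedSpace ℝ V] {d n m : ℕ}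
  {Z : Fin n → Type w} [∀ i, MeasurableSpace (Z i)] {p : Problem V d n Z}
  {b : Module.Basis (Fin m) ℝ V} {μ Cf Lf Cg σ₀ σ₁ δ : ℝ}

/-- `x'` solves the proximal subproblem of ALEXR with linear term `ℓ`, step size `1/η` and
proximal centre `x`. -/
def Problem.IsProx (p : Problem V d n Z) (η : ℝ) (ℓ : StrongDual ℝ (Primal d))
    (x x' : Primal d) : Prop :=
  x' ∈ p.X ∧
    IsMinOn (fun u => ((ℓ u + η / 2 * ‖u - x‖ ^ 2 : ℝ) : EReal) + p.r u) p.X x'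

namespace Problem.Assumptions

theorem coe_toReal_r (h : p.Assumptions b μ Cf Lf Cg σ₀ σ₁ δ) {x : Primal d} (hx : x ∈ p.X)
    (hr : p.r x ≠ ⊤) : ((p.r x).toReal : EReal) = p.r x :=
  EReal.coe_toReal hr (h.r_ne_bot x hx)

theorem convex_comb_mem (h : p.Assumptions b μ Cf Lf Cg σ₀ σ₁ δ) {x u : Primal d} (hx : x ∈ p.X)
    (hu : u ∈ p.X) {s : ℝ} (hs₀ : 0 < s) (hs₁ : s < 1) : (1 - s) • x + s • u ∈ p.X :=
  h.convex hx hu (by linarith) hs₀.le (by ring)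

theorem r_ne_top_of_isMinOn (h : p.Assumptions b μ Cf Lf Cg σ₀ σ₁ δ) {φ : Primal d → ℝ}
    {x : Primal d} (hmin : IsMinOn (fun u => (φ u : EReal) + p.r u) p.X x) : p.r x ≠ ⊤ := by
  obtain ⟨u, hu, hru⟩ := h.r_proper
  intro htop
  have hle : (φ x : EReal) + p.r x ≤ φ u + p.r u := hmin hu
  rw [htop, ← h.coe_toReal_r hu hru, ← EReal.coe_add, EReal.coe_add_top, top_le_iff] at hle
  exact EReal.coe_ne_top _ hle

theorem add_toReal_r_le_of_isMinOn (h : p.Assumptions b μ Cf Lf Cg σ₀ σ₁ δ) {φ : Primal d → ℝ}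
    {x u : Primal d} (hx : x ∈ p.X)
    (hmin : IsMinOn (fun u => (φ u : EReal) + p.r u) p.X x) (hu : u ∈ p.X) (hru : p.r u ≠ ⊤) :
    φ x + (p.r x).toReal ≤ φ u + (p.r u).toReal := by
  have hle : (φ x : EReal) + p.r x ≤ φ u + p.r u := hmin hu
  rwa [← h.coe_toReal_r hx (h.r_ne_top_of_isMinOn hmin), ← h.coe_toReal_r hu hru,
    ← EReal.coe_add, ← EReal.coe_add, EReal.coe_le_coe_iff] at hle

theorem r_convex_comb_ne_top (h : p.Assumptions b μ Cf Lf Cg σ₀ σ₁ δ) {x u : Primal d}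
    (hx : x ∈ p.X) (hu : u ∈ p.X) (hrx : p.r x ≠ ⊤) (hru : p.r u ≠ ⊤) {s : ℝ} (hs₀ : 0 < s)
    (hs₁ : s < 1) : p.r ((1 - s) • x + s • u) ≠ ⊤ := by
  intro htop
  have hle := h.r_strong x hx u hu (1 - s) s (by linarith) hs₀ (by ring)
  rw [htop, ← h.coe_toReal_r hx hrx, ← h.coe_toReal_r hu hru, ← EReal.coe_mul, ← EReal.coe_mul,
    ← EReal.coe_add, EReal.top_add_coe, top_le_iff] at hle
  exact EReal.coe_ne_top _ hle

theorem toReal_r_convex_comb_add_le (h : p.Assumptions b μ Cf Lf Cg σ₀ σ₁ δ) {x u : Primal d}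
    (hx : x ∈ p.X) (hu : u ∈ p.X) (hrx : p.r x ≠ ⊤) (hru : p.r u ≠ ⊤) {s : ℝ} (hs₀ : 0 < s)
    (hs₁ : s < 1) :
    (p.r ((1 - s) • x + s • u)).toReal + μ / 2 * (s * (1 - s)) * ‖u - x‖ ^ 2 ≤
      (1 - s) * (p.r x).toReal + s * (p.r u).toReal := by
  have hle := h.r_strong x hx u hu (1 - s) s (by linarith) hs₀ (by ring)
  rw [← h.coe_toReal_r hx hrx, ← h.coe_toReal_r hu hru,
    ← h.coe_toReal_r (h.convex_comb_mem hx hu hs₀ hs₁)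
      (h.r_convex_comb_ne_top hx hu hrx hru hs₀ hs₁),
    ← EReal.coe_mul, ← EReal.coe_mul, ← EReal.coe_add, ← EReal.coe_add,
    EReal.coe_le_coe_iff] at hle
  rw [norm_sub_rev u x]
  linarith

theorem r_ne_top_of_isProx (h : p.Assumptions b μ Cf Lf Cg σ₀ σ₁ δ)
    {ℓ : StrongDual ℝ (Primal d)} {η : ℝ} {x x' : Primal d} (hprox : p.IsProx η ℓ x x') :
    p.r x' ≠ ⊤ :=
  h.r_ne_top_of_isMinOn hprox.2

theorem prox_three_point (h : p.Assumptions b μ Cf Lf Cg σ₀ σ₁ δ)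
    {ℓ : StrongDual ℝ (Primal d)} {η : ℝ} {x x' : Primal d} (hprox : p.IsProx η ℓ x x')
    {u : Primal d} (hu : u ∈ p.X) (hru : p.r u ≠ ⊤) :
    ℓ x' + (p.r x').toReal + η / 2 * ‖x' - x‖ ^ 2 + (η + μ) / 2 * ‖u - x'‖ ^ 2 ≤
      ℓ u + (p.r u).toReal + η / 2 * ‖u - x‖ ^ 2 := by
  have hr' := h.r_ne_top_of_isProx hprox
  obtain ⟨hx', hmin⟩ := hprox
  suffices hgap : (η + μ) / 2 * ‖u - x'‖ ^ 2 ≤ ℓ u + (p.r u).toReal + η / 2 * ‖u - x‖ ^ 2 -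
      (ℓ x' + (p.r x').toReal + η / 2 * ‖x' - x‖ ^ 2) by linarith
  refine le_of_forall_one_sub_mul_le fun s hs₀ hs₁ => ?_
  have hstrong := h.toReal_r_convex_comb_add_le hx' hu hr' hru hs₀ hs₁
  have hle := h.add_toReal_r_le_of_isMinOn hx' hmin (h.convex_comb_mem hx' hu hs₀ hs₁)
    (h.r_convex_comb_ne_top hx' hu hr' hru hs₀ hs₁)
  rw [norm_sq_convex_comb_sub, map_add, map_smul, map_smul, smul_eq_mul, smul_eq_mul] at hle
  refine le_of_mul_le_mul_left ?_ hs₀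
  linarith

theorem mul_norm_sub_le_of_isProx (h : p.Assumptions b μ Cf Lf Cg σ₀ σ₁ δ) {η : ℝ} (hη : 0 ≤ η)
    {ℓ ℓ' : StrongDual ℝ (Primal d)} {c c' x x' : Primal d} (hx : p.IsProx η ℓ c x)
    (hx' : p.IsProx η ℓ' c' x') : (η + μ) * ‖x - x'‖ ≤ ‖ℓ - ℓ'‖ + η * ‖c - c'‖ := by
  have hle := h.prox_three_point hx hx'.1 (h.r_ne_top_of_isProx hx')
  have hle' := h.prox_three_point hx' hx.1 (h.r_ne_top_of_isProx hx)
  have hlin : ℓ x' - ℓ x - (ℓ' x' - ℓ' x) ≤ ‖ℓ - ℓ'‖ * ‖x - x'‖ := by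
    simpa only [sub_apply, map_sub, norm_sub_rev x' x, sub_sub_sub_comm (ℓ x') (ℓ' x')] using
      apply_le_opNorm_mul_norm (ℓ - ℓ') (x' - x)
  have hquad := mul_le_mul_of_nonneg_left (real_inner_le_norm (c - c') (x - x')) hη
  have hcross := norm_sub_sq_cross_difference c c' x x'
  rw [norm_sub_rev x' x] at hle
  have hsq : (η + μ) * ‖x - x'‖ * ‖x - x'‖ ≤ (‖ℓ - ℓ'‖ + η * ‖c - c'‖) * ‖x - x'‖ := by
    linear_combination hle + hle' + hlin + hquad + η / 2 * hcross
  rcases (norm_nonneg (x - x')).eq_or_lt with hzero | hpos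
  · rw [← hzero, mul_zero]; positivity
  · exact le_of_mul_le_mul_right hsq hpos

theorem exists_isMinOn_add_r_inter_closedBall (h : p.Assumptions b μ Cf Lf Cg σ₀ σ₁ δ)
    {φ : Primal d → ℝ} (hφ : Continuous φ) {x₀ : Primal d} (hx₀ : x₀ ∈ p.X) (hr₀ : p.r x₀ ≠ ⊤)
    {R : ℝ} (hR : 0 ≤ R) :
    ∃ x ∈ p.X ∩ Metric.closedBall x₀ R, p.r x ≠ ⊤ ∧ ∀ u ∈ p.X ∩ Metric.closedBall x₀ R,
      p.r u ≠ ⊤ → φ x + (p.r x).toReal ≤ φ u + (p.r u).toReal := by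
  have lsc : LowerSemicontinuousOn (fun u => (φ u : EReal) + p.r u)
      (p.X ∩ Metric.closedBall x₀ R) :=
    ((continuous_coe_real_ereal.comp hφ).lowerSemicontinuous.lowerSemicontinuousOn _).add'
      (h.r_lsc.mono Set.inter_subset_left) fun u _ =>
        EReal.continuousAt_add (.inl (EReal.coe_ne_top _)) (.inl (EReal.coe_ne_bot _))
  have hx₀R : x₀ ∈ p.X ∩ Metric.closedBall x₀ R := ⟨hx₀, Metric.mem_closedBall_self hR⟩
  obtain ⟨x, hx, hmin⟩ := lsc.exists_isMinOn ⟨x₀, hx₀R⟩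
    ((isCompact_closedBall x₀ R).inter_left h.closed)
  have hle (u) (hu : u ∈ p.X ∩ Metric.closedBall x₀ R) : (φ x : EReal) + p.r x ≤ φ u + p.r u :=
    hmin hu
  have hrx : p.r x ≠ ⊤ := fun htop => by
    have hle₀ := hle x₀ hx₀R
    rw [htop, ← h.coe_toReal_r hx₀ hr₀, ← EReal.coe_add, EReal.coe_add_top, top_le_iff] at hle₀
    exact EReal.coe_ne_top _ hle₀
  refine ⟨x, hx, hrx, fun u hu hru => ?_⟩
  have hleu := hle u hu
  rwa [← h.coe_toReal_r hx.1 hrx, ← h.coe_toReal_r hu.1 hru, ← EReal.coe_add, ← EReal.coe_add,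
    EReal.coe_le_coe_iff] at hleu

theorem isMinOn_add_r_of_forall_le (h : p.Assumptions b μ Cf Lf Cg σ₀ σ₁ δ) {φ : Primal d → ℝ}
    {x : Primal d} (hx : x ∈ p.X) (hrx : p.r x ≠ ⊤)
    (hle : ∀ u ∈ p.X, p.r u ≠ ⊤ → φ x + (p.r x).toReal ≤ φ u + (p.r u).toReal) :
    IsMinOn (fun u => (φ u : EReal) + p.r u) p.X x := by
  intro u hu
  change (φ x : EReal) + p.r x ≤ φ u + p.r u
  by_cases hru : p.r u = ⊤
  · rw [hru, EReal.coe_add_top]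
    exact le_top
  · rw [← h.coe_toReal_r hx hrx, ← h.coe_toReal_r hu hru, ← EReal.coe_add, ← EReal.coe_add,
      EReal.coe_le_coe_iff]
    exact hle u hu hru

/- The point of the segment from `x₀` to `u` at distance `1` from `x₀` has objective at least `c`,
which forces quadratic growth along the segment. -/
theorem le_add_toReal_r_of_one_le_norm (h : p.Assumptions b μ Cf Lf Cg σ₀ σ₁ δ)
    {φ : Primal d → ℝ} (hφ : ConvexOn ℝ Set.univ φ) {x₀ u : Primal d} {c : ℝ} (hx₀ : x₀ ∈ p.X)
    (hr₀ : p.r x₀ ≠ ⊤)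
    (hc : ∀ z ∈ p.X ∩ Metric.closedBall x₀ 1, p.r z ≠ ⊤ → c ≤ φ z + (p.r z).toReal)
    (hu : u ∈ p.X) (hru : p.r u ≠ ⊤) (hdist : 1 < ‖u - x₀‖) :
    φ x₀ + (p.r x₀).toReal +
        ‖u - x₀‖ * (c - (φ x₀ + (p.r x₀).toReal) + μ / 2 * (‖u - x₀‖ - 1)) ≤
      φ u + (p.r u).toReal := by
  set D := ‖u - x₀‖
  have hD : 0 < D := by linarith
  have hs₀ : 0 < 1 / D := by positivity
  have hs₁ : 1 / D < 1 := by rwa [div_lt_one hD]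
  have hball : (1 - 1 / D) • x₀ + (1 / D) • u ∈ Metric.closedBall x₀ 1 := by
    have hstep : (1 - 1 / D) • x₀ + (1 / D) • u - x₀ = (1 / D) • (u - x₀) := by module
    rw [mem_closedBall_iff_norm, hstep, norm_smul, Real.norm_of_nonneg hs₀.le,
      one_div_mul_cancel hD.ne']
  have hlower := hc _ ⟨h.convex_comb_mem hx₀ hu hs₀ hs₁, hball⟩
    (h.r_convex_comb_ne_top hx₀ hu hr₀ hru hs₀ hs₁)
  have hstrong := h.toReal_r_convex_comb_add_le hx₀ hu hr₀ hru hs₀ hs₁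
  have hconv := hφ.2 (Set.mem_univ x₀) (Set.mem_univ u) (by linarith : 0 ≤ 1 - 1 / D) hs₀.le
    (by ring)
  rw [smul_eq_mul, smul_eq_mul] at hconv
  have hsegment : c + μ / 2 * (1 / D * (1 - 1 / D)) * D ^ 2 ≤
      (1 - 1 / D) * (φ x₀ + (p.r x₀).toReal) + 1 / D * (φ u + (p.r u).toReal) := by linarith
  have hscaled := mul_le_mul_of_nonneg_left hsegment hD.le
  have hcancel : D * (1 / D) = 1 := mul_one_div_cancel hD.ne'
  linear_combination hscaled + (φ u + (p.r u).toReal - φ x₀ - (p.r x₀).toReal -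
    μ / 2 * D * (D - 1 - D * (1 / D))) * hcancel

theorem exists_isMinOn_add_r (h : p.Assumptions b μ Cf Lf Cg σ₀ σ₁ δ) (hμ : 0 < μ)
    {φ : Primal d → ℝ} (hcont : Continuous φ) (hconv : ConvexOn ℝ Set.univ φ) :
    ∃ x ∈ p.X, IsMinOn (fun u => (φ u : EReal) + p.r u) p.X x := by
  obtain ⟨x₀, hx₀, hr₀⟩ := h.r_proper
  obtain ⟨z, -, -, hz⟩ := h.exists_isMinOn_add_r_inter_closedBall hcont hx₀ hr₀ zero_le_one
  set c := φ z + (p.r z).toReal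
  set Φ₀ := φ x₀ + (p.r x₀).toReal
  have hc : c ≤ Φ₀ := hz x₀ ⟨hx₀, Metric.mem_closedBall_self zero_le_one⟩ hr₀
  set R := 1 + 2 * (Φ₀ - c) / μ
  have hR : 1 ≤ R := le_add_of_nonneg_right (div_nonneg (by linarith) hμ.le)
  obtain ⟨x, hx, hrx, hmin⟩ :=
    h.exists_isMinOn_add_r_inter_closedBall hcont hx₀ hr₀ (zero_le_one.trans hR)
  refine ⟨x, hx.1, h.isMinOn_add_r_of_forall_le hx.1 hrx fun u hu hru => ?_⟩
  rcases le_or_gt ‖u - x₀‖ R with hnear | hfar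
  · exact hmin u ⟨hu, mem_closedBall_iff_norm.2 hnear⟩ hru
  · have hgrowth :=
      h.le_add_toReal_r_of_one_le_norm hconv hx₀ hr₀ hz hu hru (hR.trans_lt hfar)
    have hslope : 0 ≤ c - Φ₀ + μ / 2 * (‖u - x₀‖ - 1) := by
      have : μ / 2 * (R - 1) = Φ₀ - c := by simp only [R]; field_simp; ring
      nlinarith
    have hbase := hmin x₀ ⟨hx₀, Metric.mem_closedBall_self (zero_le_one.trans hR)⟩ hr₀
    linarith [mul_nonneg (norm_nonneg (u - x₀)) hslope]

theorem exists_isProx (h : p.Assumptions b μ Cf Lf Cg σ₀ σ₁ δ) (hμ : 0 < μ) {η : ℝ} (hη : 0 ≤ η)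
    (ℓ : StrongDual ℝ (Primal d)) (x : Primal d) : ∃ x', p.IsProx η ℓ x x' := by
  have hsq : ConvexOn ℝ Set.univ fun u : Primal d => η / 2 * ‖u - x‖ ^ 2 := by
    simpa only [dist_eq_norm, Pi.pow_apply, smul_eq_mul] using
      ((convexOn_dist x convex_univ).pow (fun _ _ => dist_nonneg) 2).smul
        (by positivity : 0 ≤ η / 2)
  exact h.exists_isMinOn_add_r hμ (by fun_prop) ((ℓ.toLinearMap.convexOn convex_univ).add hsq)

theorem exists_continuous_prox (h : p.Assumptions b μ Cf Lf Cg σ₀ σ₁ δ) {η : ℝ} (hη : 0 ≤ η)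
    (hμ : 0 < μ) : ∃ prox : StrongDual ℝ (Primal d) × Primal d → Primal d, Continuous prox ∧
      ∀ ℓ x x', p.IsProx η ℓ x x' ↔ x' = prox (ℓ, x) := by
  choose prox hprox using fun w : StrongDual ℝ (Primal d) × Primal d =>
    h.exists_isProx hμ hη w.1 w.2
  have hlip : LipschitzWith ((1 + η) / (η + μ)).toNNReal prox := by
    refine LipschitzWith.of_dist_le_mul fun w w' => ?_
    have hle := h.mul_norm_sub_le_of_isProx hη (hprox w) (hprox w')
    have hfst : ‖w.1 - w'.1‖ ≤ ‖w - w'‖ := norm_fst_le (w - w')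
    have hsnd : ‖w.2 - w'.2‖ ≤ ‖w - w'‖ := norm_snd_le (w - w')
    rw [Real.coe_toNNReal _ (by positivity), dist_eq_norm, dist_eq_norm, div_mul_eq_mul_div,
      le_div_iff₀ (by positivity)]
    linear_combination hle + hfst + η * hsnd
  refine ⟨prox, hlip.continuous, fun ℓ x x' => ⟨fun hx' => ?_, fun hx' => hx' ▸ hprox (ℓ, x)⟩⟩
  have hle := h.mul_norm_sub_le_of_isProx hη hx' (hprox (ℓ, x))
  rw [sub_self, sub_self, norm_zero, norm_zero, mul_zero, add_zero] at hle
  exact sub_eq_zero.1 (norm_le_zero_iff.1 (nonpos_of_mul_nonpos_right hle (by positivity)))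

-- Coordinatewise convexity of `inner i` only passes through a monotone `f i`.
theorem f_inner_convex_comb_le (h : p.Assumptions b μ Cf Lf Cg σ₀ σ₁ δ) (i : Fin n)
    {x u : Primal d} (hx : x ∈ p.X) (hu : u ∈ p.X) {s : ℝ} (hs₀ : 0 < s) (hs₁ : s < 1) :
    p.f i (p.inner i ((1 - s) • x + s • u)) ≤
      p.f i (p.inner i x + s • (p.inner i u - p.inner i x)) := by
  rcases h.outer_mono i with hmono | haffine
  · refine hmono _ _ fun j => ?_
    refine ((h.g_convex i j).2 hx hu (by linarith : 0 ≤ 1 - s) hs₀.le (by ring)).trans_eq ?_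
    simp only [map_add, map_smul, map_sub, Finsupp.coe_add, Finsupp.coe_smul, Finsupp.coe_sub,
      Pi.add_apply, Pi.smul_apply, Pi.sub_apply, smul_eq_mul]
    ring
  · have hstep : (1 - s) • x + s • u - x = s • (u - x) := by module
    rw [haffine x hx _ (h.convex_comb_mem hx hu hs₀ hs₁), haffine x hx u hu, hstep, map_smul,
      add_sub_cancel_left]

theorem hasFDerivAt_average_f (h : p.Assumptions b μ Cf Lf Cg σ₀ σ₁ δ) (z : Fin n → V) :
    HasFDerivAt (fun v : Fin n → V => (1 / n : ℝ) * ∑ i, p.f i (v i))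
      ((1 / n : ℝ) • ∑ i, (fderiv ℝ (p.f i) (z i)).comp
        (ContinuousLinearMap.proj (R := ℝ) i)) z := by
  refine HasFDerivAt.const_mul (HasFDerivAt.fun_sum fun i _ => ?_) _
  exact HasFDerivAt.comp (g := p.f i) (f := fun v : Fin n → V => v i) z
    ((h.outer i).differentiable _).hasFDerivAt (hasFDerivAt_apply (𝕜 := ℝ) i z)

theorem r_minimizer_ne_top (h : p.Assumptions b μ Cf Lf Cg σ₀ σ₁ δ) {xs : Primal d}
    (hxs : p.IsMinimizer xs) : p.r xs ≠ ⊤ :=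
  h.r_ne_top_of_isMinOn hxs.2

theorem minimizer_objective_le (h : p.Assumptions b μ Cf Lf Cg σ₀ σ₁ δ) {xs u : Primal d}
    (hxs : p.IsMinimizer xs) (hu : u ∈ p.X) (hru : p.r u ≠ ⊤) :
    (1 / n : ℝ) * ∑ i, p.f i (p.inner i xs) + (p.r xs).toReal ≤
      (1 / n : ℝ) * ∑ i, p.f i (p.inner i u) + (p.r u).toReal :=
  h.add_toReal_r_le_of_isMinOn hxs.1 hxs.2 hu hru

theorem minimizer_slope_le (h : p.Assumptions b μ Cf Lf Cg σ₀ σ₁ δ) (hμ : 0 ≤ μ)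
    {xs u : Primal d} (hxs : p.IsMinimizer xs) (hu : u ∈ p.X) (hru : p.r u ≠ ⊤) {s : ℝ}
    (hs₀ : 0 < s) (hs₁ : s < 1) :
    s * ((p.r xs).toReal - (p.r u).toReal) ≤
      (1 / n : ℝ) * ∑ i, p.f i (p.inner i xs + s • (p.inner i u - p.inner i xs)) -
        (1 / n : ℝ) * ∑ i, p.f i (p.inner i xs) := by
  have hrs := h.r_minimizer_ne_top hxs
  have hmin := h.minimizer_objective_le hxs (h.convex_comb_mem hxs.1 hu hs₀ hs₁)
    (h.r_convex_comb_ne_top hxs.1 hu hrs hru hs₀ hs₁)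
  have hstrong := h.toReal_r_convex_comb_add_le hxs.1 hu hrs hru hs₀ hs₁
  have hcomb : (1 / n : ℝ) * ∑ i, p.f i (p.inner i ((1 - s) • xs + s • u)) ≤
      (1 / n : ℝ) * ∑ i, p.f i (p.inner i xs + s • (p.inner i u - p.inner i xs)) := by
    gcongr with i
    exact h.f_inner_convex_comb_le i hxs.1 hu hs₀ hs₁
  have hcurv : 0 ≤ μ / 2 * (s * (1 - s)) * ‖u - xs‖ ^ 2 := by
    have : 0 ≤ 1 - s := by linarith
    positivity
  linarith

theorem first_order_optimality (h : p.Assumptions b μ Cf Lf Cg σ₀ σ₁ δ) (hμ : 0 ≤ μ)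
    {xs u : Primal d} (hxs : p.IsMinimizer xs) (hu : u ∈ p.X) (hru : p.r u ≠ ⊤) :
    0 ≤ (1 / n : ℝ) * ∑ i, fderiv ℝ (p.f i) (p.inner i xs) (p.inner i u - p.inner i xs) +
      (p.r u).toReal - (p.r xs).toReal := by
  have hslope := le_fderiv_apply_of_forall_mul_le (v := fun i => p.inner i u - p.inner i xs)
    (K := (p.r xs).toReal - (p.r u).toReal) (h.hasFDerivAt_average_f fun i => p.inner i xs)
    fun s hs₀ hs₁ => by
      rcases hs₁.eq_or_lt with rfl | hs₁
      · simp only [Pi.add_apply, one_smul, add_sub_cancel]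
        linarith [h.minimizer_objective_le hxs hu hru]
      · exact h.minimizer_slope_le hμ hxs hu hru hs₀ hs₁
  simp only [smul_apply, sum_apply, ContinuousLinearMap.comp_apply,
    ContinuousLinearMap.proj_apply, smul_eq_mul] at hslope
  linarith

end Problem.Assumptions

end Primal

/-- The numerical conditions under which one iteration decreases the Lyapunov function: `κ` and `ρ`
are the strong convexity and the relative growth of the distance-generating functions, and `k₁` is
the quadratic part of the linearization error of the inner functions. -/
structure StepRegime (Cf Lf Cg ρ κ θ η τ k₁ : ℝ) : Prop where
  Cf_nonneg : 0 ≤ Cf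
  Lf_pos : 0 < Lf
  ρ_pos : 0 < ρ
  ρ_le_one : ρ ≤ 1
  κ_pos : 0 < κ
  κ_le : κ ≤ 1 / Lf
  θ_nonneg : 0 ≤ θ
  θ_le_one : θ ≤ 1
  τ_pos : 0 < τ
  η_pos : 0 < η
  coupling : 2 * Cg ^ 2 / (ρ * κ) ≤ η / 16
  curvature : Cf * k₁ ≤ η / 8

section OneStep

variable {V : Type u} [NormedAddCommGroup V] [NormedSpace ℝ V] {d n m : ℕ}
  {Z : Fin n → Type w} [∀ i, MeasurableSpace (Z i)]

namespace Problem

/-- The mean of the extrapolated estimator `g̃^{(i)}` with previous iterate `xprev`. -/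
noncomputable def extrapMean (p : Problem V d n Z) (θ : ℝ) (i : Fin n) (xprev x : Primal d) : V :=
  (1 + θ) • p.inner i x - θ • p.inner i xprev

/-- The mean `(1/n) ∑ [g_i'(x)]ᵀ y^{(i)}` of the stochastic gradient, as a functional. -/
noncomputable def gradMean (p : Problem V d n Z) (x : Primal d) (y : Fin n → StrongDual ℝ V) :
    StrongDual ℝ (Primal d) :=
  (1 / n : ℝ) • ∑ i, (y i).comp (p.innerD i x)

/-- The optimal dual block `y_*^{(i)} = ∇ f_i(g_i(x_*))`. -/
noncomputable def optDual (p : Problem V d n Z) (xs : Primal d) (i : Fin n) : StrongDual ℝ V :=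
  fderiv ℝ (p.f i) (p.inner i xs)

/-- The Bregman divergence `U_{ψ_i}(y_*^{(i)}, y)`, formed with the (sub)gradient `q` at `y`. -/
noncomputable def dualGap (p : Problem V d n Z) (ψ : Fin n → DGF V) (xs : Primal d) (i : Fin n)
    (y : StrongDual ℝ V) (q : V) : ℝ :=
  bregman ((ψ i).val (p.f i)) (p.optDual xs i) y q

/-- A bound on the linearization errors of the inner functions which covers the smooth case
(`k₂ = 0`) and the Lipschitz case (`k₁ > 0` arbitrary, with `k₂` of order `1 / k₁`) at once. -/
def LinearizationBound (p : Problem V d n Z) (k₁ k₂ : ℝ) : Prop :=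
  ∀ i, ∀ x ∈ p.X, ∀ x' ∈ p.X,
    ‖p.inner i x' - p.inner i x - p.innerD i x (x' - x)‖ ≤ k₁ * ‖x' - x‖ ^ 2 + k₂

end Problem

variable {p : Problem V d n Z} {b : Module.Basis (Fin m) ℝ V} {ψ : Fin n → DGF V}
  {μ Cf Lf Cg σ₀ σ₁ δ ρ κ θ η τ k₁ k₂ : ℝ} {i : Fin n} {xs xp x x' : Primal d}

theorem OuterFunction.apply_sub_conj_le {f : V → ℝ} (hf : OuterFunction Cf Lf f) (z : V)
    {y : StrongDual ℝ V} (hy : y ∈ conjDom f) :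
    y z - conj f y ≤ fderiv ℝ f z z - conj f (fderiv ℝ f z) := by
  linarith [le_conj hy z, hf.conj_fderiv z]

namespace Problem.Assumptions

theorem apply_inner_add_innerD_le (h : p.Assumptions b μ Cf Lf Cg σ₀ σ₁ δ) (hx : x ∈ p.X)
    (hx' : x' ∈ p.X) {y : StrongDual ℝ V} (hy : y ∈ conjDom (p.f i)) :
    y (p.inner i x) + y (p.innerD i x (x' - x)) ≤ y (p.inner i x') := by
  rw [← map_add]
  rcases h.outer_mono i with monotone | affine
  · refine apply_le_apply_of_coordMonotone monotone hy fun j => ?_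
    rw [map_add, Finsupp.add_apply]
    exact h.Dg_subgrad i x hx x' hx' j
  · rw [affine x hx x' hx']

theorem norm_inner_sub_extrap_le (h : p.Assumptions b μ Cf Lf Cg σ₀ σ₁ δ) (hθ : 0 ≤ θ)
    (hθ₁ : θ ≤ 1) (hxp : xp ∈ p.X) (hx : x ∈ p.X) (hx' : x' ∈ p.X) :
    ‖p.inner i x' - p.extrapMean θ i xp x‖ ≤ Cg * (‖x' - x‖ + ‖x - xp‖) := by
  have lipschitz := h.g_lipschitz i
  calc ‖p.inner i x' - p.extrapMean θ i xp x‖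
      = ‖(p.inner i x' - p.inner i x) - θ • (p.inner i x - p.inner i xp)‖ := by
        rw [extrapMean]; congr 1; module
    _ ≤ ‖p.inner i x' - p.inner i x‖ + θ * ‖p.inner i x - p.inner i xp‖ := by
        simpa only [norm_smul, Real.norm_of_nonneg hθ] using
          norm_sub_le (p.inner i x' - p.inner i x) (θ • (p.inner i x - p.inner i xp))
    _ ≤ Cg * ‖x' - x‖ + 1 * (Cg * ‖x - xp‖) := by
        gcongr
        exacts [lipschitz x' hx' x hx, lipschitz x hx xp hxp]
    _ = Cg * (‖x' - x‖ + ‖x - xp‖) := by ring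

theorem apply_inner_sub_extrap_le (h : p.Assumptions b μ Cf Lf Cg σ₀ σ₁ δ)
    (reg : StepRegime Cf Lf Cg ρ κ θ η τ k₁) (hxp : xp ∈ p.X) (hx : x ∈ p.X) (hx' : x' ∈ p.X)
    (a : StrongDual ℝ V) :
    a (p.inner i x' - p.extrapMean θ i xp x) ≤
      ρ * (κ / 4 * ‖a‖ ^ 2) + η / 16 * (‖x' - x‖ ^ 2 + ‖x - xp‖ ^ 2) := by
  have := reg.ρ_pos
  have := reg.κ_pos
  calc a (p.inner i x' - p.extrapMean θ i xp x)
      ≤ ρ * κ / 4 * ‖a‖ ^ 2 + ‖p.inner i x' - p.extrapMean θ i xp x‖ ^ 2 / (4 * (ρ * κ / 4)) :=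
        apply_le_mul_norm_sq_add (by positivity) a _
    _ ≤ ρ * κ / 4 * ‖a‖ ^ 2 + (Cg * (‖x' - x‖ + ‖x - xp‖)) ^ 2 / (4 * (ρ * κ / 4)) := by
        gcongr
        exact h.norm_inner_sub_extrap_le reg.θ_nonneg reg.θ_le_one hxp hx hx'
    _ ≤ ρ * κ / 4 * ‖a‖ ^ 2 +
          Cg ^ 2 * (2 * (‖x' - x‖ ^ 2 + ‖x - xp‖ ^ 2)) / (4 * (ρ * κ / 4)) := by
        rw [mul_pow]
        gcongr
        exact add_sq_le
    _ = ρ * (κ / 4 * ‖a‖ ^ 2) + 2 * Cg ^ 2 / (ρ * κ) * (‖x' - x‖ ^ 2 + ‖x - xp‖ ^ 2) := by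
        field_simp
    _ ≤ _ := by
        have : 0 ≤ ‖x' - x‖ ^ 2 + ‖x - xp‖ ^ 2 := by positivity
        linarith [mul_le_mul_of_nonneg_right reg.coupling this]

theorem apply_linearization_error_le (h : p.Assumptions b μ Cf Lf Cg σ₀ σ₁ δ)
    (reg : StepRegime Cf Lf Cg ρ κ θ η τ k₁) (lin : p.LinearizationBound k₁ k₂) (hx : x ∈ p.X)
    (hx' : x' ∈ p.X) {y : StrongDual ℝ V} (hy : y ∈ conjDom (p.f i)) :
    y (p.inner i x' - p.inner i x - p.innerD i x (x' - x)) ≤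
      η / 8 * ‖x' - x‖ ^ 2 + Cf * k₂ := by
  have hCf := reg.Cf_nonneg
  calc y (p.inner i x' - p.inner i x - p.innerD i x (x' - x))
      ≤ ‖y‖ * ‖p.inner i x' - p.inner i x - p.innerD i x (x' - x)‖ := apply_le_opNorm_mul_norm _ _
    _ ≤ Cf * (k₁ * ‖x' - x‖ ^ 2 + k₂) := by
        gcongr
        exacts [norm_le_of_mem_conjDom hCf (h.outer i).lipschitz hy, lin i x hx x' hx']
    _ = Cf * k₁ * ‖x' - x‖ ^ 2 + Cf * k₂ := by ring
    _ ≤ _ := by gcongr; exact reg.curvature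

theorem optDual_mem_conjDom (h : p.Assumptions b μ Cf Lf Cg σ₀ σ₁ δ) (xs : Primal d) (i : Fin n) :
    p.optDual xs i ∈ conjDom (p.f i) :=
  (h.outer i).fderiv_mem_conjDom _

theorem mul_norm_sq_le_dualGap (h : p.Assumptions b μ Cf Lf Cg σ₀ σ₁ δ)
    (reg : StepRegime Cf Lf Cg ρ κ θ η τ k₁) (hψ : ∀ i, (ψ i).Admissible (p.f i) κ ρ)
    {y : StrongDual ℝ V} {q : V} (hy : y ∈ conjDom (p.f i))
    (hq : (ψ i).IsSubgrad (p.f i) y q) :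
    κ / 2 * ‖p.optDual xs i - y‖ ^ 2 ≤ p.dualGap ψ xs i y q :=
  DGF.norm_sq_le_bregman (h.outer i) reg.Lf_pos (hψ i) reg.κ_le hy (h.optDual_mem_conjDom xs i) hq

/- The term `τ U(y', y)` of the three-point inequality absorbs the noise tested with `y' - y`, so
that only the noise tested with `y - y_*`, which has mean zero, is left. -/
theorem optDual_apply_inner_sub_le (h : p.Assumptions b μ Cf Lf Cg σ₀ σ₁ δ)
    (reg : StepRegime Cf Lf Cg ρ κ θ η τ k₁) (lin : p.LinearizationBound k₁ k₂)
    (hψ : ∀ i, (ψ i).Admissible (p.f i) κ ρ) (hxs : xs ∈ p.X) (hxp : xp ∈ p.X) (hx : x ∈ p.X)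
    (hx' : x' ∈ p.X) {y y' : StrongDual ℝ V} {q q' gt : V} (hy : y ∈ conjDom (p.f i))
    (hq : (ψ i).IsSubgrad (p.f i) y q) (step : (ψ i).IsDualStep (p.f i) τ gt y q y' q') :
    p.optDual xs i (p.inner i x' - p.inner i xs) ≤
      τ * p.dualGap ψ xs i y q - (τ + ρ / 2) * p.dualGap ψ xs i y' q'
      + 3 * η / 16 * ‖x' - x‖ ^ 2 + η / 16 * ‖x - xp‖ ^ 2
      + (y - p.optDual xs i) (gt - p.extrapMean θ i xp x)
      + ‖gt - p.extrapMean θ i xp x‖ ^ 2 / (2 * τ * κ) + Cf * k₂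
      + y' (p.innerD i x (x' - xs)) := by
  have hf := h.outer i
  have hτ := reg.τ_pos
  have hκ := reg.κ_pos
  have three_point := step.three_point hf reg.Lf_pos (hψ i) reg.ρ_le_one hτ
    (h.optDual_mem_conjDom xs i)
  have proximity := mul_le_mul_of_nonneg_left
    (DGF.norm_sq_le_bregman hf reg.Lf_pos (hψ i) reg.κ_le hy step.mem hq) hτ.le
  have growth := mul_le_mul_of_nonneg_left
    (h.mul_norm_sq_le_dualGap (xs := xs) reg hψ step.mem (step.isSubgrad hf hτ)) reg.ρ_pos.le
  have fenchel : y' (p.inner i xs) - conj (p.f i) y' ≤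
      p.optDual xs i (p.inner i xs) - conj (p.f i) (p.optDual xs i) :=
    hf.apply_sub_conj_le (p.inner i xs) step.mem
  have convexity := h.apply_inner_add_innerD_le hx hxs step.mem
  have linearization := h.apply_linearization_error_le reg lin hx hx' step.mem
  have movement := h.apply_inner_sub_extrap_le (i := i) reg hxp hx hx' (p.optDual xs i - y')
  have noise := apply_le_mul_norm_sq_add (by positivity : 0 < τ * κ / 2) (y' - y)
    (gt - p.extrapMean θ i xp x)
  have directions := congrArg (fun u => y' (p.innerD i x u)) (sub_sub_sub_cancel_right x' xs x)
  rw [show 4 * (τ * κ / 2) = 2 * τ * κ by ring] at noise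
  rw [dualGap, dualGap] at *
  simp only [map_sub, sub_apply] at *
  linarith

theorem average_optDual_apply_inner_sub_le (h : p.Assumptions b μ Cf Lf Cg σ₀ σ₁ δ)
    (reg : StepRegime Cf Lf Cg ρ κ θ η τ k₁) (lin : p.LinearizationBound k₁ k₂)
    (hψ : ∀ i, (ψ i).Admissible (p.f i) κ ρ) (hn : 0 < n) (hxs : xs ∈ p.X) (hxp : xp ∈ p.X)
    (hx : x ∈ p.X) (hx' : x' ∈ p.X) {y y' : Fin n → StrongDual ℝ V} {q q' gt : Fin n → V}
    (hy : ∀ i, y i ∈ conjDom (p.f i)) (hq : ∀ i, (ψ i).IsSubgrad (p.f i) (y i) (q i))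
    (step : ∀ i, (ψ i).IsDualStep (p.f i) τ (gt i) (y i) (q i) (y' i) (q' i)) :
    (1 / n : ℝ) * ∑ i, p.optDual xs i (p.inner i x' - p.inner i xs) ≤
      τ * ((1 / n : ℝ) * ∑ i, p.dualGap ψ xs i (y i) (q i))
      - (τ + ρ / 2) * ((1 / n : ℝ) * ∑ i, p.dualGap ψ xs i (y' i) (q' i))
      + 3 * η / 16 * ‖x' - x‖ ^ 2 + η / 16 * ‖x - xp‖ ^ 2
      + (1 / n : ℝ) * ∑ i, (y i - p.optDual xs i) (gt i - p.extrapMean θ i xp x)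
      + (1 / n : ℝ) * ∑ i, ‖gt i - p.extrapMean θ i xp x‖ ^ 2 / (2 * τ * κ) + Cf * k₂
      + p.gradMean x y' (x' - xs) := by
  have average_const (c : ℝ) : (1 / n : ℝ) * ∑ _i : Fin n, c = c := by
    rw [Finset.sum_const, Finset.card_univ, Fintype.card_fin, nsmul_eq_mul, ← mul_assoc,
      one_div_mul_cancel (by positivity), one_mul]
  have blocks := mul_le_mul_of_nonneg_left (Finset.sum_le_sum fun i (_ : i ∈ Finset.univ) =>
    h.optDual_apply_inner_sub_le reg lin hψ hxs hxp hx hx' (hy i) (hq i) (step i))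
    (by positivity : (0 : ℝ) ≤ 1 / n)
  simp only [Finset.sum_add_distrib, Finset.sum_sub_distrib, mul_add, mul_sub, ← Finset.mul_sum]
    at blocks
  simp only [mul_left_comm (1 / n : ℝ), average_const] at blocks
  simp only [gradMean, smul_apply, sum_apply, ContinuousLinearMap.comp_apply, smul_eq_mul]
  linarith

theorem one_step_inequality (h : p.Assumptions b μ Cf Lf Cg σ₀ σ₁ δ)
    (reg : StepRegime Cf Lf Cg ρ κ θ η τ k₁) (lin : p.LinearizationBound k₁ k₂)
    (hψ : ∀ i, (ψ i).Admissible (p.f i) κ ρ) (hμ : 0 ≤ μ) (hn : 0 < n) (hxs : p.IsMinimizer xs)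
    (hxp : xp ∈ p.X) (hx : x ∈ p.X) {y y' : Fin n → StrongDual ℝ V} {q q' gt : Fin n → V}
    (hy : ∀ i, y i ∈ conjDom (p.f i)) (hq : ∀ i, (ψ i).IsSubgrad (p.f i) (y i) (q i))
    (step : ∀ i, (ψ i).IsDualStep (p.f i) τ (gt i) (y i) (q i) (y' i) (q' i))
    {G : StrongDual ℝ (Primal d)} (prox : p.IsProx η G x x') :
    (η + μ) / 2 * ‖x' - xs‖ ^ 2 + η / 8 * ‖x' - x‖ ^ 2
      + (τ + ρ / 2) * ((1 / n : ℝ) * ∑ i, p.dualGap ψ xs i (y' i) (q' i)) ≤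
      η / 2 * ‖x - xs‖ ^ 2 + η / 16 * ‖x - xp‖ ^ 2
      + τ * ((1 / n : ℝ) * ∑ i, p.dualGap ψ xs i (y i) (q i))
      + (1 / n : ℝ) * ∑ i, (y i - p.optDual xs i) (gt i - p.extrapMean θ i xp x)
      + (1 / n : ℝ) * ∑ i, ‖gt i - p.extrapMean θ i xp x‖ ^ 2 / (2 * τ * κ)
      + (p.gradMean x y' - G) (x - xs) + 2 / η * ‖p.gradMean x y' - G‖ ^ 2 + Cf * k₂ := by
  have hη := reg.η_pos
  have primal := h.prox_three_point prox hxs.1 (h.r_minimizer_ne_top hxs)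
  have optimality := h.first_order_optimality hμ hxs prox.1 (h.r_ne_top_of_isProx prox)
  have dual := h.average_optDual_apply_inner_sub_le reg lin hψ hn hxs.1 hxp hx prox.1 hy hq step
  have gradient_noise : (p.gradMean x y' - G) (x' - x) ≤
      2 / η * ‖p.gradMean x y' - G‖ ^ 2 + η / 8 * ‖x' - x‖ ^ 2 := by
    convert apply_le_mul_norm_sq_add (by positivity : 0 < 2 / η) (p.gradMean x y' - G) (x' - x)
      using 2
    field_simp
    ring
  have gradient_split : p.gradMean x y' (x' - xs) - G x' + G xs =
      (p.gradMean x y' - G) (x - xs) + (p.gradMean x y' - G) (x' - x) := by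
    simp only [map_sub, sub_apply]
    ring
  have : 0 ≤ η * ‖x' - x‖ ^ 2 := by positivity
  rw [norm_sub_rev xs x', norm_sub_rev xs x] at primal
  unfold optDual at *
  linarith

end Problem.Assumptions

end OneStep

theorem integrable_of_nonneg_of_le {α : Type*} [MeasurableSpace α] {μ : Measure α} {f φ : α → ℝ}
    (hf : AEStronglyMeasurable f μ) (nonneg : ∀ a, 0 ≤ f a) (le : ∀ a, f a ≤ φ a)
    (hφ : Integrable φ μ) : Integrable f μ :=
  hφ.mono' hf (.of_forall fun a => by rw [Real.norm_eq_abs, abs_of_nonneg (nonneg a)]; exact le a)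

theorem norm_sub_sq_le_two_mul {E : Type*} [NormedAddCommGroup E] (a c : E) :
    ‖a - c‖ ^ 2 ≤ 2 * (‖a‖ ^ 2 + ‖c‖ ^ 2) :=
  (pow_le_pow_left₀ (norm_nonneg _) (norm_sub_le a c) 2).trans add_sq_le

theorem norm_sq_sum_le_card_mul {ι E : Type*} [NormedAddCommGroup E] (A : Finset ι) (v : ι → E) :
    ‖∑ i ∈ A, v i‖ ^ 2 ≤ A.card * ∑ i ∈ A, ‖v i‖ ^ 2 :=
  (pow_le_pow_left₀ (norm_nonneg _) (norm_sum_le A v) 2).trans sq_sum_le_card_mul_sum_sq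

theorem norm_sq_apply_le {E F : Type*} [NormedAddCommGroup E] [NormedSpace ℝ E]
    [NormedAddCommGroup F] [NormedSpace ℝ F] (L : E →L[ℝ] F) (v : E) :
    ‖L v‖ ^ 2 ≤ ‖L‖ ^ 2 * ‖v‖ ^ 2 := by
  rw [← mul_pow]
  gcongr
  exact L.le_opNorm v

theorem integral_norm_sq_apply_le {𝒵 E F : Type*} [MeasurableSpace 𝒵] {P : Measure 𝒵}
    [NormedAddCommGroup E] [NormedSpace ℝ E] [NormedAddCommGroup F] [NormedSpace ℝ F]
    (L : E →L[ℝ] F) {N : 𝒵 → E} (hN : AEStronglyMeasurable N P) {s : ℝ}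
    (hN2 : Integrable (fun z => ‖N z‖ ^ 2) P) (hs : ∫ z, ‖N z‖ ^ 2 ∂P ≤ s) :
    Integrable (fun z => ‖L (N z)‖ ^ 2) P ∧ ∫ z, ‖L (N z)‖ ^ 2 ∂P ≤ ‖L‖ ^ 2 * s := by
  have sq_int : Integrable (fun z => ‖L (N z)‖ ^ 2) P :=
    integrable_of_nonneg_of_le ((L.continuous.comp_aestronglyMeasurable hN).norm.pow 2)
      (fun _ => by positivity) (fun z => norm_sq_apply_le L (N z)) (hN2.const_mul _)
  refine ⟨sq_int, (integral_mono sq_int (hN2.const_mul _) fun z =>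
    norm_sq_apply_le L (N z)).trans ?_⟩
  rw [integral_const_mul]
  gcongr

section Batch

variable {𝒵 E H : Type*} [MeasurableSpace 𝒵] {P : Measure 𝒵} [IsProbabilityMeasure P]
  [NormedAddCommGroup E] [NormedSpace ℝ E] [NormedAddCommGroup H] [InnerProductSpace ℝ H]
  {B : ℕ} {s : ℝ}

theorem integrable_average_pi {N : 𝒵 → E} (hN : Integrable N P) :
    Integrable (fun β : Fin B → 𝒵 => (1 / B : ℝ) • ∑ k, N (β k)) (Measure.pi fun _ => P) :=
  (integrable_finsetSum _ fun _ _ => integrable_comp_eval hN).smul _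

theorem integral_average_pi (hB : 1 ≤ B) {N : 𝒵 → E} (hN : Integrable N P) :
    ∫ β : Fin B → 𝒵, (1 / B : ℝ) • ∑ k, N (β k) ∂(Measure.pi fun _ => P) = ∫ z, N z ∂P := by
  have hB₀ : (B : ℝ) ≠ 0 := by positivity
  have marginal (k : Fin B) :
      ∫ β : Fin B → 𝒵, N (β k) ∂(Measure.pi fun _ => P) = ∫ z, N z ∂P :=
    integral_comp_eval (μ := fun _ => P) hN.aestronglyMeasurable
  rw [integral_smul, integral_finsetSum _ fun _ _ => integrable_comp_eval hN,
    Finset.sum_congr rfl fun k _ => marginal k, Finset.sum_const, Finset.card_univ,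
    Fintype.card_fin, ← Nat.cast_smul_eq_nsmul ℝ, smul_smul, one_div_mul_cancel hB₀, one_smul]

theorem indepFun_comp_eval_pi {E : Type*} [NormedAddCommGroup E] [MeasurableSpace E]
    [BorelSpace E] {N : 𝒵 → E} (hN : Integrable N P) {j k : Fin B} (hjk : j ≠ k) :
    IndepFun (fun β : Fin B → 𝒵 => N (β j)) (fun β => N (β k)) (Measure.pi fun _ => P) := by
  have law (k : Fin B) : (Measure.pi fun _ => P).map (fun β : Fin B → 𝒵 => β k) = P :=
    (measurePreserving_eval (fun _ : Fin B => P) k).map_eq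
  exact ((iIndepFun_pi (μ := fun _ : Fin B => P) (X := fun _ z => z)
    fun _ => aemeasurable_id).indepFun hjk).comp₀
      (measurable_pi_apply j).aemeasurable (measurable_pi_apply k).aemeasurable
      (by rw [law]; exact hN.1.aemeasurable) (by rw [law]; exact hN.1.aemeasurable)

theorem integrable_inner_eval_pi {N : 𝒵 → H} (hN : Integrable N P)
    (hN2 : Integrable (fun z => ‖N z‖ ^ 2) P) (j k : Fin B) :
    Integrable (fun β : Fin B → 𝒵 => inner ℝ (N (β j)) (N (β k))) (Measure.pi fun _ => P) := by
  borelize H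
  obtain rfl | hjk := eq_or_ne j k
  · simpa only [real_inner_self_eq_norm_sq] using
      integrable_comp_eval (μ := fun _ : Fin B => P) (i := j) hN2
  · exact (indepFun_comp_eval_pi hN hjk).integrable_bilin (integrable_comp_eval hN)
      (integrable_comp_eval hN) (innerSL ℝ)

theorem integral_inner_eval_pi [CompleteSpace H] {N : 𝒵 → H} (hN : Integrable N P)
    (hN₀ : ∫ z, N z ∂P = 0) {j k : Fin B} (hjk : j ≠ k) :
    ∫ β : Fin B → 𝒵, inner ℝ (N (β j)) (N (β k)) ∂(Measure.pi fun _ => P) = 0 := by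
  borelize H
  have factorized := (indepFun_comp_eval_pi hN hjk).integral_bilin (integrable_comp_eval hN)
    (integrable_comp_eval hN) (innerSL ℝ)
  rwa [integral_comp_eval (μ := fun _ : Fin B => P) hN.1, hN₀, map_zero] at factorized

theorem norm_sq_average_eq (N : Fin B → H) :
    ‖(1 / B : ℝ) • ∑ k, N k‖ ^ 2 = (1 / B : ℝ) ^ 2 * ∑ j, ∑ k, inner ℝ (N j) (N k) := by
  rw [norm_smul, mul_pow, Real.norm_eq_abs, sq_abs, ← real_inner_self_eq_norm_sq, sum_inner]
  simp only [inner_sum]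

theorem integrable_norm_sq_average_pi {N : 𝒵 → H} (hN : Integrable N P)
    (hN2 : Integrable (fun z => ‖N z‖ ^ 2) P) :
    Integrable (fun β : Fin B → 𝒵 => ‖(1 / B : ℝ) • ∑ k, N (β k)‖ ^ 2)
      (Measure.pi fun _ => P) := by
  simp only [norm_sq_average_eq]
  exact (integrable_finsetSum _ fun j _ => integrable_finsetSum _ fun k _ =>
    integrable_inner_eval_pi hN hN2 j k).const_mul _

theorem integral_norm_sq_average_pi_le [CompleteSpace H] {N : 𝒵 → H} (hN : Integrable N P)
    (hN₀ : ∫ z, N z ∂P = 0) (hN2 : Integrable (fun z => ‖N z‖ ^ 2) P)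
    (hs : ∫ z, ‖N z‖ ^ 2 ∂P ≤ s) (hB : 1 ≤ B) :
    ∫ β : Fin B → 𝒵, ‖(1 / B : ℝ) • ∑ k, N (β k)‖ ^ 2 ∂(Measure.pi fun _ => P) ≤ s / B := by
  have hB₀ : (B : ℝ) ≠ 0 := by positivity
  have row (j : Fin B) :
      ∫ β : Fin B → 𝒵, ∑ k, inner ℝ (N (β j)) (N (β k)) ∂(Measure.pi fun _ => P) ≤ s := by
    rw [integral_finsetSum _ fun k _ => integrable_inner_eval_pi hN hN2 j k,
      Finset.sum_eq_single j (fun k _ hk => integral_inner_eval_pi hN hN₀ hk.symm) (by simp)]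
    simp only [real_inner_self_eq_norm_sq]
    exact (integral_comp_eval (μ := fun _ : Fin B => P) hN2.1).trans_le hs
  simp only [norm_sq_average_eq]
  rw [integral_const_mul, integral_finsetSum _ fun j _ =>
    integrable_finsetSum _ fun k _ => integrable_inner_eval_pi hN hN2 j k]
  calc (1 / B : ℝ) ^ 2 * ∑ j, ∫ β : Fin B → 𝒵, ∑ k, inner ℝ (N (β j)) (N (β k))
        ∂(Measure.pi fun _ => P)
      ≤ (1 / B : ℝ) ^ 2 * ∑ _j : Fin B, s := by gcongr with j; exact row j
    _ = s / B := by
      rw [Finset.sum_const, Finset.card_univ, Fintype.card_fin, nsmul_eq_mul]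
      field_simp

theorem average_sub_eq (hB : 1 ≤ B) (N : Fin B → E) (m : E) :
    m - (1 / B : ℝ) • ∑ k, N k = (1 / B : ℝ) • ∑ k, (m - N k) := by
  have hB₀ : (B : ℝ) ≠ 0 := by positivity
  rw [Finset.sum_sub_distrib, Finset.sum_const, Finset.card_univ, Fintype.card_fin, smul_sub,
    ← Nat.cast_smul_eq_nsmul ℝ, smul_smul, one_div_mul_cancel hB₀, one_smul]

/- The variance of an average is `1 / B` times the variance only in a Hilbert norm; another norm
costs the distortion of an isomorphism onto a Hilbert space. -/
theorem integral_norm_sq_sub_average_pi_le [CompleteSpace E] (L : E ≃L[ℝ] H) {N : 𝒵 → E}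
    (hN : Integrable N P) (hN2 : Integrable (fun z' => ‖∫ z, N z ∂P - N z'‖ ^ 2) P)
    (hs : ∫ z', ‖∫ z, N z ∂P - N z'‖ ^ 2 ∂P ≤ s) (hB : 1 ≤ B) :
    Integrable (fun β : Fin B → 𝒵 => ‖∫ z, N z ∂P - (1 / B : ℝ) • ∑ k, N (β k)‖ ^ 2)
        (Measure.pi fun _ => P) ∧
      ∫ β : Fin B → 𝒵, ‖∫ z, N z ∂P - (1 / B : ℝ) • ∑ k, N (β k)‖ ^ 2 ∂(Measure.pi fun _ => P) ≤
        ‖(L.symm : H →L[ℝ] E)‖ ^ 2 * (‖(L : E →L[ℝ] H)‖ ^ 2 * s / B) := by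
  have : CompleteSpace H :=
    (completeSpace_congr (e := L.toEquiv) L.isUniformEmbedding).1 inferInstance
  have centered : Integrable (fun z' => ∫ z, N z ∂P - N z') P := (integrable_const _).sub hN
  have image_int : Integrable (fun z' => L (∫ z, N z ∂P - N z')) P :=
    (L : E →L[ℝ] H).integrable_comp centered
  have image_mean : ∫ z', L (∫ z, N z ∂P - N z') ∂P = 0 := by
    rw [L.integral_comp_comm, integral_sub (integrable_const _) hN]
    simp
  obtain ⟨image_sq_int, image_sq_le⟩ := integral_norm_sq_apply_le (L : E →L[ℝ] H) centered.1 hN2 hs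
  have pullback : (fun β : Fin B → 𝒵 => ‖∫ z, N z ∂P - (1 / B : ℝ) • ∑ k, N (β k)‖ ^ 2) =
      fun β => ‖(L.symm : H →L[ℝ] E) ((1 / B : ℝ) • ∑ k, L (∫ z, N z ∂P - N (β k)))‖ ^ 2 := by
    funext β
    rw [average_sub_eq hB, ← map_sum, ← map_smul, L.symm.coe_coe, L.symm_apply_apply]
  rw [pullback]
  have average_sq_int := integrable_norm_sq_average_pi (B := B) image_int image_sq_int
  have average_sq_le :=
    integral_norm_sq_average_pi_le image_int image_mean image_sq_int image_sq_le hB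
  have average_meas := (integrable_average_pi (B := B) image_int).1
  exact integral_norm_sq_apply_le (L.symm : H →L[ℝ] E) average_meas average_sq_int average_sq_le

end Batch

section Subset

variable {n S : ℕ}

/-- The law of a uniformly random subset of size `S` of `{1, …, n}`. -/
noncomputable abbrev subsetLaw (n S : ℕ) : Measure (Finset (Fin n)) :=
  uniformOn {A | A.card = S}

theorem isProbabilityMeasure_subsetLaw (hS : S ≤ n) : IsProbabilityMeasure (subsetLaw n S) :=
  isProbabilityMeasure_uniformOn (Set.toFinite _) <|
    (Finset.exists_subset_card_eq (s := (Finset.univ : Finset (Fin n))) (by simpa using hS)).imp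
      fun _ hA => hA.2

theorem ae_card_eq_subsetLaw : ∀ᵐ A ∂subsetLaw n S, A.card = S :=
  ae_cond_mem (Set.toFinite _).measurableSet

theorem subsetLaw_real_map_perm (π : Equiv.Perm (Fin n)) (T : Set (Finset (Fin n))) :
    (subsetLaw n S).real {A | A.map π.toEmbedding ∈ T} = (subsetLaw n S).real T := by
  have slice : {A : Finset (Fin n) | A.card = S} ∩ {A | A.map π.toEmbedding ∈ T} =
      π.finsetCongr.symm '' ({A | A.card = S} ∩ T) := by
    rw [π.finsetCongr.symm.image_eq_preimage_symm]
    ext A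
    simp [Equiv.finsetCongr]
  simp only [Measure.real, subsetLaw, uniformOn, cond_apply (Set.toFinite _).measurableSet]
  rw [slice, Measure.count_injective_image π.finsetCongr.symm.injective]

theorem subsetLaw_real_pair_perm (π : Equiv.Perm (Fin n)) (i j : Fin n) :
    (subsetLaw n S).real {A | π i ∈ A ∧ π j ∈ A} = (subsetLaw n S).real {A | i ∈ A ∧ j ∈ A} := by
  rw [← subsetLaw_real_map_perm π]
  simp

theorem exists_subsetLaw_real_pair_eq :
    ∃ r, 0 ≤ r ∧ ∀ i j, i ≠ j → (subsetLaw n S).real {A | i ∈ A ∧ j ∈ A} = r := by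
  by_cases distinct : ∃ i j : Fin n, i ≠ j
  · obtain ⟨i₀, j₀, hij₀⟩ := distinct
    refine ⟨(subsetLaw n S).real {A | i₀ ∈ A ∧ j₀ ∈ A}, measureReal_nonneg, fun i j hij => ?_⟩
    set j' := Equiv.swap i₀ i j₀ with hj'
    have hne : i ≠ j' := fun h => hij₀ <| (Equiv.swap i₀ i).injective <| by
      rw [Equiv.swap_apply_left, ← hj', h]
    rw [← subsetLaw_real_pair_perm (Equiv.swap i₀ i) i₀ j₀, ← hj', Equiv.swap_apply_left,
      ← subsetLaw_real_pair_perm (Equiv.swap j' j) i j', Equiv.swap_apply_left,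
      Equiv.swap_apply_of_ne_of_ne hne hij]
  · push Not at distinct
    exact ⟨0, le_rfl, fun i j hij => absurd (distinct i j) hij⟩

theorem sum_mem_eq_sum_indicator_smul {E : Type*} [AddCommGroup E] [Module ℝ E]
    (A : Finset (Fin n)) (a : Fin n → E) :
    ∑ i ∈ A, a i = ∑ i, Set.indicator {A | i ∈ A} (1 : Finset (Fin n) → ℝ) A • a i := by
  classical
  simp [Set.indicator, Finset.sum_ite_mem]

theorem subsetLaw_real_mem (hS : S ≤ n) (i : Fin n) :
    (subsetLaw n S).real {A | i ∈ A} = (S : ℝ) / n := by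
  have := isProbabilityMeasure_subsetLaw hS
  have hn : (n : ℝ) ≠ 0 := by exact_mod_cast i.pos.ne'
  have symmetric (j : Fin n) :
      (subsetLaw n S).real {A | j ∈ A} = (subsetLaw n S).real {A | i ∈ A} := by
    simpa using subsetLaw_real_pair_perm (S := S) (Equiv.swap i j) i i
  have mean_card : ∑ j, (subsetLaw n S).real {A | j ∈ A} = S := by
    calc ∑ j, (subsetLaw n S).real {A | j ∈ A}
        = ∫ A, ∑ _j ∈ A, (1 : ℝ) ∂subsetLaw n S := by
          simp_rw [fun A : Finset (Fin n) => sum_mem_eq_sum_indicator_smul A fun _ => (1 : ℝ)]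
          rw [integral_finsetSum _ fun _ _ => .of_finite]
          simp [integral_indicator_one, (Set.toFinite _).measurableSet]
      _ = ∫ _, (S : ℝ) ∂subsetLaw n S := by
          refine integral_congr_ae (ae_card_eq_subsetLaw.mono fun A hA => ?_)
          simp [hA]
      _ = S := by simp
  rw [Finset.sum_congr rfl fun j _ => symmetric j, Finset.sum_const, Finset.card_univ,
    Fintype.card_fin, nsmul_eq_mul] at mean_card
  rw [eq_div_iff hn, mul_comm, mean_card]

theorem norm_sq_sum_mem_eq {E : Type*} [NormedAddCommGroup E] [InnerProductSpace ℝ E]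
    (e : Fin n → E) (A : Finset (Fin n)) :
    ‖∑ i ∈ A, e i‖ ^ 2 = ∑ i, ∑ j,
      Set.indicator {A : Finset (Fin n) | i ∈ A ∧ j ∈ A} (fun _ => inner ℝ (e i) (e j)) A := by
  classical
  rw [← real_inner_self_eq_norm_sq, sum_inner]
  simp [inner_sum, Set.indicator, ite_and, Finset.sum_ite_mem]

/- With `r` the probability of a pair `i ≠ j` and `∑ e = 0`, the cross terms sum to
`r ‖∑ e‖² - r ∑ ‖e i‖²`: sampling without replacement only decreases the variance. -/
theorem integral_norm_sq_sum_subsetLaw_le {E : Type*} [NormedAddCommGroup E]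
    [InnerProductSpace ℝ E] (hS : S ≤ n) {e : Fin n → E} (he : ∑ i, e i = 0) :
    ∫ A, ‖∑ i ∈ A, e i‖ ^ 2 ∂subsetLaw n S ≤ (S : ℝ) / n * ∑ i, ‖e i‖ ^ 2 := by
  have := isProbabilityMeasure_subsetLaw hS
  obtain ⟨r, hr, pair_eq⟩ := exists_subsetLaw_real_pair_eq (n := n) (S := S)
  have row (i : Fin n) : ∑ j, (subsetLaw n S).real {A | i ∈ A ∧ j ∈ A} * inner ℝ (e i) (e j) =
      ((S : ℝ) / n - r) * ‖e i‖ ^ 2 := by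
    have cross_sum : ∑ j, r * inner ℝ (e i) (e j) = 0 := by
      rw [← Finset.mul_sum, ← inner_sum, he, inner_zero_right, mul_zero]
    rw [← sub_zero (∑ j, _ * _), ← cross_sum, ← Finset.sum_sub_distrib, Finset.sum_eq_single i]
    · simp only [and_self, subsetLaw_real_mem hS, real_inner_self_eq_norm_sq]
      ring
    · intro j _ hj
      rw [pair_eq i j hj.symm, sub_self]
    · simp
  simp_rw [norm_sq_sum_mem_eq e]
  rw [integral_finsetSum _ fun _ _ => .of_finite, Finset.mul_sum]
  gcongr with i
  rw [integral_finsetSum _ fun _ _ => .of_finite]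
  simp_rw [integral_indicator_const _ (Set.toFinite _).measurableSet, smul_eq_mul]
  rw [row]
  nlinarith [mul_nonneg hr (sq_nonneg ‖e i‖)]

theorem measurable_sum_mem {α E : Type*} [MeasurableSpace α] [NormedAddCommGroup E]
    [NormedSpace ℝ E] [MeasurableSpace E] [BorelSpace E] [SecondCountableTopology E]
    {A : α → Finset (Fin n)} {f : Fin n → α → E} (hA : Measurable A) (hf : ∀ i, Measurable (f i)) :
    Measurable fun a => ∑ i ∈ A a, f i a := by
  simp_rw [fun a => sum_mem_eq_sum_indicator_smul (A a) fun i => f i a]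
  refine Finset.measurable_fun_sum _ fun i _ => Measurable.smul ?_ (hf i)
  exact (Measurable.of_discrete (f := Set.indicator {A : Finset (Fin n) | i ∈ A} 1)).comp hA

variable {Γ E : Type*} [MeasurableSpace Γ] {ν : Measure Γ} [NormedAddCommGroup E] [NormedSpace ℝ E]
  {ℓ : Fin n → Γ → E}

theorem integrable_sum_mem_prod (hS : S ≤ n) (hℓ : ∀ i, Integrable (ℓ i) ν) :
    Integrable (fun w : Finset (Fin n) × Γ => ∑ i ∈ w.1, ℓ i w.2) ((subsetLaw n S).prod ν) := by
  have := isProbabilityMeasure_subsetLaw hS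
  simp_rw [fun w : Finset (Fin n) × Γ => sum_mem_eq_sum_indicator_smul w.1 fun i => ℓ i w.2]
  exact integrable_finsetSum _ fun i _ => Integrable.smul_prod .of_finite (hℓ i)

theorem integral_sum_mem_prod [SFinite ν] (hS : S ≤ n) (hℓ : ∀ i, Integrable (ℓ i) ν) :
    ∫ w : Finset (Fin n) × Γ, ∑ i ∈ w.1, ℓ i w.2 ∂(subsetLaw n S).prod ν =
      ((S : ℝ) / n) • ∑ i, ∫ c, ℓ i c ∂ν := by
  have := isProbabilityMeasure_subsetLaw hS
  simp_rw [fun w : Finset (Fin n) × Γ => sum_mem_eq_sum_indicator_smul w.1 fun i => ℓ i w.2]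
  rw [integral_finsetSum _ fun i _ => Integrable.smul_prod .of_finite (hℓ i), Finset.smul_sum]
  refine Finset.sum_congr rfl fun i _ => ?_
  rw [integral_prod_smul, integral_indicator_one (Set.toFinite _).measurableSet,
    subsetLaw_real_mem hS]

theorem norm_sq_sub_subsample_le {A : Finset (Fin n)} (hA : A.card = S) (hS : 1 ≤ S)
    (m v : Fin n → E) (mean : E) :
    ‖mean - (1 / S : ℝ) • ∑ i ∈ A, v i‖ ^ 2 ≤
      2 / S * ∑ i ∈ A, ‖m i - v i‖ ^ 2 + 2 / S ^ 2 * ‖∑ i ∈ A, (m i - mean)‖ ^ 2 := by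
  have hS₀ : (S : ℝ) ≠ 0 := by positivity
  have split : mean - (1 / S : ℝ) • ∑ i ∈ A, v i =
      (1 / S : ℝ) • (∑ i ∈ A, (m i - v i) - ∑ i ∈ A, (m i - mean)) := by
    simp only [Finset.sum_sub_distrib, Finset.sum_const, hA, ← Nat.cast_smul_eq_nsmul ℝ]
    rw [sub_sub_sub_cancel_left, smul_sub, smul_smul, one_div_mul_cancel hS₀, one_smul]
  have jensen := norm_sq_sum_le_card_mul A fun i => m i - v i
  rw [hA] at jensen
  calc ‖mean - (1 / S : ℝ) • ∑ i ∈ A, v i‖ ^ 2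
      = (1 / S) ^ 2 * ‖∑ i ∈ A, (m i - v i) - ∑ i ∈ A, (m i - mean)‖ ^ 2 := by
        rw [split, norm_smul, mul_pow, Real.norm_eq_abs, sq_abs]
    _ ≤ (1 / S) ^ 2 * (2 * (S * ∑ i ∈ A, ‖m i - v i‖ ^ 2 + ‖∑ i ∈ A, (m i - mean)‖ ^ 2)) := by
        gcongr
        exact (norm_sub_sq_le_two_mul _ _).trans (by gcongr)
    _ = 2 / S * ∑ i ∈ A, ‖m i - v i‖ ^ 2 + 2 / S ^ 2 * ‖∑ i ∈ A, (m i - mean)‖ ^ 2 := by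
        field_simp

theorem integral_norm_sq_sum_sub_average_subsetLaw_le {H : Type*} [NormedAddCommGroup H]
    [InnerProductSpace ℝ H] (R : E →ₗᵢ[ℝ] H) (hS : S ≤ n) (hn : 0 < n) (m : Fin n → E) :
    ∫ A, ‖∑ i ∈ A, (m i - (1 / n : ℝ) • ∑ j, m j)‖ ^ 2 ∂subsetLaw n S ≤
      S * ((1 / n : ℝ) * ∑ i, ‖m i - (1 / n : ℝ) • ∑ j, m j‖ ^ 2) := by
  have hn₀ : (n : ℝ) ≠ 0 := by positivity
  have centered : ∑ i, R (m i - (1 / n : ℝ) • ∑ j, m j) = 0 := by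
    rw [← map_sum, Finset.sum_sub_distrib, Finset.sum_const, Finset.card_univ, Fintype.card_fin,
      ← Nat.cast_smul_eq_nsmul ℝ, smul_smul, mul_one_div_cancel hn₀, one_smul, sub_self, map_zero]
  have bound := integral_norm_sq_sum_subsetLaw_le hS centered
  simp only [← map_sum, R.norm_map] at bound
  calc _ ≤ _ := bound
    _ = _ := by ring

theorem integral_norm_sq_subsample_sub_le {H : Type*} [NormedAddCommGroup H]
    [InnerProductSpace ℝ H] (R : E →ₗᵢ[ℝ] H) [IsProbabilityMeasure ν] (hS₁ : 1 ≤ S) (hS : S ≤ n)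
    (hℓ : ∀ i, Integrable (ℓ i) ν) {m : Fin n → E} {s D : ℝ}
    (hvar : ∀ i, Integrable (fun c => ‖m i - ℓ i c‖ ^ 2) ν ∧ ∫ c, ‖m i - ℓ i c‖ ^ 2 ∂ν ≤ s)
    (hD : (1 / n : ℝ) * ∑ i, ‖m i - (1 / n : ℝ) • ∑ j, m j‖ ^ 2 ≤ D) :
    Integrable (fun w : Finset (Fin n) × Γ =>
        ‖(1 / n : ℝ) • ∑ i, m i - (1 / S : ℝ) • ∑ i ∈ w.1, ℓ i w.2‖ ^ 2)
        ((subsetLaw n S).prod ν) ∧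
      ∫ w : Finset (Fin n) × Γ, ‖(1 / n : ℝ) • ∑ i, m i - (1 / S : ℝ) • ∑ i ∈ w.1, ℓ i w.2‖ ^ 2
        ∂(subsetLaw n S).prod ν ≤ 2 * (D / S + s) := by
  have := isProbabilityMeasure_subsetLaw hS
  have hn : 0 < n := hS₁.trans hS
  set mean := (1 / n : ℝ) • ∑ i, m i
  have oracle_int := integrable_sum_mem_prod hS fun i => (hvar i).1
  have spread_int : Integrable (fun w : Finset (Fin n) × Γ => ‖∑ i ∈ w.1, (m i - mean)‖ ^ 2)
      ((subsetLaw n S).prod ν) :=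
    Integrable.comp_fst (f := fun A => ‖∑ i ∈ A, (m i - mean)‖ ^ 2) .of_finite ν
  have bound_int := (oracle_int.const_mul (2 / S)).add (spread_int.const_mul (2 / S ^ 2))
  have ae_card : ∀ᵐ w ∂(subsetLaw n S).prod ν, w.1.card = S :=
    Measure.quasiMeasurePreserving_fst.ae ae_card_eq_subsetLaw
  have bound := ae_card.mono fun w hw =>
    norm_sq_sub_subsample_le hw hS₁ m (fun i => ℓ i w.2) mean
  have sq_int := bound_int.mono' (f := fun w : Finset (Fin n) × Γ =>
      ‖mean - (1 / S : ℝ) • ∑ i ∈ w.1, ℓ i w.2‖ ^ 2)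
    (((integrable_const mean).sub ((integrable_sum_mem_prod hS hℓ).smul (1 / S : ℝ))).1.norm.pow 2)
    (bound.mono fun w hw => by rwa [Real.norm_eq_abs, abs_of_nonneg (by positivity)])
  refine ⟨sq_int, (integral_mono_ae sq_int bound_int bound).trans ?_⟩
  have spread_le := integral_norm_sq_sum_sub_average_subsetLaw_le R hS hn m
  have oracle_le : ∑ i, ∫ c, ‖m i - ℓ i c‖ ^ 2 ∂ν ≤ n * s := by
    simpa using Finset.sum_le_card_nsmul Finset.univ _ s fun i _ => (hvar i).2
  rw [integral_add' (oracle_int.const_mul _) (spread_int.const_mul _), integral_const_mul,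
    integral_const_mul, integral_sum_mem_prod hS fun i => (hvar i).1,
    integral_fun_fst fun A : Finset (Fin n) => ‖∑ i ∈ A, (m i - mean)‖ ^ 2, probReal_univ, one_smul,
    smul_eq_mul]
  calc 2 / S * (S / n * ∑ i, ∫ c, ‖m i - ℓ i c‖ ^ 2 ∂ν) +
        2 / S ^ 2 * ∫ A, ‖∑ i ∈ A, (m i - mean)‖ ^ 2 ∂subsetLaw n S
      ≤ 2 / S * (S / n * (n * s)) + 2 / S ^ 2 * (S * D) := by
        gcongr
        exact spread_le.trans (by gcongr)
    _ = 2 * (D / S + s) := by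
        field_simp
        ring

end Subset

theorem integral_norm_sq_sub_average_pi_le_of_isometry {𝒵 E H : Type*} [MeasurableSpace 𝒵]
    {P : Measure 𝒵} [IsProbabilityMeasure P] [NormedAddCommGroup E] [NormedSpace ℝ E]
    [CompleteSpace E] [NormedAddCommGroup H] [InnerProductSpace ℝ H] (R : E ≃ₗᵢ[ℝ] H) {B : ℕ}
    {N : 𝒵 → E} {s : ℝ} (hN : Integrable N P)
    (hN2 : Integrable (fun z' => ‖∫ z, N z ∂P - N z'‖ ^ 2) P)
    (hs : ∫ z', ‖∫ z, N z ∂P - N z'‖ ^ 2 ∂P ≤ s) (hB : 1 ≤ B) :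
    Integrable (fun β : Fin B → 𝒵 => ‖∫ z, N z ∂P - (1 / B : ℝ) • ∑ k, N (β k)‖ ^ 2)
        (Measure.pi fun _ => P) ∧
      ∫ β : Fin B → 𝒵, ‖∫ z, N z ∂P - (1 / B : ℝ) • ∑ k, N (β k)‖ ^ 2
        ∂(Measure.pi fun _ => P) ≤ s / B := by
  set L := R.toContinuousLinearEquiv
  have hs₀ : 0 ≤ s := (integral_nonneg fun _ => sq_nonneg _).trans hs
  have norm_le : ‖(L : E →L[ℝ] H)‖ ^ 2 ≤ 1 :=
    pow_le_one₀ (norm_nonneg _) <|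
      ContinuousLinearMap.opNorm_le_bound _ zero_le_one fun v => by simp [L]
  have norm_symm_le : ‖(L.symm : H →L[ℝ] E)‖ ^ 2 ≤ 1 :=
    pow_le_one₀ (norm_nonneg _) <|
      ContinuousLinearMap.opNorm_le_bound _ zero_le_one fun v => by simp [L]
  obtain ⟨int, le⟩ := integral_norm_sq_sub_average_pi_le L hN hN2 hs hB
  refine ⟨int, le.trans ?_⟩
  calc ‖(L.symm : H →L[ℝ] E)‖ ^ 2 * (‖(L : E →L[ℝ] H)‖ ^ 2 * s / B) ≤ 1 * (1 * s / B) := by gcongr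
    _ = s / B := by ring

section Oracles

variable {V : Type u} [NormedAddCommGroup V] [NormedSpace ℝ V] {d n m : ℕ}
  {Z : Fin n → Type w} [∀ i, MeasurableSpace (Z i)]

namespace Problem

/-- The law of an inner batch of `B` samples from `P_i`. -/
noncomputable abbrev batchLaw (p : Problem V d n Z) (B : ℕ) (i : Fin n) : Measure (Fin B → Z i) :=
  Measure.pi fun _ => p.P i

/-- The law of a family of independent inner batches, one for each `i`. -/
noncomputable abbrev batchesLaw (p : Problem V d n Z) (B : ℕ) : Measure (∀ i, Fin B → Z i) :=
  Measure.pi fun i => p.batchLaw B i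

end Problem

variable {p : Problem V d n Z} {b : Module.Basis (Fin m) ℝ V} {μ Cf Lf Cg σ₀ σ₁ δ C θ : ℝ}
  {B k : ℕ} {i : Fin n} {xp x : Primal d}

theorem Problem.extrap_sub_extrapMean (θ : ℝ) (i : Fin n) (xp x : Primal d) (s : Fin B → Z i) :
    p.extrap θ i xp x s - p.extrapMean θ i xp x =
      (1 + θ) • (p.batch i x s - p.inner i x) - θ • (p.batch i xp s - p.inner i xp) := by
  simp only [Problem.extrap, Problem.extrapMean]
  module

theorem norm_sq_extrapolation_le (hθ : 0 ≤ θ) (hθ₁ : θ ≤ 1) (a c : V) :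
    ‖(1 + θ) • a - θ • c‖ ^ 2 ≤ 8 * ‖a‖ ^ 2 + 2 * ‖c‖ ^ 2 := by
  have scaled : ‖(1 + θ) • a‖ ^ 2 ≤ 4 * ‖a‖ ^ 2 ∧ ‖θ • c‖ ^ 2 ≤ 1 * ‖c‖ ^ 2 := by
    simp only [norm_smul, mul_pow, Real.norm_eq_abs, sq_abs]
    constructor <;> gcongr <;> nlinarith
  linarith [norm_sub_sq_le_two_mul ((1 + θ) • a) (θ • c)]

namespace Problem.Assumptions

theorem integrable_batch (h : p.Assumptions b μ Cf Lf Cg σ₀ σ₁ δ) (hx : x ∈ p.X) :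
    Integrable (p.batch i x) (p.batchLaw B i) := by
  have := h.prob i
  exact integrable_average_pi (h.g_int i x hx)

theorem integral_batch (h : p.Assumptions b μ Cf Lf Cg σ₀ σ₁ δ) (hB : 1 ≤ B) (hx : x ∈ p.X) :
    ∫ s, p.batch i x s ∂(p.batchLaw B i) = p.inner i x := by
  have := h.prob i
  exact integral_average_pi hB (h.g_int i x hx)

theorem integrable_extrap (h : p.Assumptions b μ Cf Lf Cg σ₀ σ₁ δ) (hxp : xp ∈ p.X)
    (hx : x ∈ p.X) : Integrable (p.extrap θ i xp x) (p.batchLaw B i) :=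
  (h.integrable_batch hx).add (((h.integrable_batch hx).sub (h.integrable_batch hxp)).smul θ)

theorem integral_extrap (h : p.Assumptions b μ Cf Lf Cg σ₀ σ₁ δ) (hB : 1 ≤ B) (hxp : xp ∈ p.X)
    (hx : x ∈ p.X) : ∫ s, p.extrap θ i xp x s ∂(p.batchLaw B i) = p.extrapMean θ i xp x := by
  have cur := h.integrable_batch (B := B) (i := i) hx
  have prev := h.integrable_batch (B := B) (i := i) hxp
  have increment : Integrable (fun s => θ • (p.batch i x s - p.batch i xp s)) (p.batchLaw B i) :=
    (cur.sub prev).smul θ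
  simp only [Problem.extrap, Problem.extrapMean]
  rw [integral_add cur increment, integral_smul, integral_sub cur prev, h.integral_batch hB hx,
    h.integral_batch hB hxp]
  module

variable [FiniteDimensional ℝ V]

theorem measurable_batchD (h : p.Assumptions b μ Cf Lf Cg σ₀ σ₁ δ) (i : Fin n) :
    Measurable fun w : Primal d × (Fin B → Z i) => p.batchD i w.1 w.2 := by
  have sample (k : Fin B) : Measurable fun w : Primal d × (Fin B → Z i) => p.Dg i w.1 (w.2 k) :=
    (h.Dg_meas i).measurable.comp
      (measurable_fst.prodMk ((measurable_pi_apply k).comp measurable_snd))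
  exact (Finset.measurable_fun_sum _ fun k _ => sample k).const_smul (1 / B : ℝ)

theorem measurable_batch [MeasurableSpace V] [BorelSpace V]
    (h : p.Assumptions b μ Cf Lf Cg σ₀ σ₁ δ) (i : Fin n) :
    Measurable fun w : Primal d × (Fin B → Z i) => p.batch i w.1 w.2 := by
  have sample (k : Fin B) : Measurable fun w : Primal d × (Fin B → Z i) => p.g i w.1 (w.2 k) :=
    (h.g_meas i).measurable.comp
      (measurable_fst.prodMk ((measurable_pi_apply k).comp measurable_snd))
  exact (Finset.measurable_fun_sum _ fun k _ => sample k).const_smul (1 / B : ℝ)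

theorem integral_norm_sq_batch_sub_le (h : p.Assumptions b μ Cf Lf Cg σ₀ σ₁ δ)
    (L : V ≃L[ℝ] Primal k) (hB : 1 ≤ B) (hx : x ∈ p.X) :
    Integrable (fun s => ‖p.batch i x s - p.inner i x‖ ^ 2) (p.batchLaw B i) ∧
      ∫ s, ‖p.batch i x s - p.inner i x‖ ^ 2 ∂(p.batchLaw B i) ≤
        ‖(L.symm : Primal k →L[ℝ] V)‖ ^ 2 * (‖(L : V →L[ℝ] Primal k)‖ ^ 2 * σ₀ ^ 2 / B) := by
  have := h.prob i
  simp_rw [norm_sub_rev _ (p.inner i x)]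
  have := FiniteDimensional.complete ℝ V
  exact integral_norm_sq_sub_average_pi_le L (h.g_int i x hx) (h.var_g i x hx).1
    (h.var_g i x hx).2 hB

theorem integral_norm_sq_extrap_sub_le (h : p.Assumptions b μ Cf Lf Cg σ₀ σ₁ δ)
    (L : V ≃L[ℝ] Primal k) (hB : 1 ≤ B) (hθ : 0 ≤ θ) (hθ₁ : θ ≤ 1) (hxp : xp ∈ p.X)
    (hx : x ∈ p.X) :
    Integrable (fun s => ‖p.extrap θ i xp x s - p.extrapMean θ i xp x‖ ^ 2) (p.batchLaw B i) ∧
      ∫ s, ‖p.extrap θ i xp x s - p.extrapMean θ i xp x‖ ^ 2 ∂(p.batchLaw B i) ≤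
        10 * (‖(L.symm : Primal k →L[ℝ] V)‖ ^ 2 *
          (‖(L : V →L[ℝ] Primal k)‖ ^ 2 * σ₀ ^ 2 / B)) := by
  have := h.prob i
  obtain ⟨cur_int, cur_le⟩ := h.integral_norm_sq_batch_sub_le (i := i) L hB hx
  obtain ⟨prev_int, prev_le⟩ := h.integral_norm_sq_batch_sub_le (i := i) L hB hxp
  have bound (s : Fin B → Z i) : ‖p.extrap θ i xp x s - p.extrapMean θ i xp x‖ ^ 2 ≤
      8 * ‖p.batch i x s - p.inner i x‖ ^ 2 + 2 * ‖p.batch i xp s - p.inner i xp‖ ^ 2 := by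
    rw [p.extrap_sub_extrapMean]
    exact norm_sq_extrapolation_le hθ hθ₁ _ _
  have meas := (h.integrable_extrap (θ := θ) (B := B) (i := i) hxp hx).aestronglyMeasurable
  have sq_int := integrable_of_nonneg_of_le
    ((meas.sub aestronglyMeasurable_const).norm.pow 2) (fun _ => sq_nonneg _) bound
    ((cur_int.const_mul 8).add (prev_int.const_mul 2))
  refine ⟨sq_int, (integral_mono sq_int
    ((cur_int.const_mul 8).add (prev_int.const_mul 2)) bound).trans ?_⟩
  simp only [Pi.add_apply]
  rw [integral_add (cur_int.const_mul 8) (prev_int.const_mul 2), integral_const_mul,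
    integral_const_mul]
  linarith

end Problem.Assumptions

/-- The Riesz isomorphism. -/
noncomputable def riesz (d : ℕ) : StrongDual ℝ (Primal d) ≃ₗᵢ[ℝ] Primal d :=
  (InnerProductSpace.toDual ℝ (Primal d)).symm

namespace Problem.Assumptions

theorem integrable_comp_batchD (h : p.Assumptions b μ Cf Lf Cg σ₀ σ₁ δ) (hx : x ∈ p.X)
    (y : StrongDual ℝ V) : Integrable (fun s => y.comp (p.batchD i x s)) (p.batchLaw B i) := by
  have := h.prob i
  exact (ContinuousLinearMap.compL ℝ (Primal d) V ℝ y).integrable_comp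
    (integrable_average_pi (h.Dg_int i x hx))

variable [FiniteDimensional ℝ V]

theorem integral_comp_batchD (h : p.Assumptions b μ Cf Lf Cg σ₀ σ₁ δ) (hB : 1 ≤ B) (hx : x ∈ p.X)
    (y : StrongDual ℝ V) :
    ∫ s, y.comp (p.batchD i x s) ∂(p.batchLaw B i) = y.comp (p.innerD i x) := by
  have := h.prob i
  have := FiniteDimensional.complete ℝ V
  have mean := (ContinuousLinearMap.compL ℝ (Primal d) V ℝ y).integral_comp_comm
    (integrable_average_pi (B := B) (h.Dg_int i x hx))
  rw [integral_average_pi hB (h.Dg_int i x hx)] at mean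
  exact mean

theorem integral_norm_sq_sub_comp_batchD_le (h : p.Assumptions b μ Cf Lf Cg σ₀ σ₁ δ) (hB : 1 ≤ B)
    (hx : x ∈ p.X) {y : StrongDual ℝ V} (hy : ‖y‖ ≤ C) :
    Integrable (fun s => ‖y.comp (p.innerD i x) - y.comp (p.batchD i x s)‖ ^ 2) (p.batchLaw B i) ∧
      ∫ s, ‖y.comp (p.innerD i x) - y.comp (p.batchD i x s)‖ ^ 2 ∂(p.batchLaw B i) ≤
        C ^ 2 * σ₁ ^ 2 / B := by
  have := h.prob i
  have := FiniteDimensional.complete ℝ V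
  set pull := ContinuousLinearMap.compL ℝ (Primal d) V ℝ y
  have pull_norm : ‖pull‖ ^ 2 ≤ C ^ 2 := by
    gcongr
    exact (pull.opNorm_le_bound (norm_nonneg y) y.opNorm_comp_le).trans hy
  have sample_mean : ∫ z, pull (p.Dg i x z) ∂(p.P i) = pull (p.innerD i x) :=
    pull.integral_comp_comm (h.Dg_int i x hx)
  have noise_meas : AEStronglyMeasurable (fun z => p.innerD i x - p.Dg i x z) (p.P i) :=
    aestronglyMeasurable_const.sub (h.Dg_int i x hx).aestronglyMeasurable
  have sample := integral_norm_sq_apply_le pull noise_meas (h.var_Dg i x hx).1 (h.var_Dg i x hx).2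
  simp only [map_sub, ← sample_mean] at sample
  have pulled_int : Integrable (fun z => pull (p.Dg i x z)) (p.P i) :=
    pull.integrable_comp (h.Dg_int i x hx)
  have key := integral_norm_sq_sub_average_pi_le_of_isometry (riesz d) pulled_int sample.1
    (sample.2.trans (mul_le_mul_of_nonneg_right pull_norm (sq_nonneg σ₁))) hB
  have average (s : Fin B → Z i) :
      (1 / B : ℝ) • ∑ k, pull (p.Dg i x (s k)) = y.comp (p.batchD i x s) := by
    rw [← map_sum, ← map_smul]
    rfl
  simp only [average, sample_mean] at key
  exact key

end Problem.Assumptions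

end Oracles

section GradientNoise

variable {V : Type u} [NormedAddCommGroup V] [NormedSpace ℝ V] {d n m : ℕ}
  {Z : Fin n → Type w} [∀ i, MeasurableSpace (Z i)] {p : Problem V d n Z}
  {b : Module.Basis (Fin m) ℝ V} {μ Cf Lf Cg σ₀ σ₁ δ : ℝ} {S B : ℕ} {x : Primal d}
  {y : Fin n → StrongDual ℝ V}

namespace Problem.Assumptions

theorem integrable_comp_batchD_eval (h : p.Assumptions b μ Cf Lf Cg σ₀ σ₁ δ) (hx : x ∈ p.X)
    (y : Fin n → StrongDual ℝ V) (i : Fin n) :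
    Integrable (fun c : ∀ i, Fin B → Z i => (y i).comp (p.batchD i x (c i))) (p.batchesLaw B) := by
  have := h.prob
  exact integrable_comp_eval (μ := fun i => p.batchLaw B i) (h.integrable_comp_batchD hx (y i))

theorem integrable_gradEst (h : p.Assumptions b μ Cf Lf Cg σ₀ σ₁ δ) (hS : S ≤ n) (hx : x ∈ p.X)
    (y : Fin n → StrongDual ℝ V) (β : ∀ i, Fin B → Z i) :
    Integrable (fun w : Finset (Fin n) × (∀ i, Fin B → Z i) => p.gradEst S x y (w.1, β, w.2))
      ((subsetLaw n S).prod (p.batchesLaw B)) := by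
  have := h.prob
  exact (integrable_sum_mem_prod hS (h.integrable_comp_batchD_eval hx y)).smul (1 / S : ℝ)

variable [FiniteDimensional ℝ V]

theorem integral_norm_sq_gradMean_sub_gradEst_le (h : p.Assumptions b μ Cf Lf Cg σ₀ σ₁ δ)
    (hCf : 0 ≤ Cf) (hS₁ : 1 ≤ S) (hS : S ≤ n) (hB : 1 ≤ B) (hx : x ∈ p.X)
    (hy : ∀ i, y i ∈ conjDom (p.f i)) (β : ∀ i, Fin B → Z i) :
    Integrable (fun w : Finset (Fin n) × (∀ i, Fin B → Z i) =>
        ‖p.gradMean x y - p.gradEst S x y (w.1, β, w.2)‖ ^ 2)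
        ((subsetLaw n S).prod (p.batchesLaw B)) ∧
      ∫ w, ‖p.gradMean x y - p.gradEst S x y (w.1, β, w.2)‖ ^ 2
        ∂(subsetLaw n S).prod (p.batchesLaw B) ≤ 2 * (δ ^ 2 / S + Cf ^ 2 * σ₁ ^ 2 / B) := by
  have := h.prob
  have block_var (i : Fin n) :=
    h.integral_norm_sq_sub_comp_batchD_le (i := i) hB hx
      (norm_le_of_mem_conjDom hCf (h.outer i).lipschitz (hy i))
  refine integral_norm_sq_subsample_sub_le (riesz d).toLinearIsometry hS₁ hS
    (h.integrable_comp_batchD_eval hx y) (fun i => ⟨?_, ?_⟩) (h.var_comp x hx y hy)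
  · exact integrable_comp_eval (μ := fun i => p.batchLaw B i) (block_var i).1
  · exact (integral_comp_eval (μ := fun i => p.batchLaw B i)
      (block_var i).1.aestronglyMeasurable).trans_le (block_var i).2

theorem integral_gradEst (h : p.Assumptions b μ Cf Lf Cg σ₀ σ₁ δ) (hS₁ : 1 ≤ S) (hS : S ≤ n)
    (hB : 1 ≤ B) (hx : x ∈ p.X) (y : Fin n → StrongDual ℝ V) (β : ∀ i, Fin B → Z i) :
    ∫ w : Finset (Fin n) × (∀ i, Fin B → Z i), p.gradEst S x y (w.1, β, w.2)
      ∂(subsetLaw n S).prod (p.batchesLaw B) = p.gradMean x y := by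
  have := h.prob
  have hS₀ : (S : ℝ) ≠ 0 := by positivity
  have block_mean (i : Fin n) : ∫ c : ∀ i, Fin B → Z i, (y i).comp (p.batchD i x (c i))
      ∂(p.batchesLaw B) = (y i).comp (p.innerD i x) :=
    (integral_comp_eval (μ := fun i => p.batchLaw B i)
      (h.integrable_comp_batchD hx (y i)).aestronglyMeasurable).trans
      (h.integral_comp_batchD hB hx (y i))
  simp only [Problem.gradEst, Problem.gradMean]
  rw [integral_smul, integral_sum_mem_prod hS (h.integrable_comp_batchD_eval hx y), smul_smul]
  simp_rw [block_mean]
  congr 1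
  field_simp

theorem integral_gradMean_sub_gradEst_apply (h : p.Assumptions b μ Cf Lf Cg σ₀ σ₁ δ) (hS₁ : 1 ≤ S)
    (hS : S ≤ n) (hB : 1 ≤ B) (hx : x ∈ p.X) (y : Fin n → StrongDual ℝ V)
    (β : ∀ i, Fin B → Z i) (v : Primal d) :
    Integrable (fun w : Finset (Fin n) × (∀ i, Fin B → Z i) =>
        (p.gradMean x y - p.gradEst S x y (w.1, β, w.2)) v)
        ((subsetLaw n S).prod (p.batchesLaw B)) ∧
      ∫ w, (p.gradMean x y - p.gradEst S x y (w.1, β, w.2)) v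
        ∂(subsetLaw n S).prod (p.batchesLaw B) = 0 := by
  have := h.prob
  have := isProbabilityMeasure_subsetLaw hS
  have error_int : Integrable (fun w : Finset (Fin n) × (∀ i, Fin B → Z i) =>
      p.gradMean x y - p.gradEst S x y (w.1, β, w.2)) ((subsetLaw n S).prod (p.batchesLaw B)) :=
    (integrable_const _).sub (h.integrable_gradEst hS hx y β)
  refine ⟨error_int.apply_continuousLinearMap v, ?_⟩
  rw [← ContinuousLinearMap.integral_apply error_int, integral_sub (integrable_const _)
    (h.integrable_gradEst hS hx y β), h.integral_gradEst hS₁ hS hB hx]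
  simp

end Problem.Assumptions

end GradientNoise

/-- A state of ALEXR: the previous iterate, the current iterate, and for each block the dual iterate
together with its (sub)gradient. -/
abbrev State (V : Type u) [NormedAddCommGroup V] [NormedSpace ℝ V] (d n : ℕ) : Type u :=
  Primal d × Primal d × (Fin n → StrongDual ℝ V × V)

section Transition

variable {V : Type u} [NormedAddCommGroup V] [NormedSpace ℝ V] {d n m B : ℕ}
  {Z : Fin n → Type w} [∀ i, MeasurableSpace (Z i)]

namespace Problem

/-- The states whose primal iterates and dual blocks lie in the domains of the problem. -/
structure IsFeasible (p : Problem V d n Z) (ψ : Fin n → DGF V) (s : State V d n) : Prop where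
  prev_mem : s.1 ∈ p.X
  curr_mem : s.2.1 ∈ p.X
  dual_mem : ∀ i, (s.2.2 i).1 ∈ conjDom (p.f i)
  isSubgrad : ∀ i, (ψ i).IsSubgrad (p.f i) (s.2.2 i).1 (s.2.2 i).2

/-- The result of the dual step in every block, whether selected or not, on the batches `β`. -/
noncomputable def dualUpdate [FiniteDimensional ℝ V] (p : Problem V d n Z) (ψ : Fin n → DGF V)
    (θ τ : ℝ) (s : State V d n) (β : ∀ i, Fin B → Z i) (i : Fin n) : StrongDual ℝ V × V :=
  (ψ i).dualStep (p.f i) τ (p.extrap θ i s.1 s.2.1 (β i)) (s.2.2 i).2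

/-- One iteration of ALEXR on the draw `ζ`, with `prox (ℓ, x)` the solution of the proximal
subproblem with linear term `ℓ` and centre `x`. -/
noncomputable def transition [FiniteDimensional ℝ V] (p : Problem V d n Z) (ψ : Fin n → DGF V)
    (S : ℕ) (θ τ : ℝ) (prox : StrongDual ℝ (Primal d) × Primal d → Primal d) (s : State V d n)
    (ζ : Draw n B Z) : State V d n :=
  (s.2.1, prox (p.gradEst S s.2.1 (fun i => (p.dualUpdate ψ θ τ s ζ.2.1 i).1) ζ, s.2.1),
    fun i => if i ∈ ζ.1 then p.dualUpdate ψ θ τ s ζ.2.1 i else s.2.2 i)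

/-- The sum of the dual Bregman divergences over all blocks. -/
noncomputable def totalDualGap (p : Problem V d n Z) (ψ : Fin n → DGF V) (xs : Primal d)
    (v : Fin n → StrongDual ℝ V × V) : ℝ :=
  ∑ i, p.dualGap ψ xs i (v i).1 (v i).2

/-- The Lyapunov function of ALEXR. The dual part is weighted by `1 / S` rather than `1 / n`, since
only a fraction `S / n` of the blocks is updated in each iteration. -/
noncomputable def lyapunov (p : Problem V d n Z) (ψ : Fin n → DGF V) (S : ℕ) (μ ρ η τ : ℝ)
    (xs : Primal d) (s : State V d n) : ℝ :=
  (η + μ) / 2 * ‖s.2.1 - xs‖ ^ 2 + η / 8 * ‖s.2.1 - s.1‖ ^ 2 +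
    (τ + ρ / 2) * (1 / S * p.totalDualGap ψ xs s.2.2)

/-- The error made in the dual steps by the sampling of the inner functions. -/
noncomputable def dualNoise (p : Problem V d n Z) (κ θ τ : ℝ) (xs : Primal d) (s : State V d n)
    (β : ∀ i, Fin B → Z i) : ℝ :=
  1 / n * ∑ i, ((s.2.2 i).1 - p.optDual xs i)
      (p.extrap θ i s.1 s.2.1 (β i) - p.extrapMean θ i s.1 s.2.1) +
    1 / n * ∑ i, ‖p.extrap θ i s.1 s.2.1 (β i) - p.extrapMean θ i s.1 s.2.1‖ ^ 2 / (2 * τ * κ)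

end Problem

variable {p : Problem V d n Z} {b : Module.Basis (Fin m) ℝ V} {ψ : Fin n → DGF V}
  {μ Cf Lf Cg σ₀ σ₁ δ ρ κ θ η τ k₁ k₂ : ℝ} {xs : Primal d} {s : State V d n} {S : ℕ}
  {prox : StrongDual ℝ (Primal d) × Primal d → Primal d}

namespace Problem

theorem totalDualGap_ite (v v' : Fin n → StrongDual ℝ V × V) (A : Finset (Fin n)) :
    p.totalDualGap ψ xs (fun i => if i ∈ A then v' i else v i) = p.totalDualGap ψ xs v +
      ∑ i ∈ A, (p.dualGap ψ xs i (v' i).1 (v' i).2 - p.dualGap ψ xs i (v i).1 (v i).2) := by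
  rw [totalDualGap, totalDualGap, ← Finset.filter_univ_mem A, Finset.sum_filter,
    ← Finset.sum_add_distrib]
  refine Finset.sum_congr rfl fun i _ => ?_
  simp only [Finset.filter_univ_mem]
  split_ifs <;> ring

theorem gradEst_congr {y y' : Fin n → StrongDual ℝ V} {ζ : Draw n B Z} {x : Primal d}
    (h : ∀ i ∈ ζ.1, y i = y' i) : p.gradEst S x y ζ = p.gradEst S x y' ζ := by
  simp only [gradEst]
  exact congrArg _ (Finset.sum_congr rfl fun i hi => by rw [h i hi])

end Problem

namespace Problem.Assumptions

theorem isDualStep_dualUpdate [FiniteDimensional ℝ V] (h : p.Assumptions b μ Cf Lf Cg σ₀ σ₁ δ)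
    (reg : StepRegime Cf Lf Cg ρ κ θ η τ k₁) (hψ : ∀ i, (ψ i).Admissible (p.f i) κ ρ)
    (β : ∀ i, Fin B → Z i) (i : Fin n) :
    (ψ i).IsDualStep (p.f i) τ (p.extrap θ i s.1 s.2.1 (β i)) (s.2.2 i).1 (s.2.2 i).2
      (p.dualUpdate ψ θ τ s β i).1 (p.dualUpdate ψ θ τ s β i).2 :=
  DGF.isDualStep_dualStep (h.outer i) reg.Cf_nonneg reg.Lf_pos (hψ i) reg.κ_pos.le reg.τ_pos _ _ _

theorem transition_isFeasible [FiniteDimensional ℝ V] (h : p.Assumptions b μ Cf Lf Cg σ₀ σ₁ δ)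
    (reg : StepRegime Cf Lf Cg ρ κ θ η τ k₁) (hψ : ∀ i, (ψ i).Admissible (p.f i) κ ρ)
    (hprox : ∀ ℓ x, p.IsProx η ℓ x (prox (ℓ, x))) (hs : p.IsFeasible ψ s) (ζ : Draw n B Z) :
    p.IsFeasible ψ (p.transition ψ S θ τ prox s ζ) := by
  have step := h.isDualStep_dualUpdate (s := s) reg hψ ζ.2.1
  refine ⟨hs.curr_mem, (hprox _ _).1, fun i => ?_, fun i => ?_⟩ <;>
    simp only [Problem.transition] <;> split_ifs
  exacts [(step i).mem, hs.dual_mem i, (step i).isSubgrad (h.outer i) reg.τ_pos, hs.isSubgrad i]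

theorem totalDualGap_nonneg (h : p.Assumptions b μ Cf Lf Cg σ₀ σ₁ δ)
    (reg : StepRegime Cf Lf Cg ρ κ θ η τ k₁) (hψ : ∀ i, (ψ i).Admissible (p.f i) κ ρ)
    (hs : p.IsFeasible ψ s) : 0 ≤ p.totalDualGap ψ xs s.2.2 :=
  Finset.sum_nonneg fun i _ => DGF.bregman_nonneg (h.outer i) reg.Lf_pos (hψ i) reg.κ_pos.le
    (hs.dual_mem i) (h.optDual_mem_conjDom xs i) (hs.isSubgrad i)

theorem lyapunov_nonneg (h : p.Assumptions b μ Cf Lf Cg σ₀ σ₁ δ)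
    (reg : StepRegime Cf Lf Cg ρ κ θ η τ k₁) (hψ : ∀ i, (ψ i).Admissible (p.f i) κ ρ)
    (hμ : 0 ≤ μ) (hs : p.IsFeasible ψ s) : 0 ≤ p.lyapunov ψ S μ ρ η τ xs s := by
  have := h.totalDualGap_nonneg (xs := xs) reg hψ hs
  have := reg.η_pos
  have := reg.τ_pos
  have := reg.ρ_pos
  unfold Problem.lyapunov
  positivity

theorem lyapunov_transition_le [FiniteDimensional ℝ V] (h : p.Assumptions b μ Cf Lf Cg σ₀ σ₁ δ)
    (reg : StepRegime Cf Lf Cg ρ κ θ η τ k₁) (lin : p.LinearizationBound k₁ k₂)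
    (hψ : ∀ i, (ψ i).Admissible (p.f i) κ ρ) (hμ : 0 ≤ μ) (hn : 0 < n) (hxs : p.IsMinimizer xs)
    (hprox : ∀ ℓ x, p.IsProx η ℓ x (prox (ℓ, x))) (hs : p.IsFeasible ψ s) (ζ : Draw n B Z)
    {v : Fin n → StrongDual ℝ V × V} (hv : v = p.dualUpdate ψ θ τ s ζ.2.1)
    {E : StrongDual ℝ (Primal d)}
    (hE : E = p.gradMean s.2.1 (fun i => (v i).1) - p.gradEst S s.2.1 (fun i => (v i).1) ζ) :
    p.lyapunov ψ S μ ρ η τ xs (p.transition ψ S θ τ prox s ζ) ≤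
      (η / 2 * ‖s.2.1 - xs‖ ^ 2 + η / 16 * ‖s.2.1 - s.1‖ ^ 2
        + (τ * (1 / n) + (τ + ρ / 2) * (1 / S)) * p.totalDualGap ψ xs s.2.2
        - (τ + ρ / 2) * (1 / n) * p.totalDualGap ψ xs v
        + p.dualNoise κ θ τ xs s ζ.2.1 + Cf * k₂)
      + (τ + ρ / 2) * (1 / S) * ∑ i ∈ ζ.1,
          (p.dualGap ψ xs i (v i).1 (v i).2 - p.dualGap ψ xs i (s.2.2 i).1 (s.2.2 i).2)
      + (E (s.2.1 - xs) + 2 / η * ‖E‖ ^ 2) := by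
  subst hv hE
  have step := h.one_step_inequality reg lin hψ hμ hn hxs hs.prev_mem hs.curr_mem hs.dual_mem
    hs.isSubgrad (h.isDualStep_dualUpdate reg hψ ζ.2.1)
    (hprox (p.gradEst S s.2.1 (fun i => (p.dualUpdate ψ θ τ s ζ.2.1 i).1) ζ) s.2.1)
  simp only [Problem.lyapunov, Problem.transition, totalDualGap_ite, Problem.dualNoise]
  simp only [Problem.totalDualGap]
  linarith

end Problem.Assumptions

end Transition

section Measurability

variable {V : Type u} [NormedAddCommGroup V] [NormedSpace ℝ V] {d n m B S : ℕ}
  {Z : Fin n → Type w} [∀ i, MeasurableSpace (Z i)] {p : Problem V d n Z}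
  {b : Module.Basis (Fin m) ℝ V} {ψ : Fin n → DGF V}
  {μ Cf Lf Cg σ₀ σ₁ δ ρ κ θ η τ k₁ : ℝ}
  {prox : StrongDual ℝ (Primal d) × Primal d → Primal d}

namespace Problem.Assumptions

variable [FiniteDimensional ℝ V] [MeasurableSpace V] [BorelSpace V]

theorem measurable_dualUpdate (h : p.Assumptions b μ Cf Lf Cg σ₀ σ₁ δ)
    (reg : StepRegime Cf Lf Cg ρ κ θ η τ k₁) (hψ : ∀ i, (ψ i).Admissible (p.f i) κ ρ) (i : Fin n) :
    Measurable fun w : State V d n × (∀ i, Fin B → Z i) => p.dualUpdate ψ θ τ w.1 w.2 i := by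
  have prev : Measurable fun w : State V d n × (∀ i, Fin B → Z i) => p.batch i w.1.1 (w.2 i) :=
    Measurable.comp (f := fun w : State V d n × (∀ i, Fin B → Z i) => (w.1.1, w.2 i))
      (h.measurable_batch i) (by fun_prop)
  have curr : Measurable fun w : State V d n × (∀ i, Fin B → Z i) => p.batch i w.1.2.1 (w.2 i) :=
    Measurable.comp (f := fun w : State V d n × (∀ i, Fin B → Z i) => (w.1.2.1, w.2 i))
      (h.measurable_batch i) (by fun_prop)
  have extrap : Measurable fun w : State V d n × (∀ i, Fin B → Z i) =>
      p.extrap θ i w.1.1 w.1.2.1 (w.2 i) :=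
    curr.add ((curr.sub prev).const_smul θ)
  exact Measurable.comp
    (f := fun w : State V d n × (∀ i, Fin B → Z i) =>
      (p.extrap θ i w.1.1 w.1.2.1 (w.2 i), (w.1.2.2 i).2))
    (DGF.measurable_dualStep (h.outer i) reg.Cf_nonneg reg.Lf_pos (hψ i) reg.κ_pos.le reg.τ_pos.le)
    (extrap.prodMk (by fun_prop))

theorem measurable_dualUpdate_draw (h : p.Assumptions b μ Cf Lf Cg σ₀ σ₁ δ)
    (reg : StepRegime Cf Lf Cg ρ κ θ η τ k₁) (hψ : ∀ i, (ψ i).Admissible (p.f i) κ ρ) (i : Fin n) :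
    Measurable fun w : State V d n × Draw n B Z => p.dualUpdate ψ θ τ w.1 w.2.2.1 i :=
  Measurable.comp (f := fun w : State V d n × Draw n B Z => (w.1, w.2.2.1))
    (h.measurable_dualUpdate reg hψ i) (by fun_prop)

theorem measurable_gradEst_dualUpdate (h : p.Assumptions b μ Cf Lf Cg σ₀ σ₁ δ)
    (reg : StepRegime Cf Lf Cg ρ κ θ η τ k₁) (hψ : ∀ i, (ψ i).Admissible (p.f i) κ ρ) :
    Measurable fun w : State V d n × Draw n B Z =>
      p.gradEst S w.1.2.1 (fun i => (p.dualUpdate ψ θ τ w.1 w.2.2.1 i).1) w.2 := by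
  have subset : Measurable fun w : State V d n × Draw n B Z => w.2.1 := by fun_prop
  have dual (i : Fin n) : Measurable fun w : State V d n × Draw n B Z =>
      (p.dualUpdate ψ θ τ w.1 w.2.2.1 i).1 :=
    (h.measurable_dualUpdate_draw reg hψ i).fst
  have grad (i : Fin n) : Measurable fun w : State V d n × Draw n B Z =>
      p.batchD i w.1.2.1 (w.2.2.2 i) :=
    Measurable.comp (f := fun w : State V d n × Draw n B Z => (w.1.2.1, w.2.2.2 i))
      (h.measurable_batchD i) (by fun_prop)
  have comp : Continuous fun a : StrongDual ℝ V × (Primal d →L[ℝ] V) => a.1.comp a.2 := by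
    fun_prop
  have block (i : Fin n) : Measurable fun w : State V d n × Draw n B Z =>
      (p.dualUpdate ψ θ τ w.1 w.2.2.1 i).1.comp (p.batchD i w.1.2.1 (w.2.2.2 i)) :=
    comp.measurable.comp ((dual i).prodMk (grad i))
  have sum := measurable_sum_mem subset block
  simp only [Problem.gradEst]
  exact sum.const_smul (1 / S : ℝ)

theorem measurable_transition (h : p.Assumptions b μ Cf Lf Cg σ₀ σ₁ δ)
    (reg : StepRegime Cf Lf Cg ρ κ θ η τ k₁) (hψ : ∀ i, (ψ i).Admissible (p.f i) κ ρ)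
    (hprox : Continuous prox) :
    Measurable fun w : State V d n × Draw n B Z => p.transition ψ S θ τ prox w.1 w.2 := by
  refine Measurable.prodMk (by fun_prop) (Measurable.prodMk ?_ (measurable_pi_lambda _ fun i => ?_))
  · exact hprox.measurable.comp
      ((h.measurable_gradEst_dualUpdate reg hψ).prodMk (by fun_prop))
  · refine Measurable.ite ?_ (h.measurable_dualUpdate_draw reg hψ i) (by fun_prop)
    exact (by fun_prop : Measurable fun w : State V d n × Draw n B Z => w.2.1)
      (Set.toFinite {A : Finset (Fin n) | i ∈ A}).measurableSet

theorem exists_measurable_lyapunov (h : p.Assumptions b μ Cf Lf Cg σ₀ σ₁ δ)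
    (hψ : ∀ i, (ψ i).Admissible (p.f i) κ ρ) (xs : Primal d) :
    ∃ F : State V d n → ℝ, Measurable F ∧
      ∀ s, p.IsFeasible ψ s → p.lyapunov ψ S μ ρ η τ xs s = F s := by
  choose D measurable eq using fun i =>
    DGF.exists_measurable_bregman (h.outer i) (hψ i) (p.optDual xs i)
  refine ⟨fun s => (η + μ) / 2 * ‖s.2.1 - xs‖ ^ 2 + η / 8 * ‖s.2.1 - s.1‖ ^ 2 +
    (τ + ρ / 2) * (1 / S * ∑ i, D i (s.2.2 i)), by fun_prop, fun s hs => ?_⟩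
  have gap (i : Fin n) : p.dualGap ψ xs i (s.2.2 i).1 (s.2.2 i).2 = D i (s.2.2 i) :=
    eq i _ (hs.dual_mem i) _ (hs.isSubgrad i)
  simp only [Problem.lyapunov, Problem.totalDualGap, gap]

theorem exists_measurable_lyapunov_transition (h : p.Assumptions b μ Cf Lf Cg σ₀ σ₁ δ)
    (reg : StepRegime Cf Lf Cg ρ κ θ η τ k₁) (hψ : ∀ i, (ψ i).Admissible (p.f i) κ ρ)
    (hcont : Continuous prox) (hprox : ∀ ℓ x, p.IsProx η ℓ x (prox (ℓ, x))) (xs : Primal d) :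
    ∃ F : State V d n × Draw n B Z → ℝ, Measurable F ∧ ∀ s, p.IsFeasible ψ s → ∀ ζ,
      p.lyapunov ψ S μ ρ η τ xs (p.transition ψ S θ τ prox s ζ) = F (s, ζ) := by
  obtain ⟨F, measurable, eq⟩ := h.exists_measurable_lyapunov (S := S) (η := η) (τ := τ) hψ xs
  exact ⟨fun w => F (p.transition ψ S θ τ prox w.1 w.2),
    measurable.comp (h.measurable_transition reg hψ hcont),
    fun s hs ζ => eq _ (h.transition_isFeasible reg hψ hprox hs ζ)⟩

end Problem.Assumptions

end Measurability

section Fubini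

variable {α β γ : Type*} [MeasurableSpace α] [MeasurableSpace β] [MeasurableSpace γ]

theorem integral_prod_le_of_nonneg {μ : Measure α} {ν : Measure β} [SFinite μ] [SFinite ν]
    {f : α × β → ℝ} {φ : α → ℝ} (hf : AEStronglyMeasurable f (μ.prod ν)) (nonneg : ∀ w, 0 ≤ f w)
    (fiber : ∀ a, Integrable (fun b => f (a, b)) ν ∧ ∫ b, f (a, b) ∂ν ≤ φ a)
    (hφ : Integrable φ μ) : Integrable f (μ.prod ν) ∧ ∫ w, f w ∂μ.prod ν ≤ ∫ a, φ a ∂μ := by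
  have norm_eq (w : α × β) : ‖f w‖ = f w := Real.norm_of_nonneg (nonneg w)
  have marginal : Integrable (fun a => ∫ b, f (a, b) ∂ν) μ :=
    integrable_of_nonneg_of_le hf.integral_prod_right'
      (fun a => integral_nonneg fun b => nonneg (a, b)) (fun a => (fiber a).2) hφ
  have joint : Integrable f (μ.prod ν) :=
    (integrable_prod_iff hf).2 ⟨.of_forall fun a => (fiber a).1, by simpa only [norm_eq]⟩
  refine ⟨joint, ?_⟩
  rw [integral_prod f joint]
  exact integral_mono marginal hφ fun a => (fiber a).2

theorem measurePreserving_prod_left_comm (μ : Measure α) (ν : Measure β) (ξ : Measure γ)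
    [SFinite μ] [SFinite ν] [SFinite ξ] :
    MeasurePreserving (fun w : β × α × γ => (w.2.1, w.1, w.2.2)) (ν.prod (μ.prod ξ))
      (μ.prod (ν.prod ξ)) :=
  (measurePreserving_prodAssoc μ ν ξ).comp
    ((Measure.measurePreserving_swap.prod (MeasurePreserving.id ξ)).comp
      (measurePreserving_prodAssoc ν μ ξ).symm)

end Fubini

/-- The step sizes of ALEXR as functions of the extrapolation weight `θ`, for `S` of `n` blocks per
iteration. -/
structure Schedule (n S : ℕ) (μ ρ θ η τ : ℝ) : Prop where
  S_pos : 1 ≤ S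
  S_le : S ≤ n
  μ_pos : 0 < μ
  half_le_θ : 1 / 2 ≤ θ
  θ_lt_one : θ < 1
  η_eq : η = μ * θ / (1 - θ)
  τ_eq : τ = S / (n * (1 - θ))
  ρ_le : ρ ≤ 2 * τ

/-- The factor by which the variance of an average of independent vectors of `V` may exceed its
Euclidean value: the squared condition number of `L`. -/
noncomputable def distortion {V : Type*} [NormedAddCommGroup V] [NormedSpace ℝ V] {k : ℕ}
    (L : V ≃L[ℝ] Primal k) : ℝ :=
  ‖(L.symm : Primal k →L[ℝ] V)‖ ^ 2 * ‖(L : V →L[ℝ] Primal k)‖ ^ 2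

/-- The expected increase of the Lyapunov function in one iteration that is caused by sampling and
by linearizing the inner functions, where `Λ` is the distortion of the inner space. -/
noncomputable def noiseLevel (Λ : ℝ) (S B : ℕ) (Cf σ₀ σ₁ δ κ η τ k₂ : ℝ) : ℝ :=
  10 * (Λ * σ₀ ^ 2 / B) / (2 * τ * κ) + 2 / η * (2 * (δ ^ 2 / S + Cf ^ 2 * σ₁ ^ 2 / B)) + Cf * k₂

namespace Schedule

variable {n S : ℕ} {μ ρ θ η τ : ℝ}

theorem one_sub_mul_add_eq (sch : Schedule n S μ ρ θ η τ) : (1 - θ) * (η + μ) = μ := by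
  have gap_pos : 0 < 1 - θ := sub_pos.2 sch.θ_lt_one
  rw [sch.η_eq]
  field_simp
  ring

theorem dual_weight_le (sch : Schedule n S μ ρ θ η τ) :
    (1 - θ) * (τ + ρ / 2) * (1 / S) ≤ 2 * (1 / n) := by
  have S_pos : (0 : ℝ) < S := by exact_mod_cast sch.S_pos
  have gap_pos : 0 < 1 - θ := sub_pos.2 sch.θ_lt_one
  calc (1 - θ) * (τ + ρ / 2) * (1 / S) ≤ (1 - θ) * (2 * τ) * (1 / S) := by
        gcongr
        linarith [sch.ρ_le]
    _ = 2 * (1 / n) := by rw [sch.τ_eq]; field_simp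

theorem contraction (sch : Schedule n S μ ρ θ η τ) (hρ : 0 ≤ ρ) (hρ₁ : ρ ≤ 1)
    (hη : 0 ≤ η) {a e g : ℝ} (ha : 0 ≤ a) (he : 0 ≤ e) (hg : 0 ≤ g) :
    η / 2 * a + η / 16 * e + ((τ + ρ / 2) * (1 / S) - ρ / 2 * (1 / n)) * g ≤
      (1 - ρ * (1 - θ) / 4) * ((η + μ) / 2 * a + η / 8 * e + (τ + ρ / 2) * (1 / S * g)) := by
  have μ_pos := sch.μ_pos
  have half_le := sch.half_le_θ
  have gap_pos : 0 < 1 - θ := sub_pos.2 sch.θ_lt_one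
  have rate_le : ρ * (1 - θ) / 4 ≤ 1 - θ := by nlinarith
  have primal : η / 2 ≤ (1 - ρ * (1 - θ) / 4) * ((η + μ) / 2) := by
    nlinarith [sch.one_sub_mul_add_eq]
  have momentum : η / 16 ≤ (1 - ρ * (1 - θ) / 4) * (η / 8) := by nlinarith
  have dual : (τ + ρ / 2) * (1 / S) - ρ / 2 * (1 / n) ≤
      (1 - ρ * (1 - θ) / 4) * ((τ + ρ / 2) * (1 / S)) := by
    nlinarith [sch.dual_weight_le]
  linarith [mul_le_mul_of_nonneg_right primal ha, mul_le_mul_of_nonneg_right momentum he,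
    mul_le_mul_of_nonneg_right dual hg]

end Schedule

section Drift

variable {V : Type u} [NormedAddCommGroup V] [NormedSpace ℝ V] {d n m k B S : ℕ}
  {Z : Fin n → Type w} [∀ i, MeasurableSpace (Z i)] {p : Problem V d n Z}
  {b : Module.Basis (Fin m) ℝ V} {ψ : Fin n → DGF V}
  {μ Cf Lf Cg σ₀ σ₁ δ ρ κ θ η τ k₁ k₂ : ℝ} {xs : Primal d} {s : State V d n}
  {prox : StrongDual ℝ (Primal d) × Primal d → Primal d}

namespace Problem.Assumptions

variable [FiniteDimensional ℝ V]

theorem integral_gradient_noise_le (h : p.Assumptions b μ Cf Lf Cg σ₀ σ₁ δ) (hCf : 0 ≤ Cf)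
    (hη : 0 < η) (hS₁ : 1 ≤ S) (hS : S ≤ n) (hB : 1 ≤ B) {x : Primal d} (hx : x ∈ p.X)
    {y : Fin n → StrongDual ℝ V} (hy : ∀ i, y i ∈ conjDom (p.f i)) (β : ∀ i, Fin B → Z i)
    (v : Primal d) {E : Finset (Fin n) × (∀ i, Fin B → Z i) → StrongDual ℝ (Primal d)}
    (hE : ∀ w, E w = p.gradMean x y - p.gradEst S x y (w.1, β, w.2)) :
    Integrable (fun w => E w v + 2 / η * ‖E w‖ ^ 2) ((subsetLaw n S).prod (p.batchesLaw B)) ∧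
      ∫ w, (E w v + 2 / η * ‖E w‖ ^ 2) ∂(subsetLaw n S).prod (p.batchesLaw B) ≤
        2 / η * (2 * (δ ^ 2 / S + Cf ^ 2 * σ₁ ^ 2 / B)) := by
  have linear := h.integral_gradMean_sub_gradEst_apply hS₁ hS hB hx y β v
  have square := h.integral_norm_sq_gradMean_sub_gradEst_le hCf hS₁ hS hB hx hy β
  simp only [← hE] at linear square
  refine ⟨linear.1.add (square.1.const_mul _), ?_⟩
  rw [integral_add linear.1 (square.1.const_mul _), linear.2, integral_const_mul, zero_add]
  exact mul_le_mul_of_nonneg_left square.2 (div_nonneg zero_le_two hη.le)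

theorem integral_lyapunov_transition_subset_le [MeasurableSpace V] [BorelSpace V]
    (h : p.Assumptions b μ Cf Lf Cg σ₀ σ₁ δ)
    (reg : StepRegime Cf Lf Cg ρ κ θ η τ k₁) (lin : p.LinearizationBound k₁ k₂)
    (hψ : ∀ i, (ψ i).Admissible (p.f i) κ ρ) (hμ : 0 ≤ μ) (hS₁ : 1 ≤ S) (hS : S ≤ n) (hB : 1 ≤ B)
    (hxs : p.IsMinimizer xs) (hcont : Continuous prox)
    (hprox : ∀ ℓ x, p.IsProx η ℓ x (prox (ℓ, x))) (hs : p.IsFeasible ψ s) (β : ∀ i, Fin B → Z i) :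
    Integrable (fun w : Finset (Fin n) × (∀ i, Fin B → Z i) =>
        p.lyapunov ψ S μ ρ η τ xs (p.transition ψ S θ τ prox s (w.1, β, w.2)))
        ((subsetLaw n S).prod (p.batchesLaw B)) ∧
      ∫ w : Finset (Fin n) × (∀ i, Fin B → Z i),
          p.lyapunov ψ S μ ρ η τ xs (p.transition ψ S θ τ prox s (w.1, β, w.2))
          ∂(subsetLaw n S).prod (p.batchesLaw B) ≤
        p.dualNoise κ θ τ xs s β + (η / 2 * ‖s.2.1 - xs‖ ^ 2 + η / 16 * ‖s.2.1 - s.1‖ ^ 2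
          + ((τ + ρ / 2) * (1 / S) - ρ / 2 * (1 / n)) * p.totalDualGap ψ xs s.2.2
          + 2 / η * (2 * (δ ^ 2 / S + Cf ^ 2 * σ₁ ^ 2 / B)) + Cf * k₂) := by
  have := h.prob
  have := isProbabilityMeasure_subsetLaw hS
  have hn : 0 < n := by omega
  have hS₀ : (S : ℝ) ≠ 0 := by positivity
  have pointwise (w : Finset (Fin n) × (∀ i, Fin B → Z i)) :=
    h.lyapunov_transition_le (S := S) reg lin hψ hμ hn hxs hprox hs (w.1, β, w.2) rfl rfl
  simp only at pointwise
  set v := p.dualUpdate ψ θ τ s β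
  have change_const (i : Fin n) : Integrable (fun _ : ∀ i, Fin B → Z i =>
      p.dualGap ψ xs i (v i).1 (v i).2 - p.dualGap ψ xs i (s.2.2 i).1 (s.2.2 i).2)
      (p.batchesLaw B) := integrable_const _
  have change := (integrable_sum_mem_prod hS change_const).const_mul ((τ + ρ / 2) * (1 / S))
  have noise := h.integral_gradient_noise_le reg.Cf_nonneg reg.η_pos hS₁ hS hB hs.curr_mem
    (fun i => (h.isDualStep_dualUpdate (s := s) reg hψ β i).mem) β (s.2.1 - xs) fun _ => rfl
  have change_add (c : ℝ) := (integrable_const c).fun_add change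
  have bound (c : ℝ) := (change_add c).fun_add noise.1
  have left : Integrable (fun w : Finset (Fin n) × (∀ i, Fin B → Z i) =>
      p.lyapunov ψ S μ ρ η τ xs (p.transition ψ S θ τ prox s (w.1, β, w.2)))
      ((subsetLaw n S).prod (p.batchesLaw B)) := by
    obtain ⟨F, measurable, eq_F⟩ :=
      h.exists_measurable_lyapunov_transition (S := S) (B := B) reg hψ hcont hprox xs
    refine integrable_of_nonneg_of_le ?_ (fun w => ?_) pointwise (bound _)
    · simp only [eq_F s hs]
      exact (measurable.comp (by fun_prop)).aestronglyMeasurable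
    · exact h.lyapunov_nonneg reg hψ hμ (h.transition_isFeasible reg hψ hprox hs _)
  refine ⟨left, (integral_mono left (bound _) pointwise).trans ?_⟩
  rw [integral_add (change_add _) noise.1, integral_add (integrable_const _) change,
    integral_const_mul, integral_sum_mem_prod hS change_const]
  simp only [integral_const, probReal_univ, smul_eq_mul, one_mul, Finset.sum_sub_distrib]
  refine (add_le_add_right noise.2 _).trans_eq ?_
  have cancel : (1 / S : ℝ) * (S / n) = 1 / n := by field_simp
  simp only [Problem.totalDualGap]
  linear_combination (τ + ρ / 2) * (∑ i, p.dualGap ψ xs i (v i).1 (v i).2 -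
    ∑ i, p.dualGap ψ xs i (s.2.2 i).1 (s.2.2 i).2) * cancel

theorem integral_extrap_noise_le (h : p.Assumptions b μ Cf Lf Cg σ₀ σ₁ δ) (L : V ≃L[ℝ] Primal k)
    (hB : 1 ≤ B) (hθ : 0 ≤ θ) (hθ₁ : θ ≤ 1) (hτ : 0 ≤ τ) (hκ : 0 ≤ κ) {i : Fin n}
    {xp x : Primal d} (hxp : xp ∈ p.X) (hx : x ∈ p.X) (ℓ : StrongDual ℝ V) :
    Integrable (fun β => ℓ (p.extrap θ i xp x β - p.extrapMean θ i xp x) +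
        ‖p.extrap θ i xp x β - p.extrapMean θ i xp x‖ ^ 2 / (2 * τ * κ)) (p.batchLaw B i) ∧
      ∫ β, (ℓ (p.extrap θ i xp x β - p.extrapMean θ i xp x) +
          ‖p.extrap θ i xp x β - p.extrapMean θ i xp x‖ ^ 2 / (2 * τ * κ)) ∂(p.batchLaw B i) ≤
        10 * (distortion L * σ₀ ^ 2 / B) / (2 * τ * κ) := by
  have := h.prob
  have extrap := h.integrable_extrap (B := B) (i := i) (θ := θ) hxp hx
  have noise : Integrable (fun β => p.extrap θ i xp x β - p.extrapMean θ i xp x)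
    (p.batchLaw B i) := extrap.sub (integrable_const _)
  have noise_mean : ∫ β, (p.extrap θ i xp x β - p.extrapMean θ i xp x) ∂(p.batchLaw B i) = 0 := by
    rw [integral_sub extrap (integrable_const _), h.integral_extrap hB hxp hx, integral_const,
      probReal_univ, one_smul, sub_self]
  have linear := ℓ.integrable_comp noise
  obtain ⟨square, square_le⟩ := h.integral_norm_sq_extrap_sub_le (i := i) L hB hθ hθ₁ hxp hx
  refine ⟨linear.add (square.div_const _), ?_⟩
  rw [integral_add linear (square.div_const _), ℓ.integral_comp_comm noise, noise_mean, map_zero,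
    zero_add, integral_div]
  refine div_le_div_of_nonneg_right (square_le.trans_eq ?_) (by positivity)
  rw [distortion]
  ring

theorem integral_dualNoise_le (h : p.Assumptions b μ Cf Lf Cg σ₀ σ₁ δ) (L : V ≃L[ℝ] Primal k)
    (hn : 0 < n) (hB : 1 ≤ B) (hθ : 0 ≤ θ) (hθ₁ : θ ≤ 1) (hτ : 0 ≤ τ) (hκ : 0 ≤ κ)
    (hs : p.IsFeasible ψ s) :
    Integrable (p.dualNoise κ θ τ xs s) (p.batchesLaw B) ∧
      ∫ β, p.dualNoise κ θ τ xs s β ∂(p.batchesLaw B) ≤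
        10 * (distortion L * σ₀ ^ 2 / B) / (2 * τ * κ) := by
  have := h.prob
  have hn₀ : (n : ℝ) ≠ 0 := by positivity
  have block (i : Fin n) := h.integral_extrap_noise_le (i := i) L hB hθ hθ₁ hτ hκ hs.prev_mem
    hs.curr_mem ((s.2.2 i).1 - p.optDual xs i)
  have block_eval (i : Fin n) := integrable_comp_eval (μ := fun i => p.batchLaw B i) (block i).1
  have eq_sum (β : ∀ i, Fin B → Z i) : p.dualNoise κ θ τ xs s β =
      1 / n * ∑ i, (((s.2.2 i).1 - p.optDual xs i)
        (p.extrap θ i s.1 s.2.1 (β i) - p.extrapMean θ i s.1 s.2.1) +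
      ‖p.extrap θ i s.1 s.2.1 (β i) - p.extrapMean θ i s.1 s.2.1‖ ^ 2 / (2 * τ * κ)) := by
    rw [Problem.dualNoise, Finset.sum_add_distrib, mul_add]
  simp_rw [funext eq_sum]
  refine ⟨(integrable_finsetSum _ fun i _ => block_eval i).const_mul _, ?_⟩
  rw [integral_const_mul, integral_finsetSum _ fun i _ => block_eval i]
  refine (mul_le_mul_of_nonneg_left (Finset.sum_le_card_nsmul _ _ _ fun i _ =>
    (integral_comp_eval (μ := fun i => p.batchLaw B i)
      (block i).1.aestronglyMeasurable).trans_le (block i).2) (by positivity)).trans_eq ?_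
  rw [Finset.card_univ, Fintype.card_fin, nsmul_eq_mul, ← mul_assoc, one_div_mul_cancel hn₀,
    one_mul]

theorem integral_lyapunov_transition_le [MeasurableSpace V] [BorelSpace V]
    (h : p.Assumptions b μ Cf Lf Cg σ₀ σ₁ δ) (reg : StepRegime Cf Lf Cg ρ κ θ η τ k₁)
    (sch : Schedule n S μ ρ θ η τ) (lin : p.LinearizationBound k₁ k₂)
    (hψ : ∀ i, (ψ i).Admissible (p.f i) κ ρ) (L : V ≃L[ℝ] Primal k) (hB : 1 ≤ B)
    (hxs : p.IsMinimizer xs) (hcont : Continuous prox)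
    (hprox : ∀ ℓ x, p.IsProx η ℓ x (prox (ℓ, x))) (hs : p.IsFeasible ψ s) :
    Integrable (fun ζ => p.lyapunov ψ S μ ρ η τ xs (p.transition ψ S θ τ prox s ζ))
        (p.drawLaw S B) ∧
      ∫ ζ, p.lyapunov ψ S μ ρ η τ xs (p.transition ψ S θ τ prox s ζ) ∂(p.drawLaw S B) ≤
        (1 - ρ * (1 - θ) / 4) * p.lyapunov ψ S μ ρ η τ xs s +
          noiseLevel (distortion L) S B Cf σ₀ σ₁ δ κ η τ k₂ := by
  have := h.prob
  have := isProbabilityMeasure_subsetLaw sch.S_le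
  have hn : 0 < n := sch.S_pos.trans sch.S_le
  set G : Draw n B Z → ℝ := fun ζ =>
    p.lyapunov ψ S μ ρ η τ xs (p.transition ψ S θ τ prox s ζ) with hG
  obtain ⟨F, measurable, eq_F⟩ :=
    h.exists_measurable_lyapunov_transition (S := S) (B := B) (μ := μ) reg hψ hcont hprox xs
  have G_measurable : Measurable G := by
    simp only [hG, eq_F s hs]
    exact measurable.comp measurable_prodMk_left
  have G_nonneg (ζ) : 0 ≤ G ζ :=
    h.lyapunov_nonneg reg hψ sch.μ_pos.le (h.transition_isFeasible reg hψ hprox hs ζ)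
  have reorder := measurePreserving_prod_left_comm (subsetLaw n S) (p.batchesLaw B) (p.batchesLaw B)
  have fiber := h.integral_lyapunov_transition_subset_le reg lin hψ sch.μ_pos.le sch.S_pos sch.S_le
    hB hxs hcont hprox hs
  obtain ⟨noise, noise_le⟩ := h.integral_dualNoise_le (xs := xs) L hn hB reg.θ_nonneg reg.θ_le_one
    reg.τ_pos.le reg.κ_pos.le hs
  have gap_nonneg : 0 ≤ p.totalDualGap ψ xs s.2.2 := h.totalDualGap_nonneg reg hψ hs
  obtain ⟨joint, joint_le⟩ := integral_prod_le_of_nonneg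
    (G_measurable.comp reorder.measurable).aestronglyMeasurable (fun w => G_nonneg _) fiber
    (noise.add (integrable_const _))
  rw [integral_add noise (integrable_const _), integral_const, probReal_univ, one_smul] at joint_le
  refine ⟨(reorder.integrable_comp G_measurable.aestronglyMeasurable).1 joint, ?_⟩
  have law : ∫ ζ, G ζ ∂(p.drawLaw S B) = ∫ w, G (w.2.1, w.1, w.2.2)
      ∂(p.batchesLaw B).prod ((subsetLaw n S).prod (p.batchesLaw B)) := by
    rw [← integral_map reorder.measurable.aemeasurable G_measurable.aestronglyMeasurable,
      reorder.map_eq]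
    rfl
  have contraction := sch.contraction reg.ρ_pos.le reg.ρ_le_one reg.η_pos.le
    (sq_nonneg ‖s.2.1 - xs‖) (sq_nonneg ‖s.2.1 - s.1‖) gap_nonneg
  rw [law, noiseLevel, Problem.lyapunov]
  exact joint_le.trans (by linarith)

end Problem.Assumptions

end Drift

theorem integral_comp_prodMk_le_of_indepFun {Ω α β : Type*} [MeasurableSpace Ω]
    [MeasurableSpace α] [MeasurableSpace β] {Pr : Measure Ω} [IsProbabilityMeasure Pr]
    {ν : Measure β} [IsProbabilityMeasure ν] {H : Ω → α} {ζ : Ω → β} (hH : AEMeasurable H Pr)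
    (law : HasLaw ζ ν Pr) (indep : IndepFun H ζ Pr) {F : α × β → ℝ} (hF : Measurable F)
    {φ : Ω → ℝ} (hφ : Integrable φ Pr) (nonneg : ∀ ω b, 0 ≤ F (H ω, b))
    (fiber : ∀ ω, Integrable (fun b => F (H ω, b)) ν ∧ ∫ b, F (H ω, b) ∂ν ≤ φ ω) :
    Integrable (fun ω => F (H ω, ζ ω)) Pr ∧ ∫ ω, F (H ω, ζ ω) ∂Pr ≤ ∫ ω, φ ω ∂Pr := by
  have law_H : HasLaw H (Pr.map H) Pr := ⟨hH, rfl⟩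
  have law_fst : HasLaw (fun w : Ω × β => H w.1) (Pr.map H) (Pr.prod ν) :=
    law_H.comp measurePreserving_fst.hasLaw
  have joint : IdentDistrib (fun w : Ω × β => F (H w.1, w.2)) (fun ω => F (H ω, ζ ω))
      (Pr.prod ν) Pr :=
    (((indepFun_prod₀ hH aemeasurable_id).hasLaw_prod law_fst
      measurePreserving_snd.hasLaw).identDistrib (indep.hasLaw_prod law_H law)).comp hF
  rw [← joint.integrable_iff, ← joint.integral_eq]
  exact integral_prod_le_of_nonneg joint.aemeasurable_fst.aestronglyMeasurable
    (fun w => nonneg w.1 w.2) fiber hφ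

section Run

variable {V : Type u} [NormedAddCommGroup V] [NormedSpace ℝ V] {d n m k B S : ℕ}
  {Z : Fin n → Type w} [∀ i, MeasurableSpace (Z i)] {p : Problem V d n Z}
  {b : Module.Basis (Fin m) ℝ V} {ψ : Fin n → DGF V}
  {μ Cf Lf Cg σ₀ σ₁ δ ρ κ θ η τ k₁ k₂ : ℝ} {xs x₀ : Primal d} {y₀ : Fin n → StrongDual ℝ V}
  {q₀ : Fin n → V} {prox : StrongDual ℝ (Primal d) × Primal d → Primal d} {Ω : Type v}
  {ξ : ℕ → Ω → Draw n B Z} {X : ℕ → Ω → Primal d} {Y : ℕ → Ω → Fin n → StrongDual ℝ V}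
  {Q : ℕ → Ω → Fin n → V}

/-- The state of a run before iteration `t`. In iteration `0` the previous primal iterate is `X 0`,
by truncated subtraction. -/
def runState (X : ℕ → Ω → Primal d) (Y : ℕ → Ω → Fin n → StrongDual ℝ V) (Q : ℕ → Ω → Fin n → V)
    (t : ℕ) (ω : Ω) : State V d n :=
  (X (t - 1) ω, X t ω, fun i => (Y t ω i, Q t ω i))

namespace Problem.IsALEXR

theorem runState_zero (run : p.IsALEXR ψ S B θ η τ x₀ y₀ q₀ ξ X Y Q) (ω : Ω) :
    runState X Y Q 0 ω = (x₀, x₀, fun i => (y₀ i, q₀ i)) := by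
  simp only [runState, run.x_init.2, run.y_init.2, run.q_init.2]

theorem isFeasible_init (run : p.IsALEXR ψ S B θ η τ x₀ y₀ q₀ ξ X Y Q) :
    p.IsFeasible ψ (x₀, x₀, fun i => (y₀ i, q₀ i)) :=
  ⟨run.x_init.1, run.x_init.1, run.y_init.1, run.q_init.1⟩

variable [FiniteDimensional ℝ V]

theorem runState_succ (run : p.IsALEXR ψ S B θ η τ x₀ y₀ q₀ ξ X Y Q)
    (h : p.Assumptions b μ Cf Lf Cg σ₀ σ₁ δ) (reg : StepRegime Cf Lf Cg ρ κ θ η τ k₁)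
    (hψ : ∀ i, (ψ i).Admissible (p.f i) κ ρ)
    (hprox : ∀ ℓ x x', p.IsProx η ℓ x x' ↔ x' = prox (ℓ, x)) (t : ℕ) (ω : Ω) :
    runState X Y Q (t + 1) ω = p.transition ψ S θ τ prox (runState X Y Q t ω) (ξ t ω) := by
  set s := runState X Y Q t ω
  have dual_eq (i : Fin n) (hi : i ∈ (ξ t ω).1) :
      (Y (t + 1) ω i, Q (t + 1) ω i) = p.dualUpdate ψ θ τ s (ξ t ω).2.1 i := by
    obtain ⟨mem, isMaxOn, nextSubgrad⟩ := run.dual t ω i hi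
    obtain ⟨y_eq, q_eq⟩ := DGF.IsDualStep.unique (h.outer i) reg.Lf_pos (hψ i) reg.κ_pos.le
      reg.τ_pos ⟨mem, isMaxOn, nextSubgrad⟩ (h.isDualStep_dualUpdate (s := s) reg hψ (ξ t ω).2.1 i)
    exact Prod.ext y_eq q_eq
  have primal_eq := (hprox _ _ _).1 (run.primal t ω)
  rw [gradEst_congr fun i hi => congrArg Prod.fst (dual_eq i hi)] at primal_eq
  refine Prod.ext rfl (Prod.ext primal_eq (funext fun i => ?_))
  by_cases hi : i ∈ (ξ t ω).1
  · exact (dual_eq i hi).trans (if_pos hi).symm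
  · exact (Prod.ext (run.dual_idle t ω i hi).1 (run.dual_idle t ω i hi).2).trans (if_neg hi).symm

theorem isFeasible_runState (run : p.IsALEXR ψ S B θ η τ x₀ y₀ q₀ ξ X Y Q)
    (h : p.Assumptions b μ Cf Lf Cg σ₀ σ₁ δ) (reg : StepRegime Cf Lf Cg ρ κ θ η τ k₁)
    (hψ : ∀ i, (ψ i).Admissible (p.f i) κ ρ)
    (hprox : ∀ ℓ x x', p.IsProx η ℓ x x' ↔ x' = prox (ℓ, x)) (t : ℕ) (ω : Ω) :
    p.IsFeasible ψ (runState X Y Q t ω) := by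
  induction t with
  | zero => exact run.runState_zero ω ▸ run.isFeasible_init
  | succ t ih =>
    rw [run.runState_succ h reg hψ hprox]
    exact h.transition_isFeasible reg hψ (fun _ _ => (hprox _ _ _).2 rfl) ih _

variable [MeasurableSpace V] [BorelSpace V]

theorem exists_measurable_runState (run : p.IsALEXR ψ S B θ η τ x₀ y₀ q₀ ξ X Y Q)
    (h : p.Assumptions b μ Cf Lf Cg σ₀ σ₁ δ) (reg : StepRegime Cf Lf Cg ρ κ θ η τ k₁)
    (hψ : ∀ i, (ψ i).Admissible (p.f i) κ ρ) (hcont : Continuous prox)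
    (hprox : ∀ ℓ x x', p.IsProx η ℓ x x' ↔ x' = prox (ℓ, x)) (t : ℕ) :
    ∃ Φ : (Finset.range t → Draw n B Z) → State V d n, Measurable Φ ∧
      ∀ ω, runState X Y Q t ω = Φ fun i => ξ i ω := by
  induction t with
  | zero => exact ⟨fun _ => (x₀, x₀, fun i => (y₀ i, q₀ i)), measurable_const, run.runState_zero⟩
  | succ t ih =>
    obtain ⟨Φ, measurable, eq_Φ⟩ := ih
    have past {i} (hi : i ∈ Finset.range t) : i ∈ Finset.range (t + 1) :=
      Finset.range_subset_range.2 t.le_succ hi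
    refine ⟨fun z => p.transition ψ S θ τ prox (Φ fun i => z ⟨i, past i.2⟩)
      (z ⟨t, Finset.self_mem_range_succ t⟩), ?_, fun ω => ?_⟩
    · have pair : Measurable fun z : Finset.range (t + 1) → Draw n B Z =>
          (Φ fun i => z ⟨i, past i.2⟩, z ⟨t, Finset.self_mem_range_succ t⟩) :=
        (measurable.comp (measurable_pi_lambda _ fun i => measurable_pi_apply _)).prodMk
          (measurable_pi_apply _)
      exact (h.measurable_transition reg hψ hcont).comp pair
    · rw [run.runState_succ h reg hψ hprox, eq_Φ ω]

variable [MeasurableSpace Ω] {Pr : Measure Ω}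

theorem aemeasurable_runState (run : p.IsALEXR ψ S B θ η τ x₀ y₀ q₀ ξ X Y Q)
    (h : p.Assumptions b μ Cf Lf Cg σ₀ σ₁ δ) (reg : StepRegime Cf Lf Cg ρ κ θ η τ k₁)
    (hψ : ∀ i, (ψ i).Admissible (p.f i) κ ρ) (hcont : Continuous prox)
    (hprox : ∀ ℓ x x', p.IsProx η ℓ x x' ↔ x' = prox (ℓ, x)) (sampling : p.IsSampling S B Pr ξ)
    (t : ℕ) : AEMeasurable (runState X Y Q t) Pr := by
  obtain ⟨Φ, measurable, eq_Φ⟩ := run.exists_measurable_runState h reg hψ hcont hprox t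
  rw [show runState X Y Q t = fun ω => Φ fun i => ξ i ω from funext eq_Φ]
  exact measurable.comp_aemeasurable
    (aemeasurable_pi_lambda _ fun i => (sampling.law i).aemeasurable)

theorem indepFun_runState (run : p.IsALEXR ψ S B θ η τ x₀ y₀ q₀ ξ X Y Q)
    (h : p.Assumptions b μ Cf Lf Cg σ₀ σ₁ δ) (reg : StepRegime Cf Lf Cg ρ κ θ η τ k₁)
    (hψ : ∀ i, (ψ i).Admissible (p.f i) κ ρ) (hcont : Continuous prox)
    (hprox : ∀ ℓ x x', p.IsProx η ℓ x x' ↔ x' = prox (ℓ, x)) (sampling : p.IsSampling S B Pr ξ)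
    (t : ℕ) : IndepFun (runState X Y Q t) (ξ t) Pr := by
  obtain ⟨Φ, measurable, eq_Φ⟩ := run.exists_measurable_runState h reg hψ hcont hprox t
  have present : Measurable fun z : ({t} : Finset ℕ) → Draw n B Z =>
      z ⟨t, Finset.mem_singleton_self t⟩ :=
    measurable_pi_apply (⟨t, Finset.mem_singleton_self t⟩ : ({t} : Finset ℕ))
  rw [show runState X Y Q t = fun ω => Φ fun i => ξ i ω from funext eq_Φ]
  exact (sampling.indep.indepFun_finset₀ (Finset.range t) {t} (by simp)
    fun i => (sampling.law i).aemeasurable).comp measurable present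

theorem integral_lyapunov_succ_le [IsProbabilityMeasure Pr]
    (run : p.IsALEXR ψ S B θ η τ x₀ y₀ q₀ ξ X Y Q)
    (h : p.Assumptions b μ Cf Lf Cg σ₀ σ₁ δ) (reg : StepRegime Cf Lf Cg ρ κ θ η τ k₁)
    (sch : Schedule n S μ ρ θ η τ) (lin : p.LinearizationBound k₁ k₂)
    (hψ : ∀ i, (ψ i).Admissible (p.f i) κ ρ) (L : V ≃L[ℝ] Primal k) (hB : 1 ≤ B)
    (hxs : p.IsMinimizer xs) (sampling : p.IsSampling S B Pr ξ) {t : ℕ}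
    (ih : Integrable (fun ω => p.lyapunov ψ S μ ρ η τ xs (runState X Y Q t ω)) Pr) :
    Integrable (fun ω => p.lyapunov ψ S μ ρ η τ xs (runState X Y Q (t + 1) ω)) Pr ∧
      ∫ ω, p.lyapunov ψ S μ ρ η τ xs (runState X Y Q (t + 1) ω) ∂Pr ≤
        (1 - ρ * (1 - θ) / 4) * ∫ ω, p.lyapunov ψ S μ ρ η τ xs (runState X Y Q t ω) ∂Pr +
          noiseLevel (distortion L) S B Cf σ₀ σ₁ δ κ η τ k₂ := by
  obtain ⟨prox, hcont, hprox⟩ := h.exists_continuous_prox reg.η_pos.le sch.μ_pos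
  have isProx (ℓ x) : p.IsProx η ℓ x (prox (ℓ, x)) := (hprox _ _ _).2 rfl
  have feasible := run.isFeasible_runState h reg hψ hprox t
  obtain ⟨F, measurable, eq_F⟩ :=
    h.exists_measurable_lyapunov_transition (S := S) (B := B) (μ := μ) reg hψ hcont isProx xs
  have := h.prob
  have := isProbabilityMeasure_subsetLaw sch.S_le
  have : IsProbabilityMeasure (p.drawLaw S B) :=
    inferInstanceAs (IsProbabilityMeasure
      ((subsetLaw n S).prod ((p.batchesLaw B).prod (p.batchesLaw B))))
  have drift := integral_comp_prodMk_le_of_indepFun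
    (run.aemeasurable_runState h reg hψ hcont hprox sampling t) (sampling.law t)
    (run.indepFun_runState h reg hψ hcont hprox sampling t) measurable
    ((ih.const_mul _).add (integrable_const _))
    (fun ω ζ => by
      rw [← eq_F _ (feasible ω)]
      exact h.lyapunov_nonneg reg hψ sch.μ_pos.le
        (h.transition_isFeasible reg hψ isProx (feasible ω) ζ))
    fun ω => by
      simp only [← eq_F _ (feasible ω)]
      exact h.integral_lyapunov_transition_le reg sch lin hψ L hB hxs hcont isProx (feasible ω)
  simp only [← eq_F _ (feasible _), ← run.runState_succ h reg hψ hprox] at drift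
  refine ⟨drift.1, drift.2.trans_eq ?_⟩
  simp only [Pi.add_apply]
  rw [integral_add (ih.const_mul _) (integrable_const _), integral_const_mul, integral_const,
    probReal_univ, one_smul]

end Problem.IsALEXR

end Run

theorem le_pow_mul_add_of_le_mul_add {a : ℕ → ℝ} {q ν : ℝ} (hq₀ : 0 ≤ q) (hq₁ : q < 1)
    (hν : 0 ≤ ν) (h : ∀ t, a (t + 1) ≤ q * a t + ν) (t : ℕ) :
    a t ≤ q ^ t * a 0 + ν / (1 - q) := by
  have gap_pos : 0 < 1 - q := sub_pos.2 hq₁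
  induction t with
  | zero =>
    rw [pow_zero, one_mul]
    exact le_add_of_nonneg_right (by positivity)
  | succ t ih =>
    calc a (t + 1) ≤ q * (q ^ t * a 0 + ν / (1 - q)) + ν := (h t).trans (by gcongr)
      _ = q ^ (t + 1) * a 0 + ν / (1 - q) := by field_simp; ring

theorem two_mul_mul_pow_le {Δ ε x : ℝ} (hΔ : 0 ≤ Δ) (hε : 0 < ε) (hx₀ : 0 < x) (hx₁ : x ≤ 1)
    {T : ℕ} (hT : 2 / x * Real.log (2 + Δ / ε) ≤ T) : 2 * Δ * (1 - x) ^ T ≤ ε / 2 := by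
  obtain ⟨y, hy, rfl⟩ : ∃ y, 0 ≤ y ∧ Δ = y * ε :=
    ⟨Δ / ε, by positivity, (div_mul_cancel₀ _ hε.ne').symm⟩
  rw [mul_div_cancel_right₀ _ hε.ne', div_mul_eq_mul_div, div_le_iff₀ hx₀] at hT
  have pow_le : (1 - x) ^ T ≤ 1 / (2 + y) ^ 2 :=
    calc (1 - x) ^ T ≤ Real.exp (-x) ^ T :=
          pow_le_pow_left₀ (sub_nonneg.2 hx₁) (Real.one_sub_le_exp_neg x) T
      _ = Real.exp (-(T * x)) := by rw [← Real.exp_nat_mul, mul_neg]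
      _ ≤ Real.exp (-(2 * Real.log (2 + y))) := by gcongr
      _ = 1 / (2 + y) ^ 2 := by
        rw [Real.exp_neg, two_mul, Real.exp_add, Real.exp_log (by linarith), ← sq, one_div]
  calc 2 * (y * ε) * (1 - x) ^ T ≤ 2 * (y * ε) * (1 / (2 + y) ^ 2) := by gcongr
    _ ≤ ε / 2 := by
      rw [mul_one_div, div_le_iff₀ (by positivity)]
      nlinarith [mul_nonneg hε.le (sq_nonneg (y - 2)), mul_nonneg hε.le hy]

section Convergence

variable {V : Type u} [NormedAddCommGroup V] [NormedSpace ℝ V] {d n m k B S : ℕ}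
  {Z : Fin n → Type w} [∀ i, MeasurableSpace (Z i)] {p : Problem V d n Z}
  {b : Module.Basis (Fin m) ℝ V} {ψ : Fin n → DGF V}
  {μ Cf Lf Cg σ₀ σ₁ δ ρ κ θ η τ k₁ k₂ Λ : ℝ} {xs x₀ : Primal d} {y₀ : Fin n → StrongDual ℝ V}
  {q₀ : Fin n → V} {s : State V d n}

theorem StepRegime.noiseLevel_nonneg (reg : StepRegime Cf Lf Cg ρ κ θ η τ k₁) (hΛ : 0 ≤ Λ)
    (hk₂ : 0 ≤ k₂) : 0 ≤ noiseLevel Λ S B Cf σ₀ σ₁ δ κ η τ k₂ := by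
  have := reg.κ_pos
  have := reg.τ_pos
  have := reg.η_pos
  have := reg.Cf_nonneg
  rw [noiseLevel]
  positivity

namespace Problem.Assumptions

theorem initGap_nonneg (h : p.Assumptions b μ Cf Lf Cg σ₀ σ₁ δ)
    (reg : StepRegime Cf Lf Cg ρ κ θ η τ k₁) (hψ : ∀ i, (ψ i).Admissible (p.f i) κ ρ) (hμ : 0 ≤ μ)
    (hs : p.IsFeasible ψ (x₀, x₀, fun i => (y₀ i, q₀ i))) : 0 ≤ p.initGap ψ μ x₀ y₀ q₀ xs :=
  add_nonneg (by positivity)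
    (mul_nonneg (by positivity)
      (h.totalDualGap_nonneg (s := (x₀, x₀, fun i => (y₀ i, q₀ i))) reg hψ hs))

theorem mul_norm_sq_le_lyapunov (h : p.Assumptions b μ Cf Lf Cg σ₀ σ₁ δ)
    (reg : StepRegime Cf Lf Cg ρ κ θ η τ k₁) (sch : Schedule n S μ ρ θ η τ)
    (hψ : ∀ i, (ψ i).Admissible (p.f i) κ ρ) (hs : p.IsFeasible ψ s) :
    μ / 2 * ‖s.2.1 - xs‖ ^ 2 ≤ (1 - θ) * p.lyapunov ψ S μ ρ η τ xs s := by
  have gap_pos : 0 < 1 - θ := sub_pos.2 sch.θ_lt_one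
  have η_pos := reg.η_pos
  have τ_pos := reg.τ_pos
  have ρ_pos := reg.ρ_pos
  have dual_nonneg := h.totalDualGap_nonneg (xs := xs) reg hψ hs
  calc μ / 2 * ‖s.2.1 - xs‖ ^ 2 = (1 - θ) * (η + μ) / 2 * ‖s.2.1 - xs‖ ^ 2 := by
        rw [sch.one_sub_mul_add_eq]
    _ = (1 - θ) * ((η + μ) / 2 * ‖s.2.1 - xs‖ ^ 2) := by ring
    _ ≤ (1 - θ) * p.lyapunov ψ S μ ρ η τ xs s := by
        refine mul_le_mul_of_nonneg_left ?_ gap_pos.le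
        rw [Problem.lyapunov, add_assoc]
        exact le_add_of_nonneg_right (by positivity)

theorem lyapunov_init_le (h : p.Assumptions b μ Cf Lf Cg σ₀ σ₁ δ)
    (reg : StepRegime Cf Lf Cg ρ κ θ η τ k₁) (sch : Schedule n S μ ρ θ η τ)
    (hψ : ∀ i, (ψ i).Admissible (p.f i) κ ρ)
    (hs : p.IsFeasible ψ (x₀, x₀, fun i => (y₀ i, q₀ i))) :
    (1 - θ) * p.lyapunov ψ S μ ρ η τ xs (x₀, x₀, fun i => (y₀ i, q₀ i)) ≤
      2 * p.initGap ψ μ x₀ y₀ q₀ xs := by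
  set gap := p.totalDualGap ψ xs fun i => (y₀ i, q₀ i)
  have gap_nonneg : 0 ≤ gap :=
    h.totalDualGap_nonneg (s := (x₀, x₀, fun i => (y₀ i, q₀ i))) reg hψ hs
  have μ_pos := sch.μ_pos
  have initGap_eq : p.initGap ψ μ x₀ y₀ q₀ xs = μ / 2 * ‖x₀ - xs‖ ^ 2 + 1 / n * gap := rfl
  calc (1 - θ) * p.lyapunov ψ S μ ρ η τ xs (x₀, x₀, fun i => (y₀ i, q₀ i))
      = (1 - θ) * (η + μ) / 2 * ‖x₀ - xs‖ ^ 2 + (1 - θ) * (τ + ρ / 2) * (1 / S) * gap := by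
        simp only [Problem.lyapunov, sub_self, norm_zero]
        ring
    _ ≤ 2 * (μ / 2 * ‖x₀ - xs‖ ^ 2) + 2 * (1 / n) * gap := by
        rw [sch.one_sub_mul_add_eq]
        exact add_le_add (le_mul_of_one_le_left (by positivity) one_le_two)
          (mul_le_mul_of_nonneg_right sch.dual_weight_le gap_nonneg)
    _ = 2 * p.initGap ψ μ x₀ y₀ q₀ xs := by rw [initGap_eq]; ring

end Problem.Assumptions

namespace Problem.IsALEXR

variable [FiniteDimensional ℝ V] [MeasurableSpace V] [BorelSpace V] {Ω : Type v}
  [MeasurableSpace Ω] {Pr : Measure Ω} [IsProbabilityMeasure Pr] {ξ : ℕ → Ω → Draw n B Z}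
  {X : ℕ → Ω → Primal d} {Y : ℕ → Ω → Fin n → StrongDual ℝ V} {Q : ℕ → Ω → Fin n → V}

theorem integral_lyapunov_le (run : p.IsALEXR ψ S B θ η τ x₀ y₀ q₀ ξ X Y Q)
    (h : p.Assumptions b μ Cf Lf Cg σ₀ σ₁ δ) (reg : StepRegime Cf Lf Cg ρ κ θ η τ k₁)
    (sch : Schedule n S μ ρ θ η τ) (lin : p.LinearizationBound k₁ k₂) (hk₂ : 0 ≤ k₂)
    (hψ : ∀ i, (ψ i).Admissible (p.f i) κ ρ) (L : V ≃L[ℝ] Primal k) (hB : 1 ≤ B)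
    (hxs : p.IsMinimizer xs) (sampling : p.IsSampling S B Pr ξ) (t : ℕ) :
    Integrable (fun ω => p.lyapunov ψ S μ ρ η τ xs (runState X Y Q t ω)) Pr ∧
      ∫ ω, p.lyapunov ψ S μ ρ η τ xs (runState X Y Q t ω) ∂Pr ≤
        (1 - ρ * (1 - θ) / 4) ^ t *
            p.lyapunov ψ S μ ρ η τ xs (x₀, x₀, fun i => (y₀ i, q₀ i)) +
          noiseLevel (distortion L) S B Cf σ₀ σ₁ δ κ η τ k₂ / (ρ * (1 - θ) / 4) := by
  have gap_pos : 0 < 1 - θ := sub_pos.2 sch.θ_lt_one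
  have ρ_pos := reg.ρ_pos
  have rate_pos : 0 < ρ * (1 - θ) / 4 := by positivity
  have rate_le : ρ * (1 - θ) / 4 ≤ 1 := by nlinarith [reg.ρ_le_one, reg.θ_nonneg]
  have noise_nonneg : 0 ≤ noiseLevel (distortion L) S B Cf σ₀ σ₁ δ κ η τ k₂ :=
    reg.noiseLevel_nonneg (by rw [distortion]; positivity) hk₂
  have integrable (t : ℕ) :
      Integrable (fun ω => p.lyapunov ψ S μ ρ η τ xs (runState X Y Q t ω)) Pr := by
    induction t with
    | zero => simp only [run.runState_zero, integrable_const]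
    | succ t ih => exact (run.integral_lyapunov_succ_le h reg sch lin hψ L hB hxs sampling ih).1
  refine ⟨integrable t, ?_⟩
  have recursion := le_pow_mul_add_of_le_mul_add
    (a := fun t => ∫ ω, p.lyapunov ψ S μ ρ η τ xs (runState X Y Q t ω) ∂Pr) (sub_nonneg.2 rate_le)
    (sub_lt_self 1 rate_pos) noise_nonneg (fun t =>
      (run.integral_lyapunov_succ_le h reg sch lin hψ L hB hxs sampling (integrable t)).2) t
  simpa only [run.runState_zero, integral_const, probReal_univ, one_smul, sub_sub_cancel]
    using recursion

theorem integral_norm_sq_le (run : p.IsALEXR ψ S B θ η τ x₀ y₀ q₀ ξ X Y Q)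
    (h : p.Assumptions b μ Cf Lf Cg σ₀ σ₁ δ) (reg : StepRegime Cf Lf Cg ρ κ θ η τ k₁)
    (sch : Schedule n S μ ρ θ η τ) (lin : p.LinearizationBound k₁ k₂) (hk₂ : 0 ≤ k₂)
    (hψ : ∀ i, (ψ i).Admissible (p.f i) κ ρ) (L : V ≃L[ℝ] Primal k) (hB : 1 ≤ B)
    (hxs : p.IsMinimizer xs) (sampling : p.IsSampling S B Pr ξ) (t : ℕ) :
    Integrable (fun ω => ‖X t ω - xs‖ ^ 2) Pr ∧
      μ / 2 * ∫ ω, ‖X t ω - xs‖ ^ 2 ∂Pr ≤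
        2 * p.initGap ψ μ x₀ y₀ q₀ xs * (1 - ρ * (1 - θ) / 4) ^ t +
          4 * noiseLevel (distortion L) S B Cf σ₀ σ₁ δ κ η τ k₂ / ρ := by
  obtain ⟨prox, hcont, hprox⟩ := h.exists_continuous_prox reg.η_pos.le sch.μ_pos
  have feasible (t ω) := run.isFeasible_runState h reg hψ hprox t ω
  obtain ⟨integrable, integral_le⟩ :=
    run.integral_lyapunov_le h reg sch lin hk₂ hψ L hB hxs sampling t
  have μ_pos := sch.μ_pos
  have ρ_pos := reg.ρ_pos
  have gap_pos : 0 < 1 - θ := sub_pos.2 sch.θ_lt_one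
  have rate_le : 0 ≤ 1 - ρ * (1 - θ) / 4 := by nlinarith [reg.ρ_le_one, reg.θ_nonneg]
  have dominated (ω) : μ / 2 * ‖X t ω - xs‖ ^ 2 ≤
      (1 - θ) * p.lyapunov ψ S μ ρ η τ xs (runState X Y Q t ω) :=
    h.mul_norm_sq_le_lyapunov (s := runState X Y Q t ω) reg sch hψ (feasible t ω)
  have measurable : AEMeasurable (X t) Pr :=
    (measurable_fst.comp measurable_snd).comp_aemeasurable (f := runState X Y Q t)
      (run.aemeasurable_runState h reg hψ hcont hprox sampling t)
  have dist_integrable : Integrable (fun ω => μ / 2 * ‖X t ω - xs‖ ^ 2) Pr :=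
    integrable_of_nonneg_of_le
      (((measurable.sub_const xs).norm.pow_const 2).const_mul _).aestronglyMeasurable
      (fun ω => by positivity) dominated (integrable.const_mul _)
  refine ⟨(integrable_const_mul_iff (half_pos μ_pos).ne'.isUnit _).1 dist_integrable, ?_⟩
  rw [← integral_const_mul]
  set ν := noiseLevel (distortion L) S B Cf σ₀ σ₁ δ κ η τ k₂
  calc ∫ ω, μ / 2 * ‖X t ω - xs‖ ^ 2 ∂Pr
      ≤ (1 - θ) * ∫ ω, p.lyapunov ψ S μ ρ η τ xs (runState X Y Q t ω) ∂Pr := by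
        rw [← integral_const_mul]
        exact integral_mono dist_integrable (integrable.const_mul _) dominated
    _ ≤ (1 - θ) * _ := mul_le_mul_of_nonneg_left integral_le gap_pos.le
    _ = (1 - θ) * p.lyapunov ψ S μ ρ η τ xs (x₀, x₀, fun i => (y₀ i, q₀ i)) *
          (1 - ρ * (1 - θ) / 4) ^ t + 4 * ν / ρ := by
        rw [mul_add, mul_left_comm, mul_comm ((1 - ρ * (1 - θ) / 4) ^ t)]
        congr 1
        field_simp
    _ ≤ 2 * p.initGap ψ μ x₀ y₀ q₀ xs * (1 - ρ * (1 - θ) / 4) ^ t + 4 * ν / ρ := by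
        have init_le := h.lyapunov_init_le (xs := xs) reg sch hψ run.isFeasible_init
        gcongr ?_ * _ + _

end Problem.IsALEXR

theorem Problem.Assumptions.reachesAccuracy (h : p.Assumptions b μ Cf Lf Cg σ₀ σ₁ δ)
    (reg : StepRegime Cf Lf Cg ρ κ θ η τ k₁) (sch : Schedule n S μ ρ θ η τ)
    (lin : p.LinearizationBound k₁ k₂) (hk₂ : 0 ≤ k₂) (hψ : ∀ i, (ψ i).Admissible (p.f i) κ ρ)
    (L : V ≃L[ℝ] Primal k) (hB : 1 ≤ B) {ε : ℝ} (hε : 0 < ε)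
    (noise_le : noiseLevel (distortion L) S B Cf σ₀ σ₁ δ κ η τ k₂ ≤ ρ / 8 * ε) :
    Problem.ReachesAccuracy.{u, w, v} p ψ S B μ θ η τ ε (8 / (ρ * (1 - θ))) := by
  have := b.finiteDimensional_of_finite
  let : MeasurableSpace V := borel V
  have : BorelSpace V := ⟨rfl⟩
  intro Ω _ Pr _ ξ x₀ y₀ q₀ X Y Q xs hxs sampling run T hT
  have ρ_pos := reg.ρ_pos
  have gap_pos : 0 < 1 - θ := sub_pos.2 sch.θ_lt_one
  have transient_le : 2 * p.initGap ψ μ x₀ y₀ q₀ xs * (1 - ρ * (1 - θ) / 4) ^ T ≤ ε / 2 := by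
    refine two_mul_mul_pow_le (h.initGap_nonneg reg hψ sch.μ_pos.le run.isFeasible_init) hε
      (by positivity) (by nlinarith [reg.ρ_le_one, reg.θ_nonneg]) (hT.trans_eq' ?_)
    field_simp
    ring
  have stationary_le : 4 * noiseLevel (distortion L) S B Cf σ₀ σ₁ δ κ η τ k₂ / ρ ≤ ε / 2 := by
    rw [div_le_iff₀ ρ_pos]
    linarith
  obtain ⟨integrable, bound⟩ :=
    run.integral_norm_sq_le h reg sch lin hk₂ hψ L hB hxs sampling T
  exact ⟨integrable, bound.trans (by linarith)⟩

end Convergence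

/-- The extrapolation weight `θ` for which ALEXR reaches accuracy `ε` after about `M / ε`
iterations. The scale `M` dominates the contributions of the outer batches, of the inner batches and
of the rare dual updates. -/
structure AccuracyScale (n S B : ℕ) (μ c ε M θ : ℝ) : Prop where
  S_pos : 1 ≤ S
  S_le : S ≤ n
  B_pos : 1 ≤ B
  μ_pos : 0 < μ
  c_pos : 0 < c
  c_le : c ≤ 1 / 2
  ε_pos : 0 < ε
  ε_le : ε ≤ 1 / B
  outer_le : 1 / (μ * S) ≤ M
  inner_le : 1 / (μ * B) ≤ M
  dual_le : n / (B * S) ≤ M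
  θ_eq : θ = 1 - c * ε / M

theorem exists_small_constant {E A r : ℝ} (hE : 0 ≤ E) (hA : 0 ≤ A) (hr : 0 < r) :
    ∃ c, 0 < c ∧ c ≤ 1 / 2 ∧ E ≤ 1 / (2 * c) ∧ A * c ≤ r := by
  have ratio_nonneg : 0 ≤ A / r := by positivity
  refine ⟨1 / (2 + 2 * E + A / r), by positivity,
    one_div_le_one_div_of_le two_pos (by linarith), ?_, ?_⟩
  · field_simp
    linarith
  · rw [mul_one_div, div_le_iff₀ (by positivity), mul_add, mul_div_cancel₀ _ hr.ne']
    exact le_add_of_nonneg_left (by positivity)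

section Rates

variable {n S B : ℕ} {μ c ε M θ ρ κ η τ Λ Cf σ₀ σ₁ δ k₂ : ℝ}

namespace Schedule

theorem η_pos (sch : Schedule n S μ ρ θ η τ) : 0 < η := by
  have gap_pos : 0 < 1 - θ := sub_pos.2 sch.θ_lt_one
  have μ_pos := sch.μ_pos
  have : 0 < θ := by linarith [sch.half_le_θ]
  rw [sch.η_eq]
  positivity

theorem one_div_η_le (sch : Schedule n S μ ρ θ η τ) : 1 / η ≤ 2 * ((1 - θ) * (1 / μ)) := by
  have gap_pos : 0 < 1 - θ := sub_pos.2 sch.θ_lt_one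
  have μ_pos := sch.μ_pos
  have : 0 < θ := by linarith [sch.half_le_θ]
  rw [div_le_iff₀ sch.η_pos, sch.η_eq]
  field_simp
  linarith [sch.half_le_θ]

theorem noiseLevel_le (sch : Schedule n S μ ρ θ η τ) (hB : 1 ≤ B) :
    noiseLevel Λ S B Cf σ₀ σ₁ δ κ η τ k₂ ≤
      5 * Λ * σ₀ ^ 2 / κ * ((1 - θ) * (n / (B * S))) +
        8 * (δ ^ 2 * ((1 - θ) * (1 / (μ * S))) + Cf ^ 2 * σ₁ ^ 2 * ((1 - θ) * (1 / (μ * B)))) +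
        Cf * k₂ := by
  have gap_pos : 0 < 1 - θ := sub_pos.2 sch.θ_lt_one
  have μ_pos := sch.μ_pos
  have S_pos : (0 : ℝ) < S := by exact_mod_cast sch.S_pos
  have : (0 : ℝ) < B := by exact_mod_cast hB
  have dual_eq : 10 * (Λ * σ₀ ^ 2 / B) / (2 * τ * κ) =
      5 * Λ * σ₀ ^ 2 / κ * ((1 - θ) * (n / (B * S))) := by
    rw [sch.τ_eq]
    field_simp
    ring
  have primal_le : 2 / η * (2 * (δ ^ 2 / S + Cf ^ 2 * σ₁ ^ 2 / B)) ≤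
      8 * (δ ^ 2 * ((1 - θ) * (1 / (μ * S))) + Cf ^ 2 * σ₁ ^ 2 * ((1 - θ) * (1 / (μ * B)))) :=
    calc 2 / η * (2 * (δ ^ 2 / S + Cf ^ 2 * σ₁ ^ 2 / B))
        = 1 / η * (4 * (δ ^ 2 / S + Cf ^ 2 * σ₁ ^ 2 / B)) := by ring
      _ ≤ 2 * ((1 - θ) * (1 / μ)) * (4 * (δ ^ 2 / S + Cf ^ 2 * σ₁ ^ 2 / B)) := by
        gcongr
        exact sch.one_div_η_le
      _ = _ := by field_simp; ring
  rw [noiseLevel, dual_eq]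
  gcongr

end Schedule

namespace AccuracyScale

theorem scale_pos (sc : AccuracyScale n S B μ c ε M θ) : 0 < M := by
  have μ_pos := sc.μ_pos
  have B_pos : (0 : ℝ) < B := by exact_mod_cast sc.B_pos
  exact lt_of_lt_of_le (by positivity) sc.inner_le

theorem one_sub_eq (sc : AccuracyScale n S B μ c ε M θ) : 1 - θ = c * ε / M := by
  rw [sc.θ_eq, sub_sub_cancel]

theorem one_sub_pos (sc : AccuracyScale n S B μ c ε M θ) : 0 < 1 - θ := by
  have := sc.c_pos
  have := sc.ε_pos
  have := sc.scale_pos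
  rw [sc.one_sub_eq]
  positivity

theorem one_sub_mul_le (sc : AccuracyScale n S B μ c ε M θ) {a : ℝ} (ha : a ≤ M) :
    (1 - θ) * a ≤ c * ε :=
  calc (1 - θ) * a ≤ (1 - θ) * M := mul_le_mul_of_nonneg_left ha sc.one_sub_pos.le
    _ = c * ε := by rw [sc.one_sub_eq, div_mul_cancel₀ _ sc.scale_pos.ne']

theorem one_sub_mul_le_of_div_le (sc : AccuracyScale n S B μ c ε M θ) {a : ℝ} (ha : a / B ≤ M) :
    (1 - θ) * a ≤ c := by
  have c_pos := sc.c_pos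
  have B_pos : (0 : ℝ) < B := by exact_mod_cast sc.B_pos
  calc (1 - θ) * a = (1 - θ) * (a / B) * B := by field_simp
    _ ≤ c * (1 / B) * B :=
      mul_le_mul_of_nonneg_right ((sc.one_sub_mul_le ha).trans
        (mul_le_mul_of_nonneg_left sc.ε_le c_pos.le)) B_pos.le
    _ = c := by field_simp

theorem one_sub_mul_div_le (sc : AccuracyScale n S B μ c ε M θ) : (1 - θ) * (n / S) ≤ c :=
  sc.one_sub_mul_le_of_div_le (by rw [div_div, mul_comm]; exact sc.dual_le)

theorem one_sub_le (sc : AccuracyScale n S B μ c ε M θ) : 1 - θ ≤ c := by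
  have S_pos : (0 : ℝ) < S := by exact_mod_cast sc.S_pos
  have S_le : (S : ℝ) ≤ n := by exact_mod_cast sc.S_le
  exact (le_mul_of_one_le_right sc.one_sub_pos.le ((one_le_div S_pos).2 S_le)).trans
    sc.one_sub_mul_div_le

theorem schedule (sc : AccuracyScale n S B μ c ε M θ) (hρ : ρ ≤ 1) :
    Schedule n S μ ρ θ (μ * θ / (1 - θ)) (S / (n * (1 - θ))) where
  S_pos := sc.S_pos
  S_le := sc.S_le
  μ_pos := sc.μ_pos
  half_le_θ := by linarith [sc.one_sub_le, sc.c_le]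
  θ_lt_one := sub_pos.1 sc.one_sub_pos
  η_eq := rfl
  τ_eq := rfl
  ρ_le := by
    have gap_pos := sc.one_sub_pos
    have S_pos : (0 : ℝ) < S := by exact_mod_cast sc.S_pos
    have n_pos : (0 : ℝ) < n := by exact_mod_cast sc.S_pos.trans sc.S_le
    have inv_le := sc.one_sub_mul_div_le
    have one_le : 1 ≤ S / (n * (1 - θ)) := by
      rw [← mul_div_assoc, div_le_iff₀ S_pos] at inv_le
      rw [one_le_div (by positivity)]
      nlinarith [sc.c_le]
    linarith

theorem one_div_le_η (sc : AccuracyScale n S B μ c ε M θ) :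
    1 / (2 * c) ≤ μ * θ / (1 - θ) := by
  have gap_pos := sc.one_sub_pos
  have c_pos := sc.c_pos
  have μ_pos := sc.μ_pos
  have inv_le : (1 - θ) * (1 / μ) ≤ c :=
    sc.one_sub_mul_le_of_div_le (by rw [div_div]; exact sc.inner_le)
  rw [mul_one_div, div_le_iff₀ μ_pos] at inv_le
  rw [div_le_div_iff₀ (by positivity) gap_pos]
  nlinarith [sc.one_sub_le, sc.c_le, mul_pos c_pos μ_pos]

theorem noiseLevel_le (sc : AccuracyScale n S B μ c ε M θ) (hΛ : 0 ≤ Λ) (hκ : 0 ≤ κ) :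
    noiseLevel Λ S B Cf σ₀ σ₁ δ κ (μ * θ / (1 - θ)) (S / (n * (1 - θ))) k₂ ≤
      (5 * Λ * σ₀ ^ 2 / κ + 8 * (δ ^ 2 + Cf ^ 2 * σ₁ ^ 2)) * (c * ε) + Cf * k₂ := by
  refine ((sc.schedule le_rfl).noiseLevel_le sc.B_pos).trans ?_
  have dual_le : 5 * Λ * σ₀ ^ 2 / κ * ((1 - θ) * (n / (B * S))) ≤
      5 * Λ * σ₀ ^ 2 / κ * (c * ε) :=
    mul_le_mul_of_nonneg_left (sc.one_sub_mul_le sc.dual_le) (by positivity)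
  have outer_le : δ ^ 2 * ((1 - θ) * (1 / (μ * S))) ≤ δ ^ 2 * (c * ε) :=
    mul_le_mul_of_nonneg_left (sc.one_sub_mul_le sc.outer_le) (by positivity)
  have inner_le : Cf ^ 2 * σ₁ ^ 2 * ((1 - θ) * (1 / (μ * B))) ≤ Cf ^ 2 * σ₁ ^ 2 * (c * ε) :=
    mul_le_mul_of_nonneg_left (sc.one_sub_mul_le sc.inner_le) (by positivity)
  linarith

end AccuracyScale

end Rates

section Main

variable {V : Type u} [NormedAddCommGroup V] [NormedSpace ℝ V] {m : ℕ}

section Linearization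

variable {d n S B : ℕ} {Z : Fin n → Type w} [∀ i, MeasurableSpace (Z i)] {p : Problem V d n Z}
  {b : Module.Basis (Fin m) ℝ V} {μ Cf Lf Cg Lg σ₀ σ₁ δ c ε M θ : ℝ}

theorem Problem.InnerSmooth.linearizationBound (smooth : p.InnerSmooth Lg) :
    p.LinearizationBound (Lg / 2) 0 := fun i x hx x' hx' => by
  rw [add_zero]
  exact (smooth i x hx).2 x' hx'

theorem Problem.Assumptions.linearizationBound (h : p.Assumptions b μ Cf Lf Cg σ₀ σ₁ δ) {k₁ : ℝ}
    (hk₁ : 0 < k₁) : p.LinearizationBound k₁ (Cg ^ 2 / k₁) := fun i x hx x' hx' => by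
  have young : 2 * ‖x' - x‖ * Cg ≤ k₁ * ‖x' - x‖ ^ 2 + k₁⁻¹ * Cg ^ 2 :=
    two_mul_le_add_mul_sq hk₁
  calc ‖p.inner i x' - p.inner i x - p.innerD i x (x' - x)‖
      ≤ ‖p.inner i x' - p.inner i x‖ + ‖p.innerD i x (x' - x)‖ := norm_sub_le _ _
    _ ≤ Cg * ‖x' - x‖ + Cg * ‖x' - x‖ :=
      add_le_add (h.g_lipschitz i x' hx' x hx) (h.Dg_bound i x hx x' hx')
    _ ≤ k₁ * ‖x' - x‖ ^ 2 + Cg ^ 2 / k₁ := by rw [div_eq_inv_mul]; linarith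

theorem AccuracyScale.exists_linearizationBound (sc : AccuracyScale n S B μ c ε M θ)
    (hM : 1 / μ ≤ M) (h : p.Assumptions b μ Cf Lf Cg σ₀ σ₁ δ) (hCf : 0 < Cf) :
    ∃ k₁ k₂, 0 ≤ k₂ ∧ p.LinearizationBound k₁ k₂ ∧ Cf * k₁ ≤ μ * θ / (1 - θ) / 8 ∧
      Cf * k₂ ≤ 16 * Cf ^ 2 * Cg ^ 2 * (c * ε) := by
  have sch := sc.schedule le_rfl
  have η_pos := sch.η_pos
  set η := μ * θ / (1 - θ)
  refine ⟨η / (8 * Cf), Cg ^ 2 / (η / (8 * Cf)), by positivity,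
    h.linearizationBound (by positivity), le_of_eq (by field_simp), ?_⟩
  calc Cf * (Cg ^ 2 / (η / (8 * Cf))) = 8 * Cf ^ 2 * Cg ^ 2 * (1 / η) := by field_simp
    _ ≤ 8 * Cf ^ 2 * Cg ^ 2 * (2 * (c * ε)) := by
      gcongr
      exact sch.one_div_η_le.trans (mul_le_mul_of_nonneg_left (sc.one_sub_mul_le hM) two_pos.le)
    _ = 16 * Cf ^ 2 * Cg ^ 2 * (c * ε) := by ring

end Linearization

theorem exists_reachesAccuracy_of_linearizationBound (b : Module.Basis (Fin m) ℝ V)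
    {Cf Lf Cg μψ ρ σ₀ σ₁ δ a A : ℝ} (hCf : 0 ≤ Cf) (hLf : 0 < Lf) (hμψ : 0 < μψ) (hρ : 0 < ρ)
    (ha : 0 ≤ a) (hA : 0 ≤ A) :
    ∃ c K : ℝ, 0 < c ∧ c ≤ 1 / 2 ∧ 0 < K ∧
      ∀ {d n : ℕ} {Z : Fin n → Type w} [∀ i, MeasurableSpace (Z i)] {p : Problem V d n Z}
        {ψ : Fin n → DGF V} {S B : ℕ} {μ ε M θ : ℝ}, AccuracyScale n S B μ c ε M θ →
        p.Assumptions b μ Cf Lf Cg σ₀ σ₁ δ → (∀ i, (ψ i).Admissible (p.f i) μψ ρ) →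
        (a ≤ μ * θ / (1 - θ) → ∃ k₁ k₂, 0 ≤ k₂ ∧ p.LinearizationBound k₁ k₂ ∧
          Cf * k₁ ≤ μ * θ / (1 - θ) / 8 ∧ Cf * k₂ ≤ A * (c * ε)) →
        Problem.ReachesAccuracy.{u, w, v} p ψ S B μ θ (μ * θ / (1 - θ)) (S / (n * (1 - θ))) ε
          (K * (M / ε)) := by
  have := b.finiteDimensional_of_finite
  let L : V ≃L[ℝ] Primal m :=
    (b.equivFun.trans (WithLp.linearEquiv 2 ℝ (Fin m → ℝ)).symm).toContinuousLinearEquiv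
  have distortion_nonneg : 0 ≤ distortion L := by rw [distortion]; positivity
  obtain ⟨r, r_pos, r_le_one, r_le⟩ : ∃ r, 0 < r ∧ r ≤ 1 ∧ r ≤ ρ :=
    ⟨min 1 ρ, lt_min one_pos hρ, min_le_left _ _, min_le_right _ _⟩
  obtain ⟨κ, κ_pos, κ_le, κ_le_inv⟩ : ∃ κ, 0 < κ ∧ κ ≤ μψ ∧ κ ≤ 1 / Lf :=
    ⟨min μψ (1 / Lf), lt_min hμψ (by positivity), min_le_left _ _, min_le_right _ _⟩
  have coupling_nonneg : 0 ≤ 16 * (2 * Cg ^ 2 / (r * κ)) := by positivity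
  obtain ⟨c, c_pos, c_le, le_inv_c, noise_le⟩ :=
    exists_small_constant (E := 16 * (2 * Cg ^ 2 / (r * κ)) + a)
      (A := 5 * distortion L * σ₀ ^ 2 / κ + 8 * (δ ^ 2 + Cf ^ 2 * σ₁ ^ 2) + A)
      (by positivity) (by positivity) (by positivity : 0 < r / 8)
  refine ⟨c, 8 / (r * c), c_pos, c_le, by positivity, ?_⟩
  intro d n Z _ p ψ S B μ ε M θ sc h hψ exists_lin
  have η_large := le_inv_c.trans sc.one_div_le_η
  obtain ⟨k₁, k₂, k₂_nonneg, lin, curvature, k₂_le⟩ := exists_lin (by linarith)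
  have sch := sc.schedule r_le_one
  have reg : StepRegime Cf Lf Cg r κ θ (μ * θ / (1 - θ)) (S / (n * (1 - θ))) k₁ :=
    ⟨hCf, hLf, r_pos, r_le_one, κ_pos, κ_le_inv, by linarith [sch.half_le_θ], sch.θ_lt_one.le,
      by linarith [sch.ρ_le], sch.η_pos, by linarith, curvature⟩
  have budget : noiseLevel (distortion L) S B Cf σ₀ σ₁ δ κ (μ * θ / (1 - θ))
      (S / (n * (1 - θ))) k₂ ≤ r / 8 * ε := by
    have := mul_le_mul_of_nonneg_right noise_le sc.ε_pos.le
    linarith [sc.noiseLevel_le (Cf := Cf) (σ₀ := σ₀) (σ₁ := σ₁) (δ := δ) (k₂ := k₂)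
      distortion_nonneg κ_pos.le]
  convert h.reachesAccuracy reg sch lin k₂_nonneg (fun i => (hψ i).mono hμψ.le κ_le r_le) L
    sc.B_pos sc.ε_pos budget using 1
  rw [sc.one_sub_eq]
  field_simp

end Main

end CFCCO

theorem theorem1 {V : Type u} [NormedAddCommGroup V] [NormedSpace ℝ V] {m : ℕ}
    (b : Module.Basis (Fin m) ℝ V)
    (Cf Lf Cg Lg μψ ρ σ₀ σ₁ δ : ℝ) (hCf : 0 < Cf) (hLf : 0 < Lf) (hCg : 0 < Cg) (hLg : 0 < Lg)
    (hμψ : 0 < μψ) (hρ : 0 < ρ) :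
    -- (i) smooth inner functions
    (∃ c K : ℝ, 0 < c ∧ c < 1 ∧ 0 < K ∧
      ∀ (d n : ℕ) (Z : Fin n → Type w) [∀ i, MeasurableSpace (Z i)] (p : Problem V d n Z)
        (ψ : Fin n → DGF V) (S B : ℕ) (μ ε M θ : ℝ),
        0 < μ → 1 ≤ S → S ≤ n → 1 ≤ B → 0 < ε → ε ≤ 1 / B →
        p.Assumptions b μ Cf Lf Cg σ₀ σ₁ δ → (∀ i, (ψ i).Admissible (p.f i) μψ ρ) →
        p.InnerSmooth Lg →
        M = max (max (1 / (μ * S)) (1 / (μ * B))) (n / (B * S)) →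
        θ = 1 - c * ε / M →
        Problem.ReachesAccuracy.{u, w, v} p ψ S B μ θ (μ * θ / (1 - θ)) (S / (n * (1 - θ))) ε
          (K * (M / ε))) ∧
    -- (ii) possibly non-smooth inner functions
    (∃ c K : ℝ, 0 < c ∧ c < 1 ∧ 0 < K ∧
      ∀ (d n : ℕ) (Z : Fin n → Type w) [∀ i, MeasurableSpace (Z i)] (p : Problem V d n Z)
        (ψ : Fin n → DGF V) (S B : ℕ) (μ ε M θ : ℝ),
        0 < μ → 1 ≤ S → S ≤ n → 1 ≤ B → 0 < ε → ε ≤ 1 / B →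
        p.Assumptions b μ Cf Lf Cg σ₀ σ₁ δ → (∀ i, (ψ i).Admissible (p.f i) μψ ρ) →
        M = max (1 / μ) (n / (B * S)) →
        θ = 1 - c * ε / M →
        Problem.ReachesAccuracy.{u, w, v} p ψ S B μ θ (μ * θ / (1 - θ)) (S / (n * (1 - θ))) ε
          (K * (M / ε))) := by
  constructor
  · obtain ⟨c, K, c_pos, c_le, K_pos, reaches⟩ :=
      exists_reachesAccuracy_of_linearizationBound.{u, w, v} b (Cg := Cg) (σ₀ := σ₀) (σ₁ := σ₁)
        (δ := δ) (a := 4 * Cf * Lg) (A := 0) hCf.le hLf hμψ hρ (by positivity) le_rfl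
    refine ⟨c, K, c_pos, by linarith, K_pos, ?_⟩
    intro d n Z _ p ψ S B μ ε M θ hμ hS hSn hB hε hεB h hψ smooth hM hθ
    obtain ⟨⟨outer_le, inner_le⟩, dual_le⟩ :
        (1 / (μ * S) ≤ M ∧ 1 / (μ * B) ≤ M) ∧ (n : ℝ) / (B * S) ≤ M := by
      simpa only [max_le_iff] using hM.ge
    exact reaches ⟨hS, hSn, hB, hμ, c_pos, c_le, hε, hεB, outer_le, inner_le, dual_le, hθ⟩ h hψ
      fun η_large => ⟨Lg / 2, 0, le_rfl, smooth.linearizationBound, by linarith, by simp⟩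
  · obtain ⟨c, K, c_pos, c_le, K_pos, reaches⟩ :=
      exists_reachesAccuracy_of_linearizationBound.{u, w, v} b (Cg := Cg) (σ₀ := σ₀) (σ₁ := σ₁)
        (δ := δ) (a := 0) (A := 16 * Cf ^ 2 * Cg ^ 2) hCf.le hLf hμψ hρ le_rfl (by positivity)
    refine ⟨c, K, c_pos, by linarith, K_pos, ?_⟩
    intro d n Z _ p ψ S B μ ε M θ hμ hS hSn hB hε hεB h hψ hM hθ
    obtain ⟨le_scale, dual_le⟩ : 1 / μ ≤ M ∧ (n : ℝ) / (B * S) ≤ M := max_le_iff.1 hM.ge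
    have batch_le {N : ℕ} (hN : 1 ≤ N) : 1 / (μ * N) ≤ M :=
      (one_div_le_one_div_of_le hμ
        (le_mul_of_one_le_right hμ.le (by exact_mod_cast hN))).trans le_scale
    have sc : AccuracyScale n S B μ c ε M θ :=
      ⟨hS, hSn, hB, hμ, c_pos, c_le, hε, hεB, batch_le hS, batch_le hB, dual_le, hθ⟩
    exact reaches sc h hψ fun _ => sc.exists_linearizationBound le_scale h hCf
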